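/- **Setting.** Let $M$ be a smooth manifold of dimension $n$ and $\pi:E\to M$ a smooth real vector bundle of rank $m$. Let $\mathcal M=\Pi E=(M,\mathcal O)$ be the split supermanifold with $\mathcal O=\Gamma_{\Lambda E^*}$, and let $\mathcal T_{\mathcal M}$ be the sheaf of superderivations of $\mathcal O$. For $f\in\mathcal O(U)$ let $\widetilde f\in C^\infty(U)$ be its reduction (degree-$0$ component). Put $\mathcal F=\Gamma_{\mathbb R\oplus E^*}\subset\mathcal O$, let $pr:\mathcal O\to\mathcal F$ be the projection onto the components of degree $\le 1$, and for $s_0+s_1\in\mathcal F(U)$ let $\psi(s_0+s_1)\in C^\infty(\pi^{-1}(U))$ be the function $e\mapsto s_0(\pi(e))+s_1(\pi(e))(e)$. Let $\mathcal L_{\bar 0}$ be the sheaf of even superderivations $X$ of $\mathcal O$ with $X(\mathcal F)\subset\mathcal F$; for $X\in\mathcal L_{\bar 0}(U)$ let $\Psi(X)$ be the vector field on $\pi^{-1}(U)$ determined by $\Psi(X)(\psi(f))=\psi(X(f))$ for all sections $f$ of $\mathcal F$. Let $g$ be a Riemannian metric on $\mathcal M$ of parity $|g|\in\{0,1\}$,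 i.e. a morphism of sheaves $g:\mathcal T_{\mathcal M}\otimes_{\mathcal O}\mathcal T_{\mathcal M}\to\mathcal O$ of parity $|g|$ such that, for homogeneous arguments, $g(fX,Y)=(-1)^{|g||f|}f\,g(X,Y)$ and $g(X,Y)=(-1)^{|X||Y|}g(Y,X)$, and such that $X\mapsto g(X,\cdot)$ is an isomorphism of $\mathcal T_{\mathcal M}$ onto the sheaf of one-forms $\mathrm{Hom}_{\mathcal O}(\mathcal T_{\mathcal M},\mathcal O)$ (shifting parities by $|g|$). The induced form $g^{TE}$ is the symmetric $C^\infty_E$-bilinear form $\mathcal T_E\otimes\mathcal T_E\to C^\infty_E$ on the manifold $E$ satisfying $$g^{TE}(\Psi(X),\Psi(Y))=\psi\big(pr(g(X,Y))\big)\qquad\text{for all open }U\subset M,\ X,Y\in\mathcal L_{\bar 0}(U).$$ Let $U\subset M$ be a coordinate domain with coordinates $(x_i)$, let $E|_U\cong U\times\mathbb R^m$ be a smooth local trivialization and $(e_\alpha)$ a basis of $\mathbb R^m$, giving coordinates $(x_i,e^*_\alpha)$ both on the manifold $\pi^{-1}(U)\subset E$ and on the supermanifold $\mathcal M|_U$.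 Let $(\partial_i,\partial_\alpha)$ be the coordinate derivations of $C^\infty_E$ on $\pi^{-1}(U)$, and $(\hat\partial_i,\hat\partial_\alpha)$ the coordinate superderivations of $\mathcal O|_U$ ($\hat\partial_i$ even, $\hat\partial_\alpha$ odd, dual to the coordinates). For any even or odd indices $r,s$ write $g_{rs}=g(\hat\partial_r,\hat\partial_s)\in\mathcal O(U)$ and $g^{TE}_{rs}=g^{TE}(\partial_r,\partial_s)\in C^\infty(\pi^{-1}(U))$. **Lemma.** The form $g^{TE}$ exists and is unique, the coordinate derivations $(\partial_i,\partial_\alpha)$ and superderivations $(\hat\partial_i,\hat\partial_\alpha)$ exist and are unique, and for all $i,j,\alpha,\beta$: * if $|g|=0$: $\; g^{TE}_{ij}=\widetilde{g}_{ij}\circ\pi,\quad g^{TE}_{i\alpha}=0,\quad g^{TE}_{\alpha i}=0,\quad g^{TE}_{\alpha\beta}=0$; * if $|g|=1$: $\; g^{TE}_{ij}=\sum_\beta e_\beta^*\cdot\big(\widetilde{\hat\partial_\beta g_{ij}}\circ\pi\big),\quad g^{TE}_{i\alpha}=-\widetilde{g}_{i\alpha}\circ\pi,\quad g^{TE}_{\alpha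 i}=-\widetilde{g}_{\alpha i}\circ\pi,\quad g^{TE}_{\alpha\beta}=0$. -/

import Mathlib

open Bundle TopologicalSpace Manifold ContDiff

noncomputable section

namespace SplitSuper

/-- The sign `(-1) ^ a` of a parity `a`. -/
def sgn (a : ZMod 2) : ℝ := if a = 0 then 1 else -1

/-- Real-valued smooth functions on an open subset of a manifold. -/
abbrev Smooth {B H N : Type*} [NormedAddCommGroup B] [NormedSpace ℝ B] [TopologicalSpace H]
    [TopologicalSpace N] [ChartedSpace H N] (I : ModelWithCorners ℝ B H) (V : Opens N) : Type _ :=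
  C^∞⟮I, V; 𝓘(ℝ, ℝ), ℝ⟯

/-- Restriction of smooth functions to a smaller open subset. -/
def Smooth.res {B H N : Type*} [NormedAddCommGroup B] [NormedSpace ℝ B] [TopologicalSpace H]
    [TopologicalSpace N] [ChartedSpace H N] {I : ModelWithCorners ℝ B H} {V W : Opens N}
    (h : W ≤ V) (f : Smooth I V) : Smooth I W :=
  ⟨fun x => f ⟨x, h x.2⟩, f.contMDiff.comp (contMDiff_inclusion h)⟩

section TangentSheaf

/-! ### The classical tangent sheaf and symmetric bilinear forms of a manifold -/

variable {B H N : Type*} [NormedAddCommGroup B] [NormedSpace ℝ B] [TopologicalSpace H]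
    [TopologicalSpace N] [ChartedSpace H N] (I : ModelWithCorners ℝ B H)

/-- The derivations of the sheaf of smooth functions on `V`, i.e. families of derivations of
`C^∞(W)`, for `W ⊆ V` open, that commute with restrictions. -/
def vectSubmodule (V : Opens N) :
    Submodule ℝ (∀ W : {W : Opens N // W ≤ V}, Derivation ℝ (Smooth I W.1) (Smooth I W.1)) where
  carrier := {X | ∀ (W W' : Opens N) (hW : W ≤ V) (h : W' ≤ W) (f : Smooth I W),
    (X ⟨W, hW⟩ f).res h = X ⟨W', h.trans hW⟩ (f.res h)}
  add_mem' {X Y} hX hY W W' hW h f := by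
    change (X ⟨W, hW⟩ f + Y ⟨W, hW⟩ f).res h = X ⟨W', _⟩ (f.res h) + Y ⟨W', _⟩ (f.res h)
    rw [← hX W W' hW h f, ← hY W W' hW h f]
    rfl
  zero_mem' _ _ _ _ _ := rfl
  smul_mem' c X hX W W' hW h f := by
    change (c • X ⟨W, hW⟩ f).res h = c • X ⟨W', _⟩ (f.res h)
    rw [← hX W W' hW h f]
    rfl

/-- Sections over `V` of the tangent sheaf. -/
abbrev Vect (V : Opens N) : Type _ := vectSubmodule I V

variable {I}

/-- Restriction of vector fields. -/
def Vect.res {V V' : Opens N} (h : V' ≤ V) (X : Vect I V) : Vect I V' :=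
  ⟨fun W => X.1 ⟨W, W.2.trans h⟩, fun W W' hW h' f => X.2 W W' (hW.trans h) h' f⟩

/-- The vector field `f X`. -/
def Vect.mul {V : Opens N} (f : Smooth I V) (X : Vect I V) : Vect I V :=
  ⟨fun W => f.res W.2 • X.1 W, fun W W' hW h k => by
    change (f.res hW * X.1 ⟨W, hW⟩ k).res h = f.res (h.trans hW) * X.1 ⟨W', _⟩ (k.res h)
    rw [← X.2 W W' hW h k]
    rfl⟩

variable (I N)

/-- A symmetric bilinear form on a manifold: a morphism of sheaves of modules
`𝒯 ⊗ 𝒯 → C^∞` that is symmetric and `C^∞`-linear in each argument. -/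
@[ext]
structure SymmForm where
  /-- the form on the sections over an open set -/
  form : ∀ V : Opens N, Vect I V →ₗ[ℝ] Vect I V →ₗ[ℝ] Smooth I V
  form_res : ∀ {V V' : Opens N} (h : V' ≤ V) (X Y : Vect I V),
    (form V X Y).res h = form V' (X.res h) (Y.res h)
  form_mul : ∀ (V : Opens N) (f : Smooth I V) (X Y : Vect I V),
    form V (X.mul f) Y = f * form V X Y
  form_symm : ∀ (V : Opens N) (X Y : Vect I V), form V X Y = form V Y X

end TangentSheaf

section Super

/-! ### The split supermanifold `ΠE` of a vector bundle `E → M` of rank `m`, `dim M = n` -/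

variable (n m : ℕ) {M : Type*} [TopologicalSpace M] [ChartedSpace (EuclideanSpace ℝ (Fin n)) M]
  (E : M → Type*) [∀ x, AddCommGroup (E x)] [∀ x, Module ℝ (E x)] [∀ x, TopologicalSpace (E x)]
  [TopologicalSpace (TotalSpace (EuclideanSpace ℝ (Fin m)) E)]
  [FiberBundle (EuclideanSpace ℝ (Fin m)) E]

/-- The total space of the bundle. -/
abbrev Tot : Type _ := TotalSpace (EuclideanSpace ℝ (Fin m)) E

/-- The model with corners of the total space. -/
abbrev totModel := (𝓡 n).prod 𝓘(ℝ, EuclideanSpace ℝ (Fin m))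

/-- The open subset `π⁻¹(U)` of the total space. -/
def preim (U : Opens M) : Opens (Tot m E) :=
  ⟨π (EuclideanSpace ℝ (Fin m)) E ⁻¹' U,
    U.isOpen.preimage (FiberBundle.continuous_proj (EuclideanSpace ℝ (Fin m)) E)⟩

variable {m E} in
/-- The projection `π⁻¹(U) → U`. -/
def proj {U : Opens M} (e : preim m E U) : U := ⟨e.1.proj, e.2⟩

variable {E}

/-- The fibre at `x` of the bundle `Λ E^*`. -/
abbrev Lam (E : M → Type*) [∀ x, AddCommGroup (E x)] [∀ x, Module ℝ (E x)] (x : M) : Type _ :=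
  ExteriorAlgebra ℝ (Module.Dual ℝ (E x))

/-- Smooth sections of `E^*` over `U`: the corresponding fibrewise linear function on `π⁻¹(U)` is
smooth. -/
def IsSmoothDual (U : Opens M) (η : ∀ x : U, Module.Dual ℝ (E x)) : Prop :=
  ContMDiff (totModel n m) 𝓘(ℝ, ℝ) ∞ (fun e : preim m E U => η (proj e) e.1.snd)

/-- Smooth functions and smooth sections of `E^*`, as sections of `Λ E^*`. -/
def superGens (U : Opens M) : Set (∀ x : U, Lam E x) :=
  {s | ∃ f : Smooth (𝓡 n) U, s = fun x : U => algebraMap ℝ (Lam E x) (f x)} ∪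
  {s | ∃ η : ∀ x : U, Module.Dual ℝ (E x), IsSmoothDual n m U η ∧
    s = fun x : U => ExteriorAlgebra.ι ℝ (η x)}

/-- Restriction of arbitrary sections of `Λ E^*`. -/
def resSec {U V : Opens M} (h : V ≤ U) : (∀ x : U, Lam E x) →ₐ[ℝ] (∀ x : V, Lam E x) where
  toFun s x := s ⟨x, h x.2⟩
  map_one' := rfl
  map_mul' _ _ := rfl
  map_zero' := rfl
  map_add' _ _ := rfl
  commutes' _ := rfl

theorem resSec_mem_adjoin {U V : Opens M} (h : V ≤ U) {s : ∀ x : U, Lam E x}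
    (hs : s ∈ Algebra.adjoin ℝ (superGens n m U)) :
    resSec h s ∈ Algebra.adjoin ℝ (superGens n m V) := by
  have key : Algebra.adjoin ℝ (superGens n m U) ≤
      (Algebra.adjoin ℝ (superGens n m V)).comap (resSec (E := E) h) := by
    refine Algebra.adjoin_le ?_
    rintro s (⟨f, rfl⟩ | ⟨η, hη, rfl⟩)
    · exact Algebra.subset_adjoin (Or.inl ⟨f.res h, rfl⟩)
    · have hp : preim m E V ≤ preim m E U := fun e he => h he
      exact Algebra.subset_adjoin (Or.inr ⟨fun x => η ⟨x, h x.2⟩,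
        ContMDiff.comp (I' := totModel n m) hη (contMDiff_inclusion hp), rfl⟩)
  exact key hs

/-- The superfunctions on `U`, i.e. the smooth sections of `Λ E^*` over `U`: the sections that are
locally sums of products of smooth functions and smooth sections of `E^*`. -/
def superFunSubalgebra (E : M → Type*) [∀ x, AddCommGroup (E x)] [∀ x, Module ℝ (E x)]
    [∀ x, TopologicalSpace (E x)] [TopologicalSpace (TotalSpace (EuclideanSpace ℝ (Fin m)) E)]
    [FiberBundle (EuclideanSpace ℝ (Fin m)) E] (U : Opens M) :
    Subalgebra ℝ (∀ x : U, Lam E x) where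
  carrier := {s | ∀ x : U, ∃ (V : Opens M) (h : V ≤ U), (x : M) ∈ V ∧
    resSec h s ∈ Algebra.adjoin ℝ (superGens n m V)}
  mul_mem' {s t} hs ht x := by
    obtain ⟨V, hV, hxV, hsV⟩ := hs x
    obtain ⟨W, hW, hxW, htW⟩ := ht x
    refine ⟨V ⊓ W, inf_le_left.trans hV, ⟨hxV, hxW⟩, ?_⟩
    exact mul_mem (resSec_mem_adjoin n m inf_le_left hsV) (resSec_mem_adjoin n m inf_le_right htW)
  add_mem' {s t} hs ht x := by
    obtain ⟨V, hV, hxV, hsV⟩ := hs x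
    obtain ⟨W, hW, hxW, htW⟩ := ht x
    refine ⟨V ⊓ W, inf_le_left.trans hV, ⟨hxV, hxW⟩, ?_⟩
    exact add_mem (resSec_mem_adjoin n m inf_le_left hsV) (resSec_mem_adjoin n m inf_le_right htW)
  algebraMap_mem' r x := ⟨U, le_rfl, x.2, Subalgebra.algebraMap_mem _ r⟩

/-- The algebra of superfunctions on `U`. -/
abbrev SuperFun (E : M → Type*) [∀ x, AddCommGroup (E x)] [∀ x, Module ℝ (E x)]
    [∀ x, TopologicalSpace (E x)] [TopologicalSpace (TotalSpace (EuclideanSpace ℝ (Fin m)) E)]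
    [FiberBundle (EuclideanSpace ℝ (Fin m)) E] (U : Opens M) : Type _ :=
  superFunSubalgebra n m E U

variable {n m}

theorem mem_superFun_of_gens {U : Opens M} {s : ∀ x : U, Lam E x} (hs : s ∈ superGens n m U) :
    s ∈ superFunSubalgebra n m E U :=
  fun x => ⟨U, le_rfl, x.2, Algebra.subset_adjoin hs⟩

/-- Restriction of superfunctions. -/
def SuperFun.res {U V : Opens M} (h : V ≤ U) (f : SuperFun n m E U) : SuperFun n m E V :=
  ⟨resSec h f.1, fun x => by
    obtain ⟨W, hW, hxW, hs⟩ := f.2 ⟨x, h x.2⟩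
    exact ⟨W ⊓ V, inf_le_right, ⟨hxW, x.2⟩, resSec_mem_adjoin n m inf_le_left hs⟩⟩

/-- `f` is homogeneous of parity `a`. -/
def SuperFun.HasParity {U : Opens M} (f : SuperFun n m E U) (a : ZMod 2) : Prop :=
  ∀ x : U, f.1 x ∈ CliffordAlgebra.evenOdd (0 : QuadraticForm ℝ (Module.Dual ℝ (E x))) a

/-- The reduction of a superfunction: its component of degree `0`. -/
def SuperFun.red {U : Opens M} (f : SuperFun n m E U) (x : U) : ℝ :=
  ExteriorAlgebra.algebraMapInv (f.1 x)

/-- `f` is a section of the subsheaf `ℱ` of sections of `ℝ ⊕ E^* ⊆ Λ E^*`. -/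
def SuperFun.IsAffine {U : Opens M} (f : SuperFun n m E U) : Prop :=
  ∀ x : U, ∃ (r : ℝ) (η : Module.Dual ℝ (E x)),
    f.1 x = algebraMap ℝ (Lam E x) r + ExteriorAlgebra.ι ℝ η

/-- The map `ψ ∘ pr`, where `pr` projects a superfunction on its components `s₀ + s₁` of degree at
most `1` and `ψ (s₀ + s₁)` is the function `e ↦ s₀(π(e)) + s₁(π(e))(e)` on `π⁻¹(U)`. On sections of
`ℱ` this is `ψ`, since `pr` is the identity there. -/
def SuperFun.psi {U : Opens M} (f : SuperFun n m E U) (e : preim m E U) : ℝ :=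
  f.red (proj e) + ExteriorAlgebra.ιInv (f.1 (proj e)) e.1.snd

variable (n m E) in
/-- Families of linear endomorphisms of the superfunctions on the open subsets of `U`. -/
abbrev SuperFam (U : Opens M) : Type _ :=
  ∀ V : {V : Opens M // V ≤ U}, SuperFun n m E V.1 →ₗ[ℝ] SuperFun n m E V.1

variable (n m E) in
/-- The superderivations of parity `a` over `U`: endomorphisms of the sheaf of superfunctions on `U`
that are homogeneous of parity `a` and satisfy the graded Leibniz rule. -/
def SuperDer (a : ZMod 2) (U : Opens M) : Submodule ℝ (SuperFam n m E U) where
  carrier := {X |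
    (∀ (V V' : Opens M) (hV : V ≤ U) (h : V' ≤ V) (f : SuperFun n m E V),
      (X ⟨V, hV⟩ f).res h = X ⟨V', h.trans hV⟩ (f.res h)) ∧
    (∀ (V : Opens M) (hV : V ≤ U) (b : ZMod 2) (f : SuperFun n m E V), f.HasParity b →
      (X ⟨V, hV⟩ f).HasParity (a + b)) ∧
    (∀ (V : Opens M) (hV : V ≤ U) (b : ZMod 2) (f k : SuperFun n m E V), f.HasParity b →
      X ⟨V, hV⟩ (f * k) = X ⟨V, hV⟩ f * k + sgn (a * b) • (f * X ⟨V, hV⟩ k))}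
  add_mem' {X Y} hX hY := by
    refine ⟨fun V V' hV h f => ?_, fun V hV b f hf x => ?_, fun V hV b f k hf => ?_⟩
    · change (X ⟨V, hV⟩ f + Y ⟨V, hV⟩ f).res h = X ⟨V', _⟩ (f.res h) + Y ⟨V', _⟩ (f.res h)
      rw [← hX.1 V V' hV h f, ← hY.1 V V' hV h f]
      rfl
    · exact add_mem (hX.2.1 V hV b f hf x) (hY.2.1 V hV b f hf x)
    · change X ⟨V, hV⟩ (f * k) + Y ⟨V, hV⟩ (f * k) = (X ⟨V, hV⟩ f + Y ⟨V, hV⟩ f) * k +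
        sgn (a * b) • (f * (X ⟨V, hV⟩ k + Y ⟨V, hV⟩ k))
      rw [hX.2.2 V hV b f k hf, hY.2.2 V hV b f k hf, add_mul, mul_add, smul_add]
      abel
  zero_mem' := by
    refine ⟨fun V V' hV h f => rfl, fun V hV b f hf x => zero_mem _, fun V hV b f k hf => ?_⟩
    change (0 : SuperFun n m E V) = 0 * k + sgn (a * b) • (f * 0)
    simp
  smul_mem' c X hX := by
    refine ⟨fun V V' hV h f => ?_, fun V hV b f hf x => ?_, fun V hV b f k hf => ?_⟩
    · change (c • X ⟨V, hV⟩ f).res h = c • X ⟨V', _⟩ (f.res h)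
      rw [← hX.1 V V' hV h f]
      rfl
    · exact Submodule.smul_mem _ c (hX.2.1 V hV b f hf x)
    · change c • X ⟨V, hV⟩ (f * k) = (c • X ⟨V, hV⟩ f) * k + sgn (a * b) • (f * (c • X ⟨V, hV⟩ k))
      rw [hX.2.2 V hV b f k hf, smul_add, smul_mul_assoc, mul_smul_comm, smul_comm c]

variable (n m E) in
/-- Sections over `U` of the tangent sheaf of `ΠE`: sums of an even and an odd superderivation. -/
def superVectSubmodule (U : Opens M) : Submodule ℝ (SuperFam n m E U) :=
  SuperDer n m E 0 U ⊔ SuperDer n m E 1 U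

variable (n m E) in
/-- Vector fields on `ΠE` over `U`. -/
abbrev SuperVect (U : Opens M) : Type _ := superVectSubmodule n m E U

/-- `X` is homogeneous of parity `a`. -/
def SuperVect.HasParity {U : Opens M} (X : SuperVect n m E U) (a : ZMod 2) : Prop :=
  X.1 ∈ SuperDer n m E a U

theorem SuperDer.res_mem {a : ZMod 2} {U U' : Opens M} (h : U' ≤ U) {X : SuperFam n m E U}
    (hX : X ∈ SuperDer n m E a U) :
    (fun V => X ⟨V, V.2.trans h⟩ : SuperFam n m E U') ∈ SuperDer n m E a U' :=
  ⟨fun V V' hV h' f => hX.1 V V' (hV.trans h) h' f,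
    fun V hV b f hf => hX.2.1 V (hV.trans h) b f hf,
    fun V hV b f k hf => hX.2.2 V (hV.trans h) b f k hf⟩

/-- Restriction of superderivations. -/
def SuperVect.res {U U' : Opens M} (h : U' ≤ U) (X : SuperVect n m E U) : SuperVect n m E U' :=
  ⟨fun V => X.1 ⟨V, V.2.trans h⟩, by
    obtain ⟨X, hX⟩ := X
    obtain ⟨Y, hY, Z, hZ, rfl⟩ := Submodule.mem_sup.1 hX
    exact Submodule.mem_sup.2 ⟨_, SuperDer.res_mem h hY, _, SuperDer.res_mem h hZ, rfl⟩⟩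

/-- `X' = f X`. -/
def SuperVect.IsMul {U : Opens M} (f : SuperFun n m E U) (X X' : SuperVect n m E U) : Prop :=
  ∀ (V : Opens M) (h : V ≤ U) (k : SuperFun n m E V), X'.1 ⟨V, h⟩ k = f.res h * X.1 ⟨V, h⟩ k

variable (n m E) in
/-- A one-form of parity `a` over `U`: a morphism of sheaves of parity `a` from the tangent sheaf of
`ΠE` to the structure sheaf, both restricted to `U`, that is linear over superfunctions. -/
structure OneForm (a : ZMod 2) (U : Opens M) where
  /-- the one-form on the sections over an open subset of `U` -/
  form : ∀ V : Opens M, V ≤ U → (SuperVect n m E V →ₗ[ℝ] SuperFun n m E V)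
  form_res : ∀ (V V' : Opens M) (hV : V ≤ U) (h : V' ≤ V) (Y : SuperVect n m E V),
    (form V hV Y).res h = form V' (h.trans hV) (Y.res h)
  form_parity : ∀ (V : Opens M) (hV : V ≤ U) (b : ZMod 2) (Y : SuperVect n m E V),
    Y.HasParity b → (form V hV Y).HasParity (a + b)
  form_mul : ∀ (V : Opens M) (hV : V ≤ U) (b : ZMod 2) (f : SuperFun n m E V)
    (Y Y' : SuperVect n m E V), f.HasParity b → SuperVect.IsMul f Y Y' →
    form V hV Y' = sgn (a * b) • (f * form V hV Y)

variable (n m E) in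
set_option maxHeartbeats 1000000 in
/-- A Riemannian metric of parity `p` on `ΠE` (even for `p = 0`, odd for `p = 1`): a morphism of
sheaves `𝒯 ⊗ 𝒯 → 𝒪` of parity `p` that is supersymmetric, linear over superfunctions (in the second
argument this follows, with the usual signs, from supersymmetry) and non-degenerate, i.e.
`X ↦ g(X, ·)` is a bijection of vector fields with one-forms, parities being shifted by `p`. -/
structure SuperMetric (p : ZMod 2) where
  /-- the metric on the sections over an open set -/
  form : ∀ U : Opens M, SuperVect n m E U →ₗ[ℝ] SuperVect n m E U →ₗ[ℝ] SuperFun n m E U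
  form_res : ∀ {U V : Opens M} (h : V ≤ U) (X Y : SuperVect n m E U),
    (form U X Y).res h = form V (X.res h) (Y.res h)
  form_parity : ∀ (U : Opens M) (a b : ZMod 2) (X Y : SuperVect n m E U),
    X.HasParity a → Y.HasParity b → (form U X Y).HasParity (p + a + b)
  form_mul : ∀ (U : Opens M) (a : ZMod 2) (f : SuperFun n m E U) (X X' Y : SuperVect n m E U),
    f.HasParity a → SuperVect.IsMul f X X' →
    form U X' Y = sgn (p * a) • (f * form U X Y)
  form_symm : ∀ (U : Opens M) (a b : ZMod 2) (X Y : SuperVect n m E U),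
    X.HasParity a → Y.HasParity b → form U X Y = sgn (a * b) • form U Y X
  nondeg : ∀ (U : Opens M) (a : ZMod 2) (φ : OneForm n m E (p + a) U),
    ∃! X : SuperVect n m E U, X.HasParity a ∧
      ∀ (V : Opens M) (h : V ≤ U) (Y : SuperVect n m E V), φ.form V h Y = form V (X.res h) Y

/-- `X` is a section of `ℒ₀`: an even superderivation that preserves `ℱ`. -/
def SuperVect.IsL0 {U : Opens M} (X : SuperVect n m E U) : Prop :=
  X.HasParity 0 ∧ ∀ (V : Opens M) (h : V ≤ U) (f : SuperFun n m E V),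
    f.IsAffine → (X.1 ⟨V, h⟩ f).IsAffine

/-- `X' = Ψ(X)` for a section `X` of `ℒ₀` over `U`: the vector field `X'` on `π⁻¹(U)` acts on the
functions `ψ(f)`, `f` a section of `ℱ`, by `X' (ψ(f)) = ψ(X(f))`. -/
def IsPsi {U : Opens M} (X : SuperVect n m E U)
    (X' : Vect (totModel n m) (preim m E U)) : Prop :=
  ∀ (V : Opens M) (h : V ≤ U) (h' : preim m E V ≤ preim m E U) (f : SuperFun n m E V)
    (k : Smooth (totModel n m) (preim m E V)), f.IsAffine → (∀ e, k e = f.psi e) →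
    ∀ e, X'.1 ⟨preim m E V, h'⟩ k e = (X.1 ⟨V, h⟩ f).psi e

/-- `G` is the bilinear form `g^{TE}` on the total space induced by `g`: the symmetric bilinear form
with `g^{TE}(Ψ(X), Ψ(Y)) = ψ(pr(g(X, Y)))` for all sections `X`, `Y` of `ℒ₀`. -/
def IsInduced {p : ZMod 2} (g : SuperMetric n m E p) (G : SymmForm (Tot m E) (totModel n m)) :
    Prop :=
  ∀ (U : Opens M) (X Y : SuperVect n m E U) (X' Y' : Vect (totModel n m) (preim m E U)),
    X.IsL0 → Y.IsL0 → IsPsi X X' → IsPsi Y Y' →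
    ∀ e, G.form (preim m E U) X' Y' e = (g.form U X Y).psi e

end Super

section Coordinates

/-! ### Local coordinates -/

variable (n m : ℕ) {M : Type*} [TopologicalSpace M] [ChartedSpace (EuclideanSpace ℝ (Fin n)) M]
  [IsManifold (𝓡 n) ∞ M]
  (E : M → Type*) [∀ x, AddCommGroup (E x)] [∀ x, Module ℝ (E x)] [∀ x, TopologicalSpace (E x)]
  [TopologicalSpace (TotalSpace (EuclideanSpace ℝ (Fin m)) E)]
  [FiberBundle (EuclideanSpace ℝ (Fin m)) E] [VectorBundle ℝ (EuclideanSpace ℝ (Fin m)) E]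
  [ContMDiffVectorBundle ∞ (EuclideanSpace ℝ (Fin m)) E (𝓡 n)]

/-- A coordinate domain `U` of `M` with coordinates `x_i`, over which the bundle has a smooth local
trivialization `E|_U ≅ U × F`, together with a basis `(e_α)` of `F = ℝ^m`. -/
structure BundleCoords where
  /-- the coordinate domain -/
  U : Opens M
  /-- the chart -/
  chart : OpenPartialHomeomorph M (EuclideanSpace ℝ (Fin n))
  chart_mem : chart ∈ IsManifold.maximalAtlas (𝓡 n) ∞ M
  U_le_chart : (U : Set M) ⊆ chart.source
  /-- the local trivialization -/
  triv : Trivialization (EuclideanSpace ℝ (Fin m)) (π (EuclideanSpace ℝ (Fin m)) E)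
  triv_linear : triv.IsLinear ℝ
  triv_smooth : ContMDiffOn (totModel n m) (totModel n m) ∞ triv triv.source
  triv_symm_smooth : ContMDiffOn (totModel n m) (totModel n m) ∞
    triv.toOpenPartialHomeomorph.symm triv.target
  U_le_triv : (U : Set M) ⊆ triv.baseSet
  /-- the basis of the typical fibre -/
  basis : Module.Basis (Fin m) ℝ (EuclideanSpace ℝ (Fin m))

namespace BundleCoords

variable {n m E} (c : BundleCoords n m E)

/-- The coordinate functions `x_i` on `U`. -/
def x (i : Fin n) : Smooth (𝓡 n) c.U :=
  ⟨fun y => c.chart y i, by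
    have h1 : ContMDiffOn (𝓡 n) (𝓡 n) ∞ c.chart c.chart.source :=
      contMDiffOn_of_mem_maximalAtlas c.chart_mem
    have h2 : ContMDiff (𝓡 n) (𝓡 n) ∞ (fun y : c.U => c.chart y) :=
      h1.comp_contMDiff contMDiff_subtype_val fun y => c.U_le_chart y.2
    exact (EuclideanSpace.proj (𝕜 := ℝ) i).contMDiff.comp h2⟩

/-- The local frame `e_α^*` of `E^*` over `U`. -/
def coframe (α : Fin m) (y : c.U) : Module.Dual ℝ (E y) :=
  have := c.triv_linear
  c.basis.coord α ∘ₗ c.triv.linearMapAt ℝ (y : M)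

theorem coframe_apply (α : Fin m) (e : preim m E c.U) :
    c.coframe α (proj e) e.1.snd = c.basis.coord α (c.triv e.1).2 := by
  have := c.triv_linear
  have h : e.1.proj ∈ c.triv.baseSet := c.U_le_triv e.2
  exact congrArg (c.basis.coord α)
    (congrFun (c.triv.coe_linearMapAt_of_mem (R := ℝ) h) e.1.snd)

theorem coframe_smooth (α : Fin m) : IsSmoothDual n m c.U (c.coframe α) := by
  unfold IsSmoothDual
  simp only [coframe_apply]
  have h2 : ContMDiff (totModel n m) (totModel n m) ∞
      (fun e : preim m E c.U => c.triv e.1) :=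
    c.triv_smooth.comp_contMDiff contMDiff_subtype_val fun e =>
      c.triv.mem_source.2 (c.U_le_triv e.2)
  exact (LinearMap.toContinuousLinearMap (c.basis.coord α)).contMDiff.comp
    (contMDiff_snd.comp h2)

/-- The coordinates `(x_i, e_α^*)` of `ΠE`, as superfunctions on `U`. -/
def superCoord : Fin n ⊕ Fin m → SuperFun n m E c.U
  | .inl i => ⟨fun y => algebraMap ℝ (Lam E y) (c.x i y), mem_superFun_of_gens (Or.inl ⟨c.x i, rfl⟩)⟩
  | .inr α => ⟨fun y => ExteriorAlgebra.ι ℝ (c.coframe α y),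
      mem_superFun_of_gens (Or.inr ⟨_, c.coframe_smooth α, rfl⟩)⟩

/-- The coordinates `(x_i, e_α^*)` of the total space, as smooth functions on `π⁻¹(U)`. -/
def coord : Fin n ⊕ Fin m → Smooth (totModel n m) (preim m E c.U)
  | .inl i => ⟨fun e => c.x i (proj e), by
      have h1 : ContMDiff (totModel n m) (𝓡 n) ∞ (fun e : preim m E c.U => e.1.proj) :=
        (contMDiff_proj E).comp contMDiff_subtype_val
      have h2 : ContMDiffOn (𝓡 n) (𝓡 n) ∞ c.chart c.chart.source :=
        contMDiffOn_of_mem_maximalAtlas c.chart_mem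
      have h3 : ContMDiff (totModel n m) (𝓡 n) ∞ (fun e : preim m E c.U => c.chart e.1.proj) :=
        h2.comp_contMDiff h1 fun e => c.U_le_chart e.2
      exact (EuclideanSpace.proj (𝕜 := ℝ) i).contMDiff.comp h3⟩
  | .inr α => ⟨fun e => c.coframe α (proj e) e.1.snd, c.coframe_smooth α⟩

/-- `D` is the family of coordinate superderivations `(∂̂_i, ∂̂_α)` of `ΠE` over `U`: the `∂̂_i` are
even, the `∂̂_α` are odd, and they are dual to the coordinates. -/
def IsSuperFrame (D : Fin n ⊕ Fin m → SuperVect n m E c.U) : Prop :=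
  (∀ i, (D (.inl i)).HasParity 0) ∧ (∀ α, (D (.inr α)).HasParity 1) ∧
  ∀ r s, (D r).1 ⟨c.U, le_rfl⟩ (c.superCoord s) = if r = s then 1 else 0

/-- `D` is the family of coordinate derivations `(∂_i, ∂_α)` of the total space over `π⁻¹(U)`. -/
def IsFrame (D : Fin n ⊕ Fin m → Vect (totModel n m) (preim m E c.U)) : Prop :=
  ∀ r s, (D r).1 ⟨preim m E c.U, le_rfl⟩ (c.coord s) = if r = s then 1 else 0

end BundleCoords

end Coordinates

end SplitSuper

end

noncomputable section

set_option linter.unusedSectionVars false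

namespace SplitSuper

/-! ### Hadamard's lemma in a finite-dimensional space of tuples. -/

section Hadamard

open MeasureTheory Set

/-! Over a coordinate domain, a section `X` of ℒ₀ has the form Σ fᵢ ∂̂ᵢ + Σ ξ_α ∂̂_α with smooth
functions fᵢ and sections ξ_α of E^*: by parity, an even derivation that preserves ℱ sends functions
to functions and sections of E^* to sections of E^*. The vector field Ψ(X) has the coefficients fᵢ∘π
and ψ(ξ_α) with respect to ∂ᵢ and ∂_α.

Expand ψ(pr(g(X, Y))) in these coefficients. Functions pull out unchanged. Pulling out an odd
coefficient ξ_α costs the sign (-1)^|g|, and the projection to degree at most one then sees only the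
reduction of the remaining factor; terms with two odd coefficients have degree at least two and
disappear. So on Ψ-images the required form is the coordinate form with coefficients ψ(pr(g_ij)),
(-1)^|g| g̃_iα∘π and 0 (`coordForm_inducedCoeff`).

For uniqueness, ∂ᵢ is Ψ(∂̂ᵢ). The odd ∂̂_α is not in ℒ₀, but e_α^* ∂̂_α is, with image e_α^* ∂_α,
and e_α^* is not a zero divisor among smooth functions (`eq_zero_of_coord_mul`). Hence a
function-bilinear form is determined by its values on Ψ-images (`bilin_ext_of_isPsi`). The same fact
shows that the coordinate forms of two charts agree on overlaps, because both satisfy the same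
coordinate-free identity; so they glue to a global form, and no transformation law has to be
computed.

The stated formulas follow by parity. For |g| = 0 the g_ij are even and have no degree-one part,
while the g_iα are odd and have zero reduction. For |g| = 1 the g_ij are odd, so ψ(pr(g_ij)) is
their degree-one part, whose coefficient along e_β^* is the reduction of ∂̂_β g_ij
(`algebraMapInv_contractLeft`).

Coordinate derivations are unique by Hadamard's lemma applied at each point (`pointDerivation_eq`),
combined for superderivations with local generation of superfunctions by functions and the coframe.
The odd ones exist as contractions with a local frame of E; the even ones differentiate
componentwise after the exterior bundle has been trivialized. -/

theorem contDiff_parametric_intervalIntegral {P E' : Type*} [NormedAddCommGroup P]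
    [NormedSpace ℝ P] [NormedAddCommGroup E'] [NormedSpace ℝ E'] [CompleteSpace E']
    {F : P × ℝ → E'} (hF : ContDiff ℝ ∞ F) :
    ContDiff ℝ ∞ fun p => ∫ t in (0 : ℝ)..1, F (p, t) := by
  -- The integral is the convolution at 0 of the indicator of (0, 1] with `y ↦ F (p, -y)`. The bump
  -- function equals 1 on [-1, 1], so it does not change this value, and it supplies the compact
  -- support required for smoothness of a convolution with parameters.
  let χ : ContDiffBump (0 : ℝ) := ⟨1, 2, one_pos, one_lt_two⟩
  let f : ℝ → ℝ := (Ioc (0 : ℝ) 1).indicator fun _ => 1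
  let g : P → ℝ → E' := fun p y => χ y • F (p, -y)
  have hf : LocallyIntegrable f volume :=
    ((integrableOn_const (by simp)).integrable_indicator measurableSet_Ioc).locallyIntegrable
  have hg : ContDiff ℝ ∞ (Function.uncurry g) :=
    (χ.contDiff.comp contDiff_snd).smul (hF.comp (contDiff_fst.prodMk contDiff_snd.neg))
  have key := contDiffOn_convolution_right_with_param_comp (n := ⊤) (μ := volume)
    (ContinuousLinearMap.lsmul ℝ ℝ : ℝ →L[ℝ] E' →L[ℝ] E') (s := (univ : Set P))
    (v := fun _ => (0 : ℝ)) contDiffOn_const (f := f) (g := g) (k := Metric.closedBall 0 2)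
    isOpen_univ (isCompact_closedBall _ _) (fun p x _ hx => by
      have : χ x = 0 := χ.zero_of_le_dist (by
        simp only [Metric.mem_closedBall, not_le] at hx
        exact hx.le)
      simp [g, this]) hf hg.contDiffOn
  rw [contDiffOn_univ] at key
  convert key using 1
  ext p
  rw [convolution_def, intervalIntegral.integral_of_le zero_le_one, ← integral_indicator
    measurableSet_Ioc]
  congr 1
  ext t
  by_cases ht : t ∈ Ioc (0 : ℝ) 1
  · have h1 : χ (-t) = 1 := χ.one_of_mem_closedBall (by
      simp only [Metric.mem_closedBall, dist_zero_right, norm_neg, Real.norm_eq_abs]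
      exact abs_le.2 ⟨by linarith [ht.1], ht.2⟩)
    simp [f, g, ht, h1]
  · simp [f, g, ht]

theorem exists_hadamard_of_contDiff {κ : Type*} [Fintype κ] [DecidableEq κ] {g : (κ → ℝ) → ℝ}
    (hg : ContDiff ℝ ∞ g) (a : κ → ℝ) :
    ∃ h : κ → (κ → ℝ) → ℝ, (∀ i, ContDiff ℝ ∞ (h i)) ∧
      ∀ y, g y = g a + ∑ i, (y i - a i) * h i y := by
  -- The witnesses come from integrating the derivative of `g` along the segment from `a` to `y` and
  -- splitting `y - a` along the standard basis.
  refine ⟨fun i y => ∫ t in (0 : ℝ)..1, fderiv ℝ g (a + t • (y - a)) (Pi.single i 1),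
    fun i => ?_, fun y => ?_⟩
  · refine contDiff_parametric_intervalIntegral
      (F := fun q : (κ → ℝ) × ℝ => fderiv ℝ g (a + q.2 • (q.1 - a)) (Pi.single i 1)) ?_
    have h1 : ContDiff ℝ ∞ (fderiv ℝ g) := hg.fderiv_right le_rfl
    refine ContDiff.clm_apply (h1.comp ?_) contDiff_const
    fun_prop
  · have hd : ∀ t : ℝ, HasDerivAt (fun t : ℝ => g (a + t • (y - a)))
        (fderiv ℝ g (a + t • (y - a)) (y - a)) t := fun t => by
      have h1 : HasDerivAt (fun t : ℝ => a + t • (y - a)) (y - a) t := by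
        simpa using ((hasDerivAt_id t).smul_const (y - a)).const_add a
      exact ((hg.differentiable (by simp)) _).hasFDerivAt.comp_hasDerivAt t h1
    have hc : ∀ v, Continuous fun t : ℝ => fderiv ℝ g (a + t • (y - a)) v := fun v => by
      have h1 : Continuous (fderiv ℝ g) := hg.continuous_fderiv (by simp)
      have h2 : Continuous fun t : ℝ => fderiv ℝ g (a + t • (y - a)) := h1.comp (by fun_prop)
      exact h2.clm_apply continuous_const
    have hI := intervalIntegral.integral_eq_sub_of_hasDerivAt (a := 0) (b := 1)
      (fun t _ => hd t) ((hc (y - a)).intervalIntegrable _ _)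
    have hs : ∀ t : ℝ, fderiv ℝ g (a + t • (y - a)) (y - a) =
        ∑ i, (y i - a i) * fderiv ℝ g (a + t • (y - a)) (Pi.single i 1) := fun t => by
      have hv : y - a = ∑ i, (y i - a i) • (Pi.single i 1 : κ → ℝ) := by
        ext j
        simp [Finset.sum_apply, Pi.single_apply]
      refine (congrArg (fderiv ℝ g (a + t • (y - a))) hv).trans ?_
      rw [map_sum]
      simp only [map_smul, smul_eq_mul]
    simp only [hs] at hI
    rw [intervalIntegral.integral_finsetSum fun i _ =>
      ((hc (Pi.single i 1)).const_mul _).intervalIntegrable _ _] at hI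
    simp only [intervalIntegral.integral_const_mul] at hI
    rw [hI]
    simp

theorem exists_hadamard_of_contDiffOn {κ : Type*} [Fintype κ] [DecidableEq κ]
    {g : (κ → ℝ) → ℝ} {s : Set (κ → ℝ)} (hs : IsOpen s) (hg : ContDiffOn ℝ ∞ g s) {a : κ → ℝ}
    (ha : a ∈ s) :
    ∃ (t : Set (κ → ℝ)) (h : κ → (κ → ℝ) → ℝ), IsOpen t ∧ t ⊆ s ∧ a ∈ t ∧
      (∀ i, ContDiff ℝ ∞ (h i)) ∧ ∀ y ∈ t, g y = g a + ∑ i, (y i - a i) * h i y := by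
  obtain ⟨r, hr, hrs⟩ := Metric.isOpen_iff.1 hs a ha
  -- The cutoff makes `χ * g` smooth everywhere, since its support stays inside the ball of radius
  -- `r` contained in `s`. The global statement then applies, and the product equals `g` on the ball
  -- of radius `r / 4`.
  let χ : ContDiffBump a := ⟨r / 4, r / 2, by positivity, by linarith⟩
  have hG : ContDiff ℝ ∞ fun y => χ y * g y := by
    rw [contDiff_iff_contDiffAt]
    intro y
    by_cases hy : y ∈ s
    · exact χ.contDiff.contDiffAt.mul (hg.contDiffAt (hs.mem_nhds hy))
    · have h1 : y ∈ (Metric.closedBall a (r / 2))ᶜ := fun h =>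
        hy (hrs (Metric.closedBall_subset_ball (by linarith) h))
      refine (contDiffAt_const (c := (0 : ℝ))).congr_of_eventuallyEq ?_
      filter_upwards [Metric.isClosed_closedBall.isOpen_compl.mem_nhds h1] with z hz
      have : χ z = 0 := χ.zero_of_le_dist (by
        simp only [mem_compl_iff, Metric.mem_closedBall, not_le] at hz
        exact hz.le)
      simp [this]
  have hχ : ∀ y ∈ Metric.ball a (r / 4), χ y = 1 := fun y hy =>
    χ.one_of_mem_closedBall (Metric.ball_subset_closedBall hy)
  obtain ⟨h, hh, he⟩ := exists_hadamard_of_contDiff hG a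
  refine ⟨Metric.ball a (r / 4), h, Metric.isOpen_ball,
    (Metric.ball_subset_ball (by linarith)).trans hrs, Metric.mem_ball_self (by positivity), hh,
    fun y hy => ?_⟩
  have := he y
  simpa [hχ y hy, hχ a (Metric.mem_ball_self (by positivity))] using this

end Hadamard

/-! ### Coordinate systems, partial derivatives and derivations at a point. -/

section LocalCoords

open scoped Topology

variable {B H N : Type*} [NormedAddCommGroup B] [NormedSpace ℝ B] [TopologicalSpace H]
    [TopologicalSpace N] [ChartedSpace H N] {I : ModelWithCorners ℝ B H}

variable (I N) in
/-- A smooth coordinate system on an open subset of a manifold. -/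
structure LocalCoords (κ : Type*) [Fintype κ] where
  /-- the coordinate domain -/
  U : Opens N
  /-- the coordinate map -/
  φ : OpenPartialHomeomorph N (κ → ℝ)
  smooth : ContMDiffOn I 𝓘(ℝ, κ → ℝ) ∞ φ φ.source
  symm_smooth : ContMDiffOn 𝓘(ℝ, κ → ℝ) I ∞ φ.symm φ.target
  le_source : (U : Set N) ⊆ φ.source

open Classical in
/-- Extension by zero of a smooth function on an open subset. -/
def Smooth.extend {V : Opens N} (f : Smooth I V) (y : N) : ℝ := if h : y ∈ V then f ⟨y, h⟩ else 0

namespace Smooth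

variable {V W : Opens N}

@[simp] theorem res_apply (h : W ≤ V) (f : Smooth I V) (x : W) : f.res h x = f ⟨x, h x.2⟩ := rfl

theorem extend_of_mem (f : Smooth I V) {y : N} (h : y ∈ V) : f.extend y = f ⟨y, h⟩ := dif_pos h

theorem extend_add (f g : Smooth I V) : (f + g).extend = f.extend + g.extend := by
  ext y; by_cases h : y ∈ V <;> simp [extend, h]

theorem extend_smul (r : ℝ) (f : Smooth I V) : (r • f).extend = r • f.extend := by
  ext y; by_cases h : y ∈ V <;> simp [extend, h]

theorem extend_mul (f g : Smooth I V) : (f * g).extend = f.extend * g.extend := by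
  ext y; by_cases h : y ∈ V <;> simp [extend, h]

/-- At a point of the open set `V` the extension by zero has the same germ as `f`, so nothing is
lost by passing to a function on all of `N`, which can be composed with the inverse chart. What the
extension does outside `V` never matters. -/
theorem contMDiffAt_extend (f : Smooth I V) {y : N} (h : y ∈ V) :
    ContMDiffAt I 𝓘(ℝ, ℝ) ∞ f.extend y := by
  have h1 : (fun x : V => f.extend x) = f := by ext x; exact f.extend_of_mem x.2
  have h2 := f.contMDiff ⟨y, h⟩
  rw [← h1] at h2
  exact contMDiffAt_subtype_iff.1 h2

end Smooth

namespace LocalCoords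

variable {κ : Type*} [Fintype κ] (c : LocalCoords N I κ) {V W : Opens N}

theorem contMDiffAt_φ {y : N} (h : y ∈ c.U) : ContMDiffAt I 𝓘(ℝ, κ → ℝ) ∞ c.φ y :=
  c.smooth.contMDiffAt (c.φ.open_source.mem_nhds (c.le_source h))

/-- The coordinate functions. -/
def x (i : κ) : Smooth I c.U :=
  ⟨fun y => c.φ y i, fun y => by
    have h1 : ContMDiffAt I 𝓘(ℝ, κ → ℝ) ∞ (fun y : c.U => c.φ y) y :=
      contMDiffAt_subtype_iff.2 (c.contMDiffAt_φ y.2)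
    exact (ContinuousLinearMap.proj (R := ℝ) (φ := fun _ : κ => ℝ) i).contMDiff.contMDiffAt.comp
      y h1⟩

theorem x_apply (i : κ) (y : c.U) : c.x i y = c.φ y i := rfl

/-- The coordinate representation of a smooth function. -/
def rep (f : Smooth I V) : (κ → ℝ) → ℝ := f.extend ∘ c.φ.symm

theorem contDiffAt_rep (f : Smooth I V) {y : κ → ℝ} (hy : y ∈ c.φ.target)
    (h : c.φ.symm y ∈ V) : ContDiffAt ℝ ∞ (c.rep f) y :=
  contMDiffAt_iff_contDiffAt.1 ((f.contMDiffAt_extend h).comp y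
    (c.symm_smooth.contMDiffAt (c.φ.open_target.mem_nhds hy)))

theorem contDiffAt_rep_φ (hV : V ≤ c.U) (f : Smooth I V) (y : V) :
    ContDiffAt ℝ ∞ (c.rep f) (c.φ y) := by
  have hy := c.le_source (hV y.2)
  exact c.contDiffAt_rep f (c.φ.map_source hy) (by rw [c.φ.left_inv hy]; exact y.2)

theorem differentiableAt_rep (hV : V ≤ c.U) (f : Smooth I V) (y : V) :
    DifferentiableAt ℝ (c.rep f) (c.φ y) :=
  (c.contDiffAt_rep_φ hV f y).differentiableAt (by simp)

theorem rep_apply_φ (hV : V ≤ c.U) (f : Smooth I V) (y : V) : c.rep f (c.φ y) = f y := by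
  have hy := c.le_source (hV y.2)
  rw [rep, Function.comp_apply, c.φ.left_inv hy, f.extend_of_mem y.2]

/-- The Leibniz rule for `1 * 1` shows that `D` kills constants. In each product of the expansion
the first factor vanishes at `p`, so only its derivative, multiplied by the value of `h i` at `p`,
survives. -/
theorem map_hadamard_expansion {A : Type*} [AddCommGroup A] [Module ℝ A] (hW : W ≤ c.U) {p : N}
    (hp : p ∈ W) (D : Smooth I W →ₗ[ℝ] A)
    (hD : ∀ f g : Smooth I W, D (f * g) = f ⟨p, hp⟩ • D g + g ⟨p, hp⟩ • D f) {f : Smooth I W}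
    {r : ℝ} {h : κ → Smooth I W} (hf : f = algebraMap ℝ _ r + ∑ i, ((c.x i).res hW -
        algebraMap ℝ _ (c.x i ⟨p, hW hp⟩)) * h i) :
    D f = ∑ i, h i ⟨p, hp⟩ • D ((c.x i).res hW) := by
  have hone : D 1 = 0 := by
    have := hD 1 1
    rw [mul_one] at this
    change D 1 = (1 : ℝ) • D 1 + (1 : ℝ) • D 1 at this
    rw [one_smul] at this
    exact left_eq_add.1 this
  have hc : ∀ r, D (algebraMap ℝ _ r) = 0 := fun r => by
    rw [Algebra.algebraMap_eq_smul_one, map_smul, hone, smul_zero]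
  rw [hf, map_add, hc, zero_add, map_sum]
  refine Finset.sum_congr rfl fun i _ => ?_
  rw [hD, map_sub, hc, sub_zero]
  change (c.x i ⟨p, _⟩ - c.x i ⟨p, _⟩) • _ + _ = _
  rw [sub_self, zero_smul, zero_add]

variable [DecidableEq κ]

/-- The coordinate derivations of the algebra of smooth functions on an open subset of the
coordinate domain. -/
def pd (hV : V ≤ c.U) (i : κ) : Derivation ℝ (Smooth I V) (Smooth I V) :=
  Derivation.mk' {
    toFun f := ⟨fun y => fderiv ℝ (c.rep f) (c.φ y) (Pi.single i 1), fun y => by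
      have h1 : ContDiffAt ℝ ∞ (fun z => fderiv ℝ (c.rep f) z (Pi.single i 1)) (c.φ y) :=
        ((c.contDiffAt_rep_φ hV f y).fderiv_right le_rfl).clm_apply contDiffAt_const
      exact ContMDiffAt.comp y h1.contMDiffAt
        (contMDiffAt_subtype_iff.2 (c.contMDiffAt_φ (hV y.2)))⟩
    map_add' f g := by
      ext y
      change fderiv ℝ (c.rep (f + g)) (c.φ y) (Pi.single i 1) =
        fderiv ℝ (c.rep f) (c.φ y) (Pi.single i 1) + fderiv ℝ (c.rep g) (c.φ y) (Pi.single i 1)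
      have : c.rep (f + g) = c.rep f + c.rep g := by simp only [rep, Smooth.extend_add]; rfl
      rw [this, fderiv_add (c.differentiableAt_rep hV f y) (c.differentiableAt_rep hV g y)]
      rfl
    map_smul' r f := by
      ext y
      change fderiv ℝ (c.rep (r • f)) (c.φ y) (Pi.single i 1) =
        r * fderiv ℝ (c.rep f) (c.φ y) (Pi.single i 1)
      have : c.rep (r • f) = r • c.rep f := by simp only [rep, Smooth.extend_smul]; rfl
      rw [this, fderiv_const_smul (c.differentiableAt_rep hV f y)]
      rfl }
    fun f g => by
      ext y
      change fderiv ℝ (c.rep (f * g)) (c.φ y) (Pi.single i 1) =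
        f y * fderiv ℝ (c.rep g) (c.φ y) (Pi.single i 1) +
          g y * fderiv ℝ (c.rep f) (c.φ y) (Pi.single i 1)
      have : c.rep (f * g) = c.rep f * c.rep g := by simp only [rep, Smooth.extend_mul]; rfl
      rw [this, fderiv_mul (c.differentiableAt_rep hV f y) (c.differentiableAt_rep hV g y),
        ← c.rep_apply_φ hV f, ← c.rep_apply_φ hV g]
      rfl

theorem pd_apply (hV : V ≤ c.U) (i : κ) (f : Smooth I V) (y : V) :
    c.pd hV i f y = fderiv ℝ (c.rep f) (c.φ y) (Pi.single i 1) := rfl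

/-- The coordinate representations of `f` and of its restriction agree near the point in question,
and a derivative depends only on the germ. -/
theorem pd_res (hV : V ≤ c.U) (h : W ≤ V) (i : κ) (f : Smooth I V) :
    (c.pd hV i f).res h = c.pd (h.trans hV) i (f.res h) := by
  ext y
  rw [Smooth.res_apply, pd_apply, pd_apply]
  have hy := c.le_source (hV (h y.2))
  have : c.rep f =ᶠ[𝓝 (c.φ y)] c.rep (f.res h) := by
    have h1 : ∀ᶠ z in 𝓝 (c.φ y), c.φ.symm z ∈ W :=
      (c.φ.symm.continuousAt (c.φ.map_source hy)).eventually
        (W.isOpen.mem_nhds (by rw [c.φ.left_inv hy]; exact y.2))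
    filter_upwards [h1] with z hz
    rw [rep, rep, Function.comp_apply, Function.comp_apply, Smooth.extend_of_mem _ hz,
      Smooth.extend_of_mem _ (h hz)]
    rfl
  rw [this.fderiv_eq]

theorem pd_x (hV : V ≤ c.U) (i j : κ) :
    c.pd hV i ((c.x j).res hV) = if i = j then 1 else 0 := by
  ext y
  have hy := c.le_source (hV y.2)
  have h1 : c.rep ((c.x j).res hV) =ᶠ[𝓝 (c.φ y)] fun z => z j := by
    have h1 : ∀ᶠ z in 𝓝 (c.φ y), c.φ.symm z ∈ V :=
      (c.φ.symm.continuousAt (c.φ.map_source hy)).eventually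
        (V.isOpen.mem_nhds (by rw [c.φ.left_inv hy]; exact y.2))
    filter_upwards [h1, c.φ.open_target.mem_nhds (c.φ.map_source hy)] with z hz hz'
    rw [rep, Function.comp_apply, Smooth.extend_of_mem _ hz, Smooth.res_apply, x_apply,
      c.φ.right_inv hz']
  have h2 : fderiv ℝ (fun z : κ → ℝ => z j) (c.φ y) =
      ContinuousLinearMap.proj (R := ℝ) (φ := fun _ : κ => ℝ) j :=
    (ContinuousLinearMap.proj (R := ℝ) (φ := fun _ : κ => ℝ) j).hasFDerivAt.fderiv
  rw [pd_apply, h1.fderiv_eq, h2]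
  by_cases hij : i = j
  · subst hij; simp
  · simp [hij, Ne.symm hij]

/-- Hadamard's lemma in coordinates. -/
theorem exists_hadamard (hV : V ≤ c.U) (f : Smooth I V) {p : N} (hp : p ∈ V) :
    ∃ (W : Opens N) (hW : W ≤ V) (_ : p ∈ W) (h : κ → Smooth I W),
      f.res hW = algebraMap ℝ _ (f ⟨p, hp⟩) + ∑ i, ((c.x i).res (hW.trans hV) -
        algebraMap ℝ _ (c.x i ⟨p, hV hp⟩)) * h i := by
  have hpU := c.le_source (hV hp)
  have hs : IsOpen (c.φ.target ∩ c.φ.symm ⁻¹' V) := c.φ.symm.isOpen_inter_preimage V.isOpen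
  obtain ⟨t, h, ht, hts, hat, hh, he⟩ := exists_hadamard_of_contDiffOn hs
    (fun y hy => (c.contDiffAt_rep f hy.1 hy.2).contDiffWithinAt)
    (a := c.φ p) ⟨c.φ.map_source hpU, by
      rw [Set.mem_preimage, c.φ.left_inv hpU]; exact hp⟩
  let W : Opens N := ⟨c.φ.source ∩ c.φ ⁻¹' t, c.φ.isOpen_inter_preimage ht⟩
  have hW : W ≤ V := fun y hy => by
    have := (hts hy.2).2
    rwa [Set.mem_preimage, c.φ.left_inv hy.1] at this
  refine ⟨W, hW, ⟨hpU, hat⟩, fun i => ⟨fun y => h i (c.φ y), fun y => ?_⟩, ?_⟩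
  · exact ContMDiffAt.comp y (hh i).contMDiff.contMDiffAt
      (contMDiffAt_subtype_iff.2 (c.contMDiffAt_φ (hV (hW y.2))))
  · ext y
    have h1 := he (c.φ y) y.2.2
    rw [c.rep_apply_φ hV f ⟨y, hW y.2⟩, c.rep_apply_φ hV f ⟨p, hp⟩] at h1
    rw [Smooth.res_apply, h1]
    change _ = f ⟨p, hp⟩ + (ContMDiffMap.coeFnAddMonoidHom (∑ i, _)) y
    rw [map_sum, Finset.sum_apply]
    rfl

/-- A derivation at a point, defined on smooth functions near the point and compatible with
restrictions, is determined by its values on coordinates. -/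
theorem pointDerivation_eq {A : Type*} [AddCommGroup A] [Module ℝ A] (hV : V ≤ c.U) {p : N}
    (hp : p ∈ V) (D : ∀ W : Opens N, W ≤ V → p ∈ W → (Smooth I W →ₗ[ℝ] A))
    (hres : ∀ (W : Opens N) (hW : W ≤ V) (hpW : p ∈ W) (f : Smooth I V),
      D W hW hpW (f.res hW) = D V le_rfl hp f)
    (hmul : ∀ (W : Opens N) (hW : W ≤ V) (hpW : p ∈ W) (f g : Smooth I W),
      D W hW hpW (f * g) = f ⟨p, hpW⟩ • D W hW hpW g + g ⟨p, hpW⟩ • D W hW hpW f)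
    (f : Smooth I V) :
    D V le_rfl hp f = ∑ i, c.pd hV i f ⟨p, hp⟩ • D V le_rfl hp ((c.x i).res hV) := by
  obtain ⟨W, hW, hpW, h, hf⟩ := c.exists_hadamard hV f hp
  -- Differentiation along the `i`-th coordinate at `p` is itself a derivation at `p`. Applied to
  -- it, the expansion identifies the values of the Hadamard coefficients as the partial derivatives
  -- of `f`.
  have hpd : ∀ i, c.pd hV i f ⟨p, hp⟩ = h i ⟨p, hpW⟩ := fun i => by
    let ev : Smooth I W →ₗ[ℝ] ℝ :=
      { toFun k := c.pd (hW.trans hV) i k ⟨p, hpW⟩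
        map_add' k l := by rw [map_add]; rfl
        map_smul' r k := by rw [Derivation.map_smul]; rfl }
    have h1 := c.map_hadamard_expansion (hW.trans hV) hpW ev (fun k l => by
      change c.pd (hW.trans hV) i (k * l) ⟨p, hpW⟩ = _
      rw [Derivation.leibniz]
      rfl) hf
    have h2 : c.pd hV i f ⟨p, hp⟩ = ev (f.res hW) :=
      congrArg (fun k : Smooth I W => k ⟨p, hpW⟩) (c.pd_res hV hW i f)
    rw [h2, h1, Finset.sum_eq_single i]
    · have : ev ((c.x i).res (hW.trans hV)) = 1 := by
        change c.pd (hW.trans hV) i _ ⟨p, hpW⟩ = _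
        rw [pd_x, if_pos rfl]; rfl
      rw [this, smul_eq_mul, mul_one]
    · intro j _ hj
      have : ev ((c.x j).res (hW.trans hV)) = 0 := by
        change c.pd (hW.trans hV) i _ ⟨p, hpW⟩ = _
        rw [pd_x, if_neg hj.symm]; rfl
      rw [this, smul_zero]
    · simp
  rw [← hres W hW hpW, c.map_hadamard_expansion (hW.trans hV) hpW _ (hmul W hW hpW) hf]
  refine Finset.sum_congr rfl fun i _ => ?_
  rw [hpd, ← hres W hW hpW]
  rfl

end LocalCoords

end LocalCoords

/-! ### Vector fields and symmetric forms in coordinates; gluing of forms. -/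

section VectorFields

variable {B H N : Type*} [NormedAddCommGroup B] [NormedSpace ℝ B] [TopologicalSpace H]
    [TopologicalSpace N] [ChartedSpace H N] {I : ModelWithCorners ℝ B H} {V W : Opens N}

namespace Smooth

theorem sum_apply {κ : Type*} (s : Finset κ) (f : κ → Smooth I V) (y : V) :
    (∑ i ∈ s, f i) y = ∑ i ∈ s, f i y := by
  change (ContMDiffMap.coeFnAddMonoidHom (∑ i ∈ s, f i)) y = _
  rw [map_sum, Finset.sum_apply]
  rfl

/-- Restriction of smooth functions, as an algebra homomorphism. -/
def resHom (h : W ≤ V) : Smooth I V →ₐ[ℝ] Smooth I W where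
  toFun f := f.res h
  map_one' := rfl
  map_mul' _ _ := rfl
  map_zero' := rfl
  map_add' _ _ := rfl
  commutes' _ := rfl

theorem res_mul (h : W ≤ V) (f g : Smooth I V) : (f * g).res h = f.res h * g.res h := rfl

theorem res_sum {κ : Type*} (h : W ≤ V) (s : Finset κ) (f : κ → Smooth I V) :
    (∑ i ∈ s, f i).res h = ∑ i ∈ s, (f i).res h :=
  map_sum (resHom (I := I) h) f s

end Smooth

namespace Vect

/-- The action of a vector field on the smooth functions on its domain. -/
def app (X : Vect I V) : Derivation ℝ (Smooth I V) (Smooth I V) := X.1 ⟨V, le_rfl⟩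

theorem app_add (X Y : Vect I V) (f : Smooth I V) : (X + Y).app f = X.app f + Y.app f := rfl

theorem app_smul (r : ℝ) (X : Vect I V) (f : Smooth I V) : (r • X).app f = r • X.app f := rfl

theorem app_mul (k : Smooth I V) (X : Vect I V) (f : Smooth I V) :
    (X.mul k).app f = k * X.app f := rfl

theorem app_res (h : W ≤ V) (X : Vect I V) (f : Smooth I V) :
    (X.res h).app (f.res h) = (X.app f).res h :=
  (X.2 V W le_rfl h f).symm

theorem res_add (h : W ≤ V) (X Y : Vect I V) : (X + Y).res h = X.res h + Y.res h := rfl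

theorem res_smul (h : W ≤ V) (r : ℝ) (X : Vect I V) : (r • X).res h = r • X.res h := rfl

theorem res_mul (h : W ≤ V) (f : Smooth I V) (X : Vect I V) :
    (X.mul f).res h = (X.res h).mul (f.res h) := rfl

theorem sum_val_apply {κ : Type*} (s : Finset κ) (X : κ → Vect I V) (W : {W : Opens N // W ≤ V})
    (f : Smooth I W.1) : (∑ i ∈ s, X i).1 W f = ∑ i ∈ s, (X i).1 W f := by
  induction s using Finset.cons_induction with
  | empty => rfl
  | cons a s ha ih =>
    rw [Finset.sum_cons, Finset.sum_cons, ← ih]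
    rfl

end Vect

namespace LocalCoords

variable {κ : Type*} [Fintype κ] [DecidableEq κ] (c : LocalCoords N I κ)

/-- The coordinate vector fields. -/
def frame (i : κ) : Vect I c.U :=
  ⟨fun W => c.pd W.2 i, fun _ _ hW h f => c.pd_res hW h i f⟩

theorem frame_app (hV : V ≤ c.U) (i : κ) (f : Smooth I V) :
    ((c.frame i).res hV).app f = c.pd hV i f := rfl

/-- Followed by evaluation at a point, a vector field is a derivation at that point. Being a family
compatible with restrictions, it also acts on the smaller neighbourhoods that Hadamard's lemma
produces, so no cutoff functions are needed. -/
theorem vect_app_eq (hV : V ≤ c.U) (X : Vect I V) (f : Smooth I V) :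
    X.app f = ∑ i, X.app ((c.x i).res hV) * c.pd hV i f := by
  ext p
  let D : ∀ W : Opens N, W ≤ V → p.1 ∈ W → (Smooth I W →ₗ[ℝ] ℝ) := fun W hW hp =>
    { toFun k := X.1 ⟨W, hW⟩ k ⟨p, hp⟩
      map_add' k l := by rw [map_add]; rfl
      map_smul' r k := by rw [Derivation.map_smul]; rfl }
  have h := c.pointDerivation_eq hV p.2 D
    (fun W hW hp f => (congrArg (fun k : Smooth I W => k ⟨p, hp⟩) (X.2 V W le_rfl hW f)).symm)
    (fun W hW hp f g => by
      change X.1 ⟨W, hW⟩ (f * g) ⟨p, hp⟩ = _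
      rw [Derivation.leibniz]
      rfl) f
  rw [Smooth.sum_apply]
  refine h.trans (Finset.sum_congr rfl fun i _ => ?_)
  exact mul_comm _ _

theorem vect_eq_sum (hV : V ≤ c.U) (X : Vect I V) :
    X = ∑ i, ((c.frame i).res hV).mul (X.app ((c.x i).res hV)) := by
  refine Subtype.ext (funext fun W => Derivation.ext fun f => ?_)
  refine (c.vect_app_eq (W.2.trans hV) (X.res W.2) f).trans ?_
  rw [Vect.sum_val_apply]
  refine Finset.sum_congr rfl fun i _ => ?_
  have h : (X.res W.2).app ((c.x i).res (W.2.trans hV)) = (X.app ((c.x i).res hV)).res W.2 :=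
    X.app_res W.2 ((c.x i).res hV)
  rw [h]
  rfl

theorem vect_ext (hV : V ≤ c.U) {X Y : Vect I V}
    (h : ∀ i, X.app ((c.x i).res hV) = Y.app ((c.x i).res hV)) : X = Y := by
  rw [c.vect_eq_sum hV X, c.vect_eq_sum hV Y]
  simp only [h]

/-- The bilinear form on vector fields with given coefficients in a coordinate system. -/
def coordForm (hV : V ≤ c.U) (G : κ → κ → Smooth I c.U) :
    Vect I V →ₗ[ℝ] Vect I V →ₗ[ℝ] Smooth I V :=
  LinearMap.mk₂ ℝ
    (fun X Y => ∑ i, ∑ j, X.app ((c.x i).res hV) * Y.app ((c.x j).res hV) * (G i j).res hV)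
    (fun X X' Y => by simp only [Vect.app_add, add_mul, Finset.sum_add_distrib])
    (fun r X Y => by simp only [Vect.app_smul, smul_mul_assoc, Finset.smul_sum])
    (fun X Y Y' => by simp only [Vect.app_add, mul_add, add_mul, Finset.sum_add_distrib])
    (fun r X Y => by simp only [Vect.app_smul, smul_mul_assoc, mul_smul_comm, Finset.smul_sum])

omit [DecidableEq κ] in
theorem coordForm_apply (hV : V ≤ c.U) (G : κ → κ → Smooth I c.U) (X Y : Vect I V) :
    c.coordForm hV G X Y =
      ∑ i, ∑ j, X.app ((c.x i).res hV) * Y.app ((c.x j).res hV) * (G i j).res hV := rfl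

omit [DecidableEq κ] in
theorem coordForm_res (hV : V ≤ c.U) (h : W ≤ V) (G : κ → κ → Smooth I c.U) (X Y : Vect I V) :
    (c.coordForm hV G X Y).res h = c.coordForm (h.trans hV) G (X.res h) (Y.res h) := by
  have hx : ∀ (Z : Vect I V) i,
      (Z.res h).app ((c.x i).res (h.trans hV)) = (Z.app ((c.x i).res hV)).res h :=
    fun Z i => Z.app_res h ((c.x i).res hV)
  simp only [coordForm_apply, Smooth.res_sum, hx]
  rfl

omit [DecidableEq κ] in
theorem coordForm_mul (hV : V ≤ c.U) (G : κ → κ → Smooth I c.U) (f : Smooth I V)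
    (X Y : Vect I V) : c.coordForm hV G (X.mul f) Y = f * c.coordForm hV G X Y := by
  simp only [coordForm_apply, Vect.app_mul, Finset.mul_sum, mul_assoc]

omit [DecidableEq κ] in
theorem coordForm_symm (hV : V ≤ c.U) {G : κ → κ → Smooth I c.U} (hG : ∀ i j, G i j = G j i)
    (X Y : Vect I V) : c.coordForm hV G X Y = c.coordForm hV G Y X := by
  rw [coordForm_apply, coordForm_apply, Finset.sum_comm]
  refine Finset.sum_congr rfl fun i _ => Finset.sum_congr rfl fun j _ => ?_
  rw [hG j i, mul_comm (X.app _)]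

/-- A bilinear form is determined by its values on coordinate vector fields. -/
theorem bilin_eq_coordForm (hV : V ≤ c.U) (b : Vect I V →ₗ[ℝ] Vect I V →ₗ[ℝ] Smooth I V)
    (hl : ∀ (f : Smooth I V) (X Y : Vect I V), b (X.mul f) Y = f * b X Y)
    (hr : ∀ (f : Smooth I V) (X Y : Vect I V), b X (Y.mul f) = f * b X Y)
    {G : κ → κ → Smooth I c.U}
    (hG : ∀ i j, b ((c.frame i).res hV) ((c.frame j).res hV) = (G i j).res hV) :
    b = c.coordForm hV G := by
  refine LinearMap.ext fun X => LinearMap.ext fun Y => ?_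
  conv_lhs => rw [c.vect_eq_sum hV X, c.vect_eq_sum hV Y]
  simp only [map_sum, LinearMap.sum_apply, hl, hr, hG, coordForm_apply]
  rw [Finset.sum_comm]
  refine Finset.sum_congr rfl fun i _ => Finset.sum_congr rfl fun j _ => ?_
  ring

omit [DecidableEq κ] in
/-- Coordinate forms that agree on overlaps glue to a symmetric form on the manifold. -/
theorem exists_symmForm (c : N → LocalCoords N I κ) (hc : ∀ y, y ∈ (c y).U)
    (G : ∀ y, κ → κ → Smooth I (c y).U) (hG : ∀ y i j, G y i j = G y j i)
    (hcomp : ∀ (y z : N) (V : Opens N) (hy : V ≤ (c y).U) (hz : V ≤ (c z).U),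
      (c y).coordForm hy (G y) = (c z).coordForm hz (G z)) :
    ∃ F : SymmForm N I, ∀ (y : N) (V : Opens N) (hV : V ≤ (c y).U),
      F.form V = (c y).coordForm hV (G y) := by
  -- The value at `y` is computed in the coordinates attached to `y` itself, so no choice of a cover
  -- is involved.
  let val : ∀ V : Opens N, Vect I V → Vect I V → V → ℝ := fun V X Y y =>
    (c y).coordForm (V := V ⊓ (c y).U) inf_le_right (G y) (X.res inf_le_left)
      (Y.res inf_le_left) ⟨y, y.2, hc y⟩
  -- Near a point one fixed coordinate system computes all values, by agreement on overlaps. This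
  -- gives smoothness and compatibility with restrictions; the algebraic identities are checked
  -- pointwise from the definition of `val`.
  have hval : ∀ (V W : Opens N) (hW : W ≤ V) (X Y : Vect I V) (y : N) (hy : W ≤ (c y).U) (z : N)
      (hz : z ∈ W), val V X Y ⟨z, hW hz⟩ =
        (c y).coordForm hy (G y) (X.res hW) (Y.res hW) ⟨z, hz⟩ := by
    intro V W hW X Y y hy z hz
    have h1 := (c z).coordForm_res (V := V ⊓ (c z).U) (W := W ⊓ (c z).U) inf_le_right
      (inf_le_inf_right _ hW) (G z) (X.res inf_le_left) (Y.res inf_le_left)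
    have h2 := (c y).coordForm_res (V := W) (W := W ⊓ (c z).U) hy inf_le_left (G y) (X.res hW)
      (Y.res hW)
    have h3 := hcomp y z (W ⊓ (c z).U) (inf_le_left.trans hy) inf_le_right
    have h4 := congrArg (fun k : Smooth I (W ⊓ (c z).U) => k ⟨z, hz, hc z⟩)
      (h1.trans ((congrArg (fun b => b (X.res (inf_le_left.trans hW))
        (Y.res (inf_le_left.trans hW))) h3.symm).trans h2.symm))
    exact h4
  have hsm : ∀ V X Y, ContMDiff I 𝓘(ℝ, ℝ) ∞ (val V X Y) := by
    intro V X Y y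
    have hm : y.1 ∈ V ⊓ (c y).U := ⟨y.2, hc y⟩
    let k := (c y).coordForm (V := V ⊓ (c y).U) inf_le_right (G y) (X.res inf_le_left)
      (Y.res inf_le_left)
    have h1 : ContMDiffAt I 𝓘(ℝ, ℝ) ∞ (fun z : V => k.extend z) y :=
      contMDiffAt_subtype_iff.2 (k.contMDiffAt_extend hm)
    refine h1.congr_of_eventuallyEq ?_
    filter_upwards [(continuous_subtype_val.continuousAt (x := y)).eventually
      ((V ⊓ (c y).U).isOpen.mem_nhds hm)] with z hz
    rw [k.extend_of_mem hz]
    exact hval V (V ⊓ (c y).U) inf_le_left X Y y inf_le_right z hz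
  let b : ∀ (V : Opens N) (y : N), Vect I (V ⊓ (c y).U) →ₗ[ℝ] Vect I (V ⊓ (c y).U) →ₗ[ℝ]
      Smooth I (V ⊓ (c y).U) := fun V y => (c y).coordForm inf_le_right (G y)
  have hb : ∀ V X Y y, val V X Y y =
      b V y (X.res inf_le_left) (Y.res inf_le_left) ⟨y, y.2, hc y⟩ := fun _ _ _ _ => rfl
  have hadd : ∀ V X X' Y y, val V (X + X') Y y = val V X Y y + val V X' Y y := by
    intro V X X' Y y
    rw [hb, Vect.res_add, LinearMap.map_add₂]
    rfl
  have hsmul : ∀ V (r : ℝ) X Y y, val V (r • X) Y y = r * val V X Y y := by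
    intro V r X Y y
    rw [hb, Vect.res_smul, LinearMap.map_smul₂]
    rfl
  have hmul : ∀ V (f : Smooth I V) X Y y, val V (X.mul f) Y y = f y * val V X Y y := by
    intro V f X Y y
    rw [hb, Vect.res_mul]
    have := (c y).coordForm_mul (V := V ⊓ (c y).U) inf_le_right (G y) (f.res inf_le_left)
      (X.res inf_le_left) (Y.res inf_le_left)
    exact congrArg (fun k : Smooth I (V ⊓ (c y).U) => k ⟨y, y.2, hc y⟩) this
  have hsymm : ∀ V X Y y, val V X Y y = val V Y X y := by
    intro V X Y y
    have := (c y).coordForm_symm (V := V ⊓ (c y).U) inf_le_right (hG y) (X.res inf_le_left)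
      (Y.res inf_le_left)
    exact congrArg (fun k : Smooth I (V ⊓ (c y).U) => k ⟨y, y.2, hc y⟩) this
  let F : SymmForm N I :=
    { form V := LinearMap.mk₂ ℝ (fun X Y => ⟨val V X Y, hsm V X Y⟩)
        (fun X X' Y => ContMDiffMap.ext fun y => hadd V X X' Y y)
        (fun r X Y => ContMDiffMap.ext fun y => hsmul V r X Y y)
        (fun X Y Y' => ContMDiffMap.ext fun y =>
          (hsymm V X (Y + Y') y).trans ((hadd V Y Y' X y).trans
            (congrArg₂ (· + ·) (hsymm V Y X y) (hsymm V Y' X y))))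
        (fun r X Y => ContMDiffMap.ext fun y =>
          (hsymm V X (r • Y) y).trans ((hsmul V r Y X y).trans
            (congrArg (r * ·) (hsymm V Y X y))))
      form_res := fun {V V'} h X Y => ContMDiffMap.ext fun y =>
        hval V (V' ⊓ (c y).U) (inf_le_left.trans h) X Y y inf_le_right y ⟨y.2, hc y⟩
      form_mul := fun V f X Y => ContMDiffMap.ext fun y => hmul V f X Y y
      form_symm := fun V X Y => ContMDiffMap.ext fun y => hsymm V X Y y }
  refine ⟨F, fun y V hV => LinearMap.ext fun X => LinearMap.ext fun Y => ?_⟩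
  ext z
  exact hval V V le_rfl X Y y hV z z.2

end LocalCoords

/-- Two symmetric forms that agree locally in coordinates are equal. -/
theorem SymmForm.ext_of_local {F F' : SymmForm N I}
    (h : ∀ y : N, ∃ U : Opens N, y ∈ U ∧ ∀ V ≤ U, F.form V = F'.form V) : F = F' := by
  refine SymmForm.ext (funext fun V => LinearMap.ext fun X => LinearMap.ext fun Y => ?_)
  ext y
  obtain ⟨U, hy, hU⟩ := h y
  have h1 : (F.form V X Y).res (W := V ⊓ U) inf_le_left =
      (F'.form V X Y).res (W := V ⊓ U) inf_le_left := by
    rw [F.form_res, F'.form_res, hU _ inf_le_right]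
  exact congrArg (fun k : Smooth I (V ⊓ U : Opens N) => k ⟨y, y.2, hy⟩) h1

end VectorFields

/-! ### Parity, components of degree zero and one, and contraction in the exterior algebra. -/

section ExteriorAlgebra

open CliffordAlgebra (evenOdd involute contractLeft)

@[simp] theorem sgn_zero : sgn 0 = 1 := if_pos rfl

@[simp] theorem sgn_one : sgn 1 = -1 := if_neg one_ne_zero

theorem zmod_two_cases (a : ZMod 2) : a = 0 ∨ a = 1 := by
  fin_cases a
  · exact Or.inl rfl
  · exact Or.inr rfl

theorem one_add_one_zmod_two : (1 + 1 : ZMod 2) = 0 := rfl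

theorem sgn_add (a b : ZMod 2) : sgn (a + b) = sgn a * sgn b := by
  rcases zmod_two_cases a with rfl | rfl <;> rcases zmod_two_cases b with rfl | rfl <;>
    simp [one_add_one_zmod_two]

variable {V : Type*} [AddCommGroup V] [Module ℝ V]

/-- The even and odd parts are complementary and the grade involution acts on them by 1 and -1; as 2
is invertible, they are exactly its eigenspaces. Parity thereby becomes an equation that linear maps
and algebra homomorphisms can transport. -/
theorem mem_evenOdd_iff {a : ZMod 2} {x : ExteriorAlgebra ℝ V} :
    x ∈ evenOdd (0 : QuadraticForm ℝ V) a ↔ involute x = sgn a • x := by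
  constructor
  · intro h
    rcases zmod_two_cases a with rfl | rfl
    · rw [CliffordAlgebra.involute_eq_of_mem_even h, sgn_zero, one_smul]
    · rw [CliffordAlgebra.involute_eq_of_mem_odd h, sgn_one, neg_one_smul]
  · intro h
    have htop := (CliffordAlgebra.evenOdd_isCompl (0 : QuadraticForm ℝ V)).sup_eq_top
    obtain ⟨y, hy, z, hz, rfl⟩ := Submodule.mem_sup.1 (htop.ge (Submodule.mem_top (x := x)))
    rw [map_add, CliffordAlgebra.involute_eq_of_mem_even hy,
      CliffordAlgebra.involute_eq_of_mem_odd hz] at h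
    rcases zmod_two_cases a with rfl | rfl
    · rw [sgn_zero, one_smul] at h
      have h2 : (2 : ℝ) • z = 0 := by
        rw [two_smul]
        have := add_left_cancel h
        nth_rewrite 1 [← this]
        exact neg_add_cancel z
      rw [(smul_eq_zero.1 h2).resolve_left two_ne_zero, add_zero]
      exact hy
    · rw [sgn_one, neg_one_smul, neg_add] at h
      have h2 : (2 : ℝ) • y = 0 := by
        rw [two_smul]
        have := add_right_cancel h
        nth_rewrite 1 [this]
        exact neg_add_cancel y
      rw [(smul_eq_zero.1 h2).resolve_left two_ne_zero, zero_add]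
      exact hz

theorem algebraMapInv_algebraMap (r : ℝ) :
    ExteriorAlgebra.algebraMapInv (algebraMap ℝ (ExteriorAlgebra ℝ V) r) = r :=
  ExteriorAlgebra.algebraMap_leftInverse V r

theorem algebraMapInv_ι (v : V) :
    ExteriorAlgebra.algebraMapInv (ExteriorAlgebra.ι ℝ v) = (0 : ℝ) := by
  simp [ExteriorAlgebra.algebraMapInv]

theorem ιInv_ι (v : V) : ExteriorAlgebra.ιInv (R := ℝ) (ExteriorAlgebra.ι ℝ v) = v :=
  ExteriorAlgebra.ι_leftInverse v

theorem fst_toTrivSqZeroExt [Module ℝᵐᵒᵖ V] [IsCentralScalar ℝ V] (x : ExteriorAlgebra ℝ V) :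
    (ExteriorAlgebra.toTrivSqZeroExt x).fst = ExteriorAlgebra.algebraMapInv x := by
  have : (TrivSqZeroExt.fstHom ℝ ℝ V).comp ExteriorAlgebra.toTrivSqZeroExt =
      ExteriorAlgebra.algebraMapInv := by
    ext v
    simp [algebraMapInv_ι]
  exact DFunLike.congr_fun this x

/-- The degree-one part is the second component of an algebra homomorphism to a trivial square-zero
extension, hence a derivation over the degree-zero part. Products of two degree-one elements are
invisible to it. -/
theorem ιInv_mul (x y : ExteriorAlgebra ℝ V) :
    ExteriorAlgebra.ιInv (x * y) =
      (ExteriorAlgebra.algebraMapInv x : ℝ) • ExteriorAlgebra.ιInv y +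
        (ExteriorAlgebra.algebraMapInv y : ℝ) • ExteriorAlgebra.ιInv x := by
  -- The square-zero extension needs a right action; this is the one used in the definition of
  -- `ExteriorAlgebra.ιInv`, so that the two sides unfold to its components.
  let : Module ℝᵐᵒᵖ V := Module.compHom _ ((RingHom.id ℝ).fromOpposite mul_comm)
  have : IsCentralScalar ℝ V := ⟨fun r m => rfl⟩
  change (ExteriorAlgebra.toTrivSqZeroExt (x * y)).snd =
    _ • (ExteriorAlgebra.toTrivSqZeroExt y).snd + _ • (ExteriorAlgebra.toTrivSqZeroExt x).snd
  rw [map_mul, TrivSqZeroExt.snd_mul, fst_toTrivSqZeroExt, fst_toTrivSqZeroExt, op_smul_eq_smul]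

theorem ιInv_algebraMap (r : ℝ) :
    ExteriorAlgebra.ιInv (algebraMap ℝ (ExteriorAlgebra ℝ V) r) = 0 := by
  let : Module ℝᵐᵒᵖ V := Module.compHom _ ((RingHom.id ℝ).fromOpposite mul_comm)
  have : IsCentralScalar ℝ V := ⟨fun r m => rfl⟩
  change (ExteriorAlgebra.toTrivSqZeroExt (algebraMap ℝ (ExteriorAlgebra ℝ V) r)).snd = 0
  rw [AlgHom.commutes]
  rfl

theorem algebraMapInv_involute (x : ExteriorAlgebra ℝ V) :
    (ExteriorAlgebra.algebraMapInv (involute x) : ℝ) = ExteriorAlgebra.algebraMapInv x := by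
  have : (ExteriorAlgebra.algebraMapInv (R := ℝ) (M := V)).comp involute =
      ExteriorAlgebra.algebraMapInv := by
    ext v
    simp [algebraMapInv_ι]
  exact DFunLike.congr_fun this x

theorem ιInv_involute (x : ExteriorAlgebra ℝ V) :
    ExteriorAlgebra.ιInv (R := ℝ) (involute x) = -ExteriorAlgebra.ιInv (R := ℝ) x := by
  induction x using ExteriorAlgebra.induction with
  | algebraMap r => rw [AlgHom.commutes, ιInv_algebraMap, neg_zero]
  | ι v => rw [CliffordAlgebra.involute_ι, map_neg]
  | mul a b ha hb =>
    rw [map_mul, ιInv_mul, ιInv_mul, ha, hb, algebraMapInv_involute, algebraMapInv_involute,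
      smul_neg, smul_neg, neg_add]
  | add a b ha hb => rw [map_add, map_add, map_add, ha, hb, neg_add]

/-- The involution fixes the degree-zero part but negates an odd element. Together with its
counterpart for even elements, this is what separates the two parities of the metric in the final
formulas. -/
theorem algebraMapInv_of_odd {x : ExteriorAlgebra ℝ V}
    (h : x ∈ evenOdd (0 : QuadraticForm ℝ V) 1) : (ExteriorAlgebra.algebraMapInv x : ℝ) = 0 := by
  have h1 := algebraMapInv_involute x
  rw [CliffordAlgebra.involute_eq_of_mem_odd h, map_neg] at h1
  linarith

theorem ιInv_of_even {x : ExteriorAlgebra ℝ V}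
    (h : x ∈ evenOdd (0 : QuadraticForm ℝ V) 0) : ExteriorAlgebra.ιInv (R := ℝ) x = 0 := by
  have h1 := ιInv_involute x
  rw [CliffordAlgebra.involute_eq_of_mem_even h] at h1
  have h2 : (2 : ℝ) • ExteriorAlgebra.ιInv (R := ℝ) x = 0 := by
    rw [two_smul]
    nth_rewrite 1 [h1]
    exact neg_add_cancel _
  exact (smul_eq_zero.1 h2).resolve_left two_ne_zero

/-- By induction on `x` the rule reduces to scalars and vectors, where it is the recursion defining
contraction. It is the graded Leibniz rule that makes contraction with a frame vector an odd
superderivation. -/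
theorem contractLeft_mul (d : Module.Dual ℝ V) (x y : ExteriorAlgebra ℝ V) :
    contractLeft d (x * y) = contractLeft d x * y + involute x * contractLeft d y := by
  induction x using ExteriorAlgebra.induction generalizing y with
  | algebraMap r =>
    rw [CliffordAlgebra.contractLeft_algebraMap_mul, CliffordAlgebra.contractLeft_algebraMap,
      zero_mul, zero_add, AlgHom.commutes]
  | ι v =>
    rw [CliffordAlgebra.contractLeft_ι_mul, CliffordAlgebra.contractLeft_ι,
      CliffordAlgebra.involute_ι, Algebra.smul_def, neg_mul, sub_eq_add_neg]
  | mul a b ha hb =>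
    rw [mul_assoc, ha, hb, ha b, map_mul]
    noncomm_ring
  | add a b ha hb =>
    rw [add_mul, map_add, ha, hb, map_add, map_add]
    noncomm_ring

theorem involute_contractLeft (d : Module.Dual ℝ V) (x : ExteriorAlgebra ℝ V) :
    involute (contractLeft d x) = -contractLeft d (involute x) := by
  induction x using ExteriorAlgebra.induction with
  | algebraMap r => simp
  | ι v => simp
  | mul a b ha hb =>
    rw [contractLeft_mul, map_add, map_mul, map_mul, map_mul, contractLeft_mul, ha, hb]
    noncomm_ring
  | add a b ha hb => rw [map_add, map_add, map_add, map_add, ha, hb, neg_add]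

theorem contractLeft_mem_evenOdd (d : Module.Dual ℝ V) {x : ExteriorAlgebra ℝ V} {a : ZMod 2}
    (h : x ∈ evenOdd (0 : QuadraticForm ℝ V) a) :
    contractLeft d x ∈ evenOdd (0 : QuadraticForm ℝ V) (1 + a) := by
  rw [mem_evenOdd_iff] at h ⊢
  rw [involute_contractLeft, h, map_smul, sgn_add, sgn_one, neg_one_mul, neg_smul]

theorem ι_mem_odd (v : V) :
    ExteriorAlgebra.ι ℝ v ∈ evenOdd (0 : QuadraticForm ℝ V) 1 :=
  CliffordAlgebra.ι_mem_evenOdd_one _ v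

theorem algebraMap_mem_even (r : ℝ) :
    algebraMap ℝ (ExteriorAlgebra ℝ V) r ∈ evenOdd (0 : QuadraticForm ℝ V) 0 := by
  rw [mem_evenOdd_iff, AlgHom.commutes, sgn_zero, one_smul]

theorem mul_mem_evenOdd {x y : ExteriorAlgebra ℝ V} {a b : ZMod 2}
    (hx : x ∈ evenOdd (0 : QuadraticForm ℝ V) a) (hy : y ∈ evenOdd (0 : QuadraticForm ℝ V) b) :
    x * y ∈ evenOdd (0 : QuadraticForm ℝ V) (a + b) := by
  rw [mem_evenOdd_iff] at *
  rw [map_mul, hx, hy, sgn_add, smul_mul_smul_comm]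

theorem ι_mul_comm_sgn (v : V) {x : ExteriorAlgebra ℝ V} {a : ZMod 2}
    (hx : x ∈ evenOdd (0 : QuadraticForm ℝ V) a) :
    x * ExteriorAlgebra.ι ℝ v = sgn a • (ExteriorAlgebra.ι ℝ v * x) := by
  have h : ∀ x : ExteriorAlgebra ℝ V,
      involute x * ExteriorAlgebra.ι ℝ v = ExteriorAlgebra.ι ℝ v * x := by
    intro x
    induction x using ExteriorAlgebra.induction with
    | algebraMap r => rw [AlgHom.commutes, Algebra.commutes]
    | ι w =>
      rw [CliffordAlgebra.involute_ι, neg_mul, neg_eq_iff_add_eq_zero]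
      exact ExteriorAlgebra.ι_add_mul_swap w v
    | mul a b ha hb => rw [map_mul, mul_assoc, hb, ← mul_assoc, ha, mul_assoc]
    | add a b ha hb => rw [map_add, add_mul, mul_add, ha, hb]
  have h1 := h (involute x)
  rw [CliffordAlgebra.involute_involute] at h1
  rw [h1, mem_evenOdd_iff.1 hx, mul_smul_comm]

/-- For fixed `x`, both sides of `x * y = y * x` (even `x`) and of `x * y = involute y * x` (odd
`x`) are compatible with products in `y`, so it is enough to move `x` past a single vector. -/
theorem mul_comm_sgn {x y : ExteriorAlgebra ℝ V} {a b : ZMod 2}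
    (hx : x ∈ evenOdd (0 : QuadraticForm ℝ V) a) (hy : y ∈ evenOdd (0 : QuadraticForm ℝ V) b) :
    x * y = sgn (a * b) • (y * x) := by
  rcases zmod_two_cases a with rfl | rfl
  · have h : ∀ y : ExteriorAlgebra ℝ V, x * y = y * x := by
      intro y
      induction y using ExteriorAlgebra.induction with
      | algebraMap r => rw [Algebra.commutes]
      | ι v => rw [ι_mul_comm_sgn v hx, sgn_zero, one_smul]
      | mul y z hy hz => rw [← mul_assoc, hy, mul_assoc, hz, mul_assoc]
      | add y z hy hz => rw [mul_add, add_mul, hy, hz]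
    rw [zero_mul, sgn_zero, one_smul, h]
  · have h : ∀ y : ExteriorAlgebra ℝ V, x * y = involute y * x := by
      intro y
      induction y using ExteriorAlgebra.induction with
      | algebraMap r => rw [AlgHom.commutes, Algebra.commutes]
      | ι v => rw [ι_mul_comm_sgn v hx, sgn_one, neg_one_smul, CliffordAlgebra.involute_ι, neg_mul]
      | mul y z hy hz => rw [map_mul, ← mul_assoc, hy, mul_assoc, hz, mul_assoc]
      | add y z hy hz => rw [mul_add, map_add, add_mul, hy, hz]
    rw [one_mul, h, mem_evenOdd_iff.1 hy, smul_mul_assoc]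

/-- Exterior powers beyond the rank have dimension a vanishing binomial coefficient, so the algebra
is a finite sum of finite-dimensional powers. Maps into it can then be differentiated by components
in a finite basis. -/
instance finiteDimensional_exteriorAlgebra [FiniteDimensional ℝ V] :
    FiniteDimensional ℝ (ExteriorAlgebra ℝ V) := by
  have h0 : ∀ k, Module.finrank ℝ V < k →
      LinearMap.range (ExteriorAlgebra.ι ℝ : V →ₗ[ℝ] _) ^ k = ⊥ := fun k hk => by
    have h1 : Module.finrank ℝ (⋀[ℝ]^k V) = 0 := by
      rw [exteriorPower.finrank_eq, Nat.choose_eq_zero_of_lt hk]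
    exact Submodule.finrank_eq_zero.1 h1
  have h2 : (⊤ : Submodule ℝ (ExteriorAlgebra ℝ V)) =
      ⨆ i : Fin (Module.finrank ℝ V + 1),
        LinearMap.range (ExteriorAlgebra.ι ℝ : V →ₗ[ℝ] _) ^ (i : ℕ) := by
    refine le_antisymm ?_ le_top
    refine (CliffordAlgebra.iSup_ι_range_eq_top (0 : QuadraticForm ℝ V)).ge.trans
      (iSup_le fun i => ?_)
    by_cases hi : Module.finrank ℝ V < i
    · exact (h0 i hi).le.trans bot_le
    · exact le_iSup (fun i : Fin (Module.finrank ℝ V + 1) =>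
        LinearMap.range (ExteriorAlgebra.ι ℝ : V →ₗ[ℝ] _) ^ (i : ℕ)) ⟨i, by omega⟩
  refine Module.finite_def.2 ?_
  rw [h2]
  refine Submodule.fg_iSup _ fun i => ?_
  exact Module.Finite.iff_fg.1 (inferInstanceAs (Module.Finite ℝ (⋀[ℝ]^(i : ℕ) V)))

end ExteriorAlgebra

/-! ### Superfunctions: smoothness of the components of degree zero and one, and the map ψ ∘ pr. -/

section SuperFunctions

section

variable {B H N : Type*} [NormedAddCommGroup B] [NormedSpace ℝ B] [TopologicalSpace H]
    [TopologicalSpace N] [ChartedSpace H N] {I : ModelWithCorners ℝ B H} {V W : Opens N}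

theorem contMDiffAt_of_restrict (h : W ≤ V) {f : V → ℝ} {y : N} (hy : y ∈ W)
    (hf : ContMDiffAt I 𝓘(ℝ, ℝ) ∞ (fun z : W => f ⟨z, h z.2⟩) ⟨y, hy⟩) :
    ContMDiffAt I 𝓘(ℝ, ℝ) ∞ f ⟨y, h hy⟩ := by
  classical
  let F : N → ℝ := fun z => if hz : z ∈ V then f ⟨z, hz⟩ else 0
  have h1 : (fun z : V => F z) = f := by ext z; exact dif_pos z.2
  have h2 : (fun z : W => F z) = fun z : W => f ⟨z, h z.2⟩ := by ext z; exact dif_pos (h z.2)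
  rw [← h2] at hf
  rw [← h1]
  exact contMDiffAt_subtype_iff.2 (contMDiffAt_subtype_iff (U := W) (f := F).1 hf)

end

variable {n m : ℕ} {M : Type*} [TopologicalSpace M] [ChartedSpace (EuclideanSpace ℝ (Fin n)) M]
  [IsManifold (𝓡 n) ∞ M]
  {E : M → Type*} [∀ x, AddCommGroup (E x)] [∀ x, Module ℝ (E x)] [∀ x, TopologicalSpace (E x)]
  [TopologicalSpace (TotalSpace (EuclideanSpace ℝ (Fin m)) E)]
  [FiberBundle (EuclideanSpace ℝ (Fin m)) E] [VectorBundle ℝ (EuclideanSpace ℝ (Fin m)) E]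
  [ContMDiffVectorBundle ∞ (EuclideanSpace ℝ (Fin m)) E (𝓡 n)]
  {U V W : Opens M}

theorem preim_mono (h : V ≤ U) : preim m E V ≤ preim m E U := fun _ he => h he

/-- The pull-back of a smooth function to the total space. -/
def Smooth.pull (f : Smooth (𝓡 n) U) : Smooth (totModel n m) (preim m E U) :=
  ⟨fun e => f (proj e), fun e => by
    have h1 : ContMDiffAt (totModel n m) (𝓡 n) ∞ (fun e : preim m E U => e.1.proj) e :=
      ((contMDiff_proj E).comp contMDiff_subtype_val).contMDiffAt
    have h2 : (fun e : preim m E U => f (proj e)) = fun e : preim m E U => f.extend e.1.proj := by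
      ext e
      exact (f.extend_of_mem e.2).symm
    rw [h2]
    exact ContMDiffAt.comp e (f.contMDiffAt_extend e.2) h1⟩

@[simp] theorem Smooth.pull_apply (f : Smooth (𝓡 n) U) (e : preim m E U) :
    f.pull e = f (proj e) := rfl

/-- The value of the fibrewise linear function given by a section of the dual bundle. -/
def evalDual (η : ∀ x : U, Module.Dual ℝ (E x)) (e : preim m E U) : ℝ := η (proj e) e.1.snd

theorem evalDual_add (η ζ : ∀ x : U, Module.Dual ℝ (E x)) (e : preim m E U) :
    evalDual (fun x => η x + ζ x) e = evalDual η e + evalDual ζ e := rfl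

theorem evalDual_smul (f : U → ℝ) (η : ∀ x : U, Module.Dual ℝ (E x)) (e : preim m E U) :
    evalDual (fun x => f x • η x) e = f (proj e) * evalDual η e := rfl

theorem evalDual_zero (e : preim m E U) :
    evalDual (fun x : U => (0 : Module.Dual ℝ (E x))) e = 0 := rfl

/-- The fibrewise linear function given by a smooth section of the dual bundle. -/
def dualFun (η : ∀ x : U, Module.Dual ℝ (E x)) (hη : IsSmoothDual n m U η) :
    Smooth (totModel n m) (preim m E U) :=
  ⟨fun e => η (proj e) e.1.snd, hη⟩

theorem IsSmoothDual.add {η ζ : ∀ x : U, Module.Dual ℝ (E x)} (hη : IsSmoothDual n m U η)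
    (hζ : IsSmoothDual n m U ζ) : IsSmoothDual n m U fun x => η x + ζ x :=
  (dualFun η hη + dualFun ζ hζ).contMDiff

theorem IsSmoothDual.smul (f : Smooth (𝓡 n) U) {η : ∀ x : U, Module.Dual ℝ (E x)}
    (hη : IsSmoothDual n m U η) : IsSmoothDual n m U fun x => f x • η x :=
  (f.pull * dualFun η hη).contMDiff

theorem isSmoothDual_zero : IsSmoothDual n m U fun x => (0 : Module.Dual ℝ (E x)) :=
  (0 : Smooth (totModel n m) (preim m E U)).contMDiff

theorem IsSmoothDual.res {η : ∀ x : U, Module.Dual ℝ (E x)} (hη : IsSmoothDual n m U η)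
    (h : V ≤ U) : IsSmoothDual n m V fun x => η ⟨x, h x.2⟩ :=
  ((dualFun η hη).res (preim_mono h)).contMDiff

namespace SuperFun

/-- Smooth functions as superfunctions. -/
def ofSmooth (f : Smooth (𝓡 n) U) : SuperFun n m E U :=
  ⟨fun y => algebraMap ℝ (Lam E y) (f y), mem_superFun_of_gens (Or.inl ⟨f, rfl⟩)⟩

/-- Smooth sections of the dual bundle as superfunctions. -/
def ofDual (η : ∀ x : U, Module.Dual ℝ (E x)) (hη : IsSmoothDual n m U η) : SuperFun n m E U :=
  ⟨fun y => ExteriorAlgebra.ι ℝ (η y), mem_superFun_of_gens (Or.inr ⟨η, hη, rfl⟩)⟩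

theorem ext {f g : SuperFun n m E U} (h : ∀ x, f.1 x = g.1 x) : f = g := Subtype.ext (funext h)

theorem res_mul (h : V ≤ U) (f g : SuperFun n m E U) : (f * g).res h = f.res h * g.res h := rfl

theorem res_add (h : V ≤ U) (f g : SuperFun n m E U) : (f + g).res h = f.res h + g.res h := rfl

/-- Smoothness is local, and locally a superfunction lies in the algebra generated by functions and
sections of E^*, where induction applies. Both components are treated together because the
degree-one part of a product involves the degree-zero parts of its factors. -/
theorem red_pull_contMDiff (f : SuperFun n m E U) :
    ContMDiff (𝓡 n) 𝓘(ℝ, ℝ) ∞ f.red ∧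
      IsSmoothDual n m U fun x => ExteriorAlgebra.ιInv (f.1 x) := by
  have key : ∀ (V : Opens M) (s : ∀ x : V, Lam E x),
      s ∈ Algebra.adjoin ℝ (superGens (E := E) n m V) →
      ∃ (r : Smooth (𝓡 n) V) (η : ∀ x : V, Module.Dual ℝ (E x)), IsSmoothDual n m V η ∧
        ∀ x, ExteriorAlgebra.algebraMapInv (s x) = r x ∧ ExteriorAlgebra.ιInv (s x) = η x := by
    intro V s hs
    induction hs using Algebra.adjoin_induction with
    | mem s hs =>
      rcases hs with ⟨f, rfl⟩ | ⟨η, hη, rfl⟩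
      · exact ⟨f, _, isSmoothDual_zero, fun x => ⟨algebraMapInv_algebraMap _, ιInv_algebraMap _⟩⟩
      · exact ⟨0, η, hη, fun x => ⟨algebraMapInv_ι _, ιInv_ι _⟩⟩
    | algebraMap r =>
      exact ⟨algebraMap ℝ _ r, _, isSmoothDual_zero, fun x =>
        ⟨algebraMapInv_algebraMap _, ιInv_algebraMap _⟩⟩
    | add s t _ _ hs ht =>
      obtain ⟨r, η, hη, h⟩ := hs
      obtain ⟨r', η', hη', h'⟩ := ht
      refine ⟨r + r', _, hη.add hη', fun x => ⟨?_, ?_⟩⟩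
      · rw [Pi.add_apply, map_add, (h x).1, (h' x).1]; rfl
      · rw [Pi.add_apply, map_add, (h x).2, (h' x).2]
    | mul s t _ _ hs ht =>
      obtain ⟨r, η, hη, h⟩ := hs
      obtain ⟨r', η', hη', h'⟩ := ht
      refine ⟨r * r', _, (hη'.smul r).add (hη.smul r'), fun x => ⟨?_, ?_⟩⟩
      · rw [Pi.mul_apply, map_mul, (h x).1, (h' x).1]; rfl
      · rw [Pi.mul_apply, ιInv_mul, (h x).2, (h' x).2, (h x).1, (h' x).1]
  refine ⟨fun x => ?_, fun e => ?_⟩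
  · obtain ⟨V, hV, hx, hs⟩ := f.2 x
    obtain ⟨r, η, -, h⟩ := key V _ hs
    refine contMDiffAt_of_restrict hV hx ?_
    exact (r.contMDiff _).congr_of_eventuallyEq (Filter.Eventually.of_forall fun z => (h z).1)
  · obtain ⟨V, hV, hx, hs⟩ := f.2 (proj e)
    obtain ⟨r, η, hη, h⟩ := key V _ hs
    refine contMDiffAt_of_restrict (preim_mono hV) hx ?_
    refine (hη _).congr_of_eventuallyEq (Filter.Eventually.of_forall fun z => ?_)
    exact congrArg (fun ζ : Module.Dual ℝ (E z.1.proj) => ζ z.1.snd) (h (proj z)).2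

/-- The reduction of a superfunction, as a smooth function. -/
def redS (f : SuperFun n m E U) : Smooth (𝓡 n) U := ⟨f.red, f.red_pull_contMDiff.1⟩

/-- The component of degree one of a superfunction. -/
def lin (f : SuperFun n m E U) (x : U) : Module.Dual ℝ (E x) := ExteriorAlgebra.ιInv (f.1 x)

theorem lin_smooth (f : SuperFun n m E U) : IsSmoothDual n m U f.lin := f.red_pull_contMDiff.2

/-- The map `ψ ∘ pr` with values in smooth functions on the total space. -/
def psiS (f : SuperFun n m E U) : Smooth (totModel n m) (preim m E U) :=
  f.redS.pull + dualFun f.lin f.lin_smooth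

theorem psi_eq (f : SuperFun n m E U) (e : preim m E U) :
    f.psi e = f.red (proj e) + evalDual f.lin e := rfl

theorem red_mul (f g : SuperFun n m E U) (x : U) : (f * g).red x = f.red x * g.red x :=
  map_mul ExteriorAlgebra.algebraMapInv (f.1 x) (g.1 x)

theorem red_add (f g : SuperFun n m E U) (x : U) : (f + g).red x = f.red x + g.red x :=
  map_add ExteriorAlgebra.algebraMapInv (f.1 x) (g.1 x)

theorem lin_mul (f g : SuperFun n m E U) :
    (f * g).lin = fun x => f.red x • g.lin x + g.red x • f.lin x :=
  funext fun x => ιInv_mul (f.1 x) (g.1 x)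

theorem lin_add (f g : SuperFun n m E U) : (f + g).lin = fun x => f.lin x + g.lin x :=
  funext fun x => map_add ExteriorAlgebra.ιInv (f.1 x) (g.1 x)

theorem red_smul (r : ℝ) (f : SuperFun n m E U) (x : U) : (r • f).red x = r * f.red x :=
  map_smul ExteriorAlgebra.algebraMapInv r (f.1 x)

theorem lin_smul (r : ℝ) (f : SuperFun n m E U) : (r • f).lin = fun x => r • f.lin x :=
  funext fun x => map_smul ExteriorAlgebra.ιInv r (f.1 x)

theorem psi_mul (f g : SuperFun n m E U) (e : preim m E U) :
    (f * g).psi e = f.red (proj e) * g.psi e + g.red (proj e) * evalDual f.lin e := by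
  rw [psi_eq, red_mul, lin_mul, psi_eq, evalDual_add (fun x => f.red x • g.lin x),
    evalDual_smul, evalDual_smul]
  ring

/-- `ψ ∘ pr` as a linear map. -/
def psiHom (e : preim m E U) : SuperFun n m E U →ₗ[ℝ] ℝ where
  toFun f := f.psi e
  map_add' f g := by
    rw [psi_eq, red_add, lin_add, evalDual_add, psi_eq, psi_eq, add_add_add_comm]
  map_smul' r f := by
    rw [psi_eq, red_smul, lin_smul, evalDual_smul (fun _ => r), psi_eq, ← mul_add]
    rfl

theorem psi_add (f g : SuperFun n m E U) (e : preim m E U) :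
    (f + g).psi e = f.psi e + g.psi e := map_add (psiHom e) f g

theorem psi_smul (r : ℝ) (f : SuperFun n m E U) (e : preim m E U) :
    (r • f).psi e = r * f.psi e := map_smul (psiHom e) r f

theorem psi_sum {κ : Type*} (s : Finset κ) (f : κ → SuperFun n m E U) (e : preim m E U) :
    (∑ i ∈ s, f i).psi e = ∑ i ∈ s, (f i).psi e := map_sum (psiHom e) f s

theorem red_ofSmooth (f : Smooth (𝓡 n) U) (x : U) : (ofSmooth f : SuperFun n m E U).red x = f x :=
  algebraMapInv_algebraMap _

theorem lin_ofSmooth (f : Smooth (𝓡 n) U) : (ofSmooth f : SuperFun n m E U).lin = fun _ => 0 :=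
  funext fun _ => ιInv_algebraMap _

theorem red_ofDual {η : ∀ x : U, Module.Dual ℝ (E x)} (hη : IsSmoothDual n m U η) (x : U) :
    (ofDual η hη).red x = 0 := algebraMapInv_ι _

theorem lin_ofDual {η : ∀ x : U, Module.Dual ℝ (E x)} (hη : IsSmoothDual n m U η) :
    (ofDual η hη).lin = η := funext fun _ => ιInv_ι _

theorem psi_ofSmooth (f : Smooth (𝓡 n) U) (e : preim m E U) :
    (ofSmooth f).psi e = f (proj e) := by
  rw [psi_eq, red_ofSmooth, lin_ofSmooth, evalDual_zero, add_zero]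

theorem psi_ofDual {η : ∀ x : U, Module.Dual ℝ (E x)} (hη : IsSmoothDual n m U η)
    (e : preim m E U) : (ofDual η hη).psi e = evalDual η e := by
  rw [psi_eq, red_ofDual, lin_ofDual, zero_add]

theorem psi_ofSmooth_mul (f : Smooth (𝓡 n) U) (g : SuperFun n m E U) (e : preim m E U) :
    (ofSmooth f * g).psi e = f (proj e) * g.psi e := by
  rw [psi_mul, red_ofSmooth, lin_ofSmooth, evalDual_zero, mul_zero, add_zero]

/-- A factor of degree one already exhausts the degrees that ψ ∘ pr retains, so the other factor
contributes only its reduction. This is why the odd frame enters the induced form through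
reductions. -/
theorem psi_ofDual_mul {η : ∀ x : U, Module.Dual ℝ (E x)} (hη : IsSmoothDual n m U η)
    (g : SuperFun n m E U) (e : preim m E U) :
    (ofDual η hη * g).psi e = evalDual η e * g.red (proj e) := by
  rw [psi_mul, red_ofDual, lin_ofDual, zero_mul, zero_add, mul_comm]

theorem hasParity_ofSmooth (f : Smooth (𝓡 n) U) : (ofSmooth f : SuperFun n m E U).HasParity 0 :=
  fun _ => algebraMap_mem_even _

theorem hasParity_ofDual {η : ∀ x : U, Module.Dual ℝ (E x)} (hη : IsSmoothDual n m U η) :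
    (ofDual η hη).HasParity 1 := fun _ => ι_mem_odd _

theorem red_of_odd {f : SuperFun n m E U} (hf : f.HasParity 1) (x : U) : f.red x = 0 :=
  algebraMapInv_of_odd (hf x)

theorem lin_of_even {f : SuperFun n m E U} (hf : f.HasParity 0) (x : U) : f.lin x = 0 :=
  ιInv_of_even (hf x)

theorem IsAffine.eq {f : SuperFun n m E U} (hf : f.IsAffine) :
    f = ofSmooth f.redS + ofDual f.lin f.lin_smooth := by
  refine SuperFun.ext fun x => ?_
  obtain ⟨r, η, h⟩ := hf x
  change f.1 x = algebraMap ℝ _ (ExteriorAlgebra.algebraMapInv (f.1 x)) +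
    ExteriorAlgebra.ι ℝ (ExteriorAlgebra.ιInv (f.1 x))
  rw [h, map_add ExteriorAlgebra.algebraMapInv, map_add ExteriorAlgebra.ιInv,
    algebraMapInv_algebraMap, algebraMapInv_ι, ιInv_algebraMap, ιInv_ι, add_zero, zero_add]

theorem IsAffine.eq_of_even {f : SuperFun n m E U} (hf : f.IsAffine) (h0 : f.HasParity 0) :
    f = ofSmooth f.redS := by
  refine SuperFun.ext fun x => ?_
  have h := congrArg (fun k : SuperFun n m E U => k.1 x) hf.eq
  refine h.trans ?_
  change _ + ExteriorAlgebra.ι ℝ (f.lin x) = _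
  rw [lin_of_even h0, map_zero, add_zero]

theorem IsAffine.eq_of_odd {f : SuperFun n m E U} (hf : f.IsAffine) (h1 : f.HasParity 1) :
    f = ofDual f.lin f.lin_smooth := by
  refine SuperFun.ext fun x => ?_
  have h := congrArg (fun k : SuperFun n m E U => k.1 x) hf.eq
  refine h.trans ?_
  change algebraMap ℝ (Lam E x) (f.red x) + _ = _
  rw [red_of_odd h1, map_zero, zero_add]

theorem isAffine_ofSmooth (f : Smooth (𝓡 n) U) : (ofSmooth f : SuperFun n m E U).IsAffine :=
  fun x => ⟨f x, 0, by rw [map_zero, add_zero]; rfl⟩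

theorem isAffine_ofDual {η : ∀ x : U, Module.Dual ℝ (E x)} (hη : IsSmoothDual n m U η) :
    (ofDual η hη).IsAffine :=
  fun x => ⟨0, η x, by rw [map_zero, zero_add]; rfl⟩

theorem HasParity.res {f : SuperFun n m E U} {a : ZMod 2} (hf : f.HasParity a) (h : V ≤ U) :
    (f.res h).HasParity a := fun x => hf ⟨x, h x.2⟩

theorem HasParity.mul_comm {f g : SuperFun n m E U} {a b : ZMod 2} (hf : f.HasParity a)
    (hg : g.HasParity b) : f * g = sgn (a * b) • (g * f) :=
  SuperFun.ext fun x => mul_comm_sgn (hf x) (hg x)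

theorem HasParity.mul {f g : SuperFun n m E U} {a b : ZMod 2} (hf : f.HasParity a)
    (hg : g.HasParity b) : (f * g).HasParity (a + b) :=
  fun x => mul_mem_evenOdd (hf x) (hg x)

end SuperFun

end SuperFunctions

/-! ### Coordinates on the base and on the total space; the frame dual to the coframe. -/

section BundleCoordinates

variable {n m : ℕ} {M : Type*} [TopologicalSpace M] [ChartedSpace (EuclideanSpace ℝ (Fin n)) M]
  [IsManifold (𝓡 n) ∞ M]
  {E : M → Type*} [∀ x, AddCommGroup (E x)] [∀ x, Module ℝ (E x)] [∀ x, TopologicalSpace (E x)]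
  [TopologicalSpace (TotalSpace (EuclideanSpace ℝ (Fin m)) E)]
  [FiberBundle (EuclideanSpace ℝ (Fin m)) E] [VectorBundle ℝ (EuclideanSpace ℝ (Fin m)) E]
  [ContMDiffVectorBundle ∞ (EuclideanSpace ℝ (Fin m)) E (𝓡 n)]

namespace BundleCoords

variable (c : BundleCoords n m E) {V W : Opens M}

/-- The coordinates on the base. -/
def baseCoords : LocalCoords M (𝓡 n) (Fin n) where
  U := c.U
  φ := c.chart.transHomeomorph (EuclideanSpace.equiv (Fin n) ℝ).toHomeomorph
  smooth := (EuclideanSpace.equiv (Fin n) ℝ).contDiff.contMDiff.comp_contMDiffOn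
    (contMDiffOn_of_mem_maximalAtlas c.chart_mem)
  symm_smooth := (contMDiffOn_symm_of_mem_maximalAtlas c.chart_mem).comp
    (EuclideanSpace.equiv (Fin n) ℝ).symm.contDiff.contMDiff.contMDiffOn fun _ hy => hy
  le_source := c.U_le_chart

/-- The linear identification of the model space of the total space with a space of tuples. -/
def modelEquiv : (EuclideanSpace ℝ (Fin n) × EuclideanSpace ℝ (Fin m)) ≃L[ℝ]
    (Fin n ⊕ Fin m → ℝ) :=
  (((EuclideanSpace.equiv (Fin n) ℝ).toLinearEquiv.prodCongr c.basis.equivFun).trans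
    (LinearEquiv.sumArrowLequivProdArrow (Fin n) (Fin m) ℝ ℝ).symm).toContinuousLinearEquiv

/-- The coordinates on the total space. -/
def totCoords : LocalCoords (Tot m E) (totModel n m) (Fin n ⊕ Fin m) where
  U := preim m E c.U
  φ := (c.triv.toOpenPartialHomeomorph.trans (c.chart.prod
    (OpenPartialHomeomorph.refl (EuclideanSpace ℝ (Fin m))))).transHomeomorph
      c.modelEquiv.toHomeomorph
  smooth := by
    refine c.modelEquiv.contDiff.contMDiff.comp_contMDiffOn ?_
    have h0 : ContMDiffOn (totModel n m) (totModel n m) ∞ c.triv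
        (c.triv.toOpenPartialHomeomorph.trans (c.chart.prod
          (OpenPartialHomeomorph.refl (EuclideanSpace ℝ (Fin m))))).source :=
      c.triv_smooth.mono fun e he => he.1
    have h1 : ContMDiffOn (𝓡 n) (𝓡 n) ∞ c.chart c.chart.source :=
      contMDiffOn_of_mem_maximalAtlas c.chart_mem
    exact (h1.comp (contMDiff_fst.comp_contMDiffOn h0) fun e he => he.2.1).prodMk_space
      (contMDiff_snd.comp_contMDiffOn h0)
  symm_smooth := by
    have h0 : ContMDiff 𝓘(ℝ, Fin n ⊕ Fin m → ℝ)
        𝓘(ℝ, EuclideanSpace ℝ (Fin n) × EuclideanSpace ℝ (Fin m)) ∞ c.modelEquiv.symm :=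
      c.modelEquiv.symm.contDiff.contMDiff
    have h2 := contMDiffOn_symm_of_mem_maximalAtlas c.chart_mem
    have h3 : ContMDiff 𝓘(ℝ, Fin n ⊕ Fin m → ℝ) (𝓡 n) ∞ fun y => (c.modelEquiv.symm y).1 :=
      (ContinuousLinearMap.fst ℝ (EuclideanSpace ℝ (Fin n))
        (EuclideanSpace ℝ (Fin m))).contDiff.contMDiff.comp h0
    have h4 : ContMDiff 𝓘(ℝ, Fin n ⊕ Fin m → ℝ) 𝓘(ℝ, EuclideanSpace ℝ (Fin m)) ∞
        fun y => (c.modelEquiv.symm y).2 :=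
      (ContinuousLinearMap.snd ℝ (EuclideanSpace ℝ (Fin n))
        (EuclideanSpace ℝ (Fin m))).contDiff.contMDiff.comp h0
    exact c.triv_symm_smooth.comp (t := c.triv.target)
      ((h2.comp h3.contMDiffOn fun y hy => hy.1.1).prodMk h4.contMDiffOn) fun y hy => hy.2
  le_source := fun e he => ⟨c.triv.mem_source.2 (c.U_le_triv he), by
    have h : (c.triv e).1 = e.proj := c.triv.coe_fst (c.triv.mem_source.2 (c.U_le_triv he))
    refine ⟨?_, trivial⟩
    change (c.triv e).1 ∈ c.chart.source
    rw [h]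
    exact c.U_le_chart he⟩

theorem totCoords_x (r : Fin n ⊕ Fin m) : c.totCoords.x r = c.coord r := by
  ext e
  rcases r with i | α
  · change c.chart (c.triv e.1).1 i = c.chart e.1.proj i
    rw [c.triv.coe_fst (c.triv.mem_source.2 (c.U_le_triv e.2))]
  · exact (c.coframe_apply α e).symm

/-- The local frame of `E` given by the basis of the typical fibre. -/
def dualFrame (α : Fin m) (y : c.U) : E y :=
  have := c.triv_linear
  c.triv.symmₗ ℝ y (c.basis α)

theorem coframe_dualFrame (α β : Fin m) (y : c.U) :
    c.coframe α y (c.dualFrame β y) = if α = β then 1 else 0 := by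
  have := c.triv_linear
  change c.basis.coord α (c.triv.linearMapAt ℝ y (c.triv.symmₗ ℝ y (c.basis β))) = _
  rw [c.triv.linearMapAt_symmₗ (c.U_le_triv y.2), c.basis.coord_apply, c.basis.repr_self,
    Finsupp.single_apply]
  simp only [eq_comm]

theorem sum_coframe_smul_dualFrame (y : c.U) (v : E y) :
    v = ∑ α, c.coframe α y v • c.dualFrame α y := by
  have := c.triv_linear
  have h1 : c.triv.symmₗ ℝ y (c.triv.linearMapAt ℝ y v) = v :=
    c.triv.symmₗ_linearMapAt (c.U_le_triv y.2) v
  conv_lhs => rw [← h1, ← c.basis.sum_repr (c.triv.linearMapAt ℝ y v), map_sum]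
  refine Finset.sum_congr rfl fun α _ => ?_
  rw [map_smul]
  rfl

theorem dual_eq_sum (y : c.U) (η : Module.Dual ℝ (E y)) :
    η = ∑ α, η (c.dualFrame α y) • c.coframe α y := by
  ext v
  conv_lhs => rw [c.sum_coframe_smul_dualFrame y v, map_sum]
  rw [LinearMap.sum_apply]
  refine Finset.sum_congr rfl fun α _ => ?_
  rw [map_smul, LinearMap.smul_apply, smul_eq_mul, smul_eq_mul, mul_comm]

/-- The coefficients of a section of the dual bundle in the local frame. -/
def dualCoeff (hV : V ≤ c.U) (η : ∀ x : V, Module.Dual ℝ (E x)) (hη : IsSmoothDual n m V η)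
    (α : Fin m) : Smooth (𝓡 n) V :=
  ⟨fun x => η x (c.dualFrame α ⟨x, hV x.2⟩), fun x => by
    have := c.triv_linear
    let F := (dualFun η hη).extend
    -- The coefficient along a coframe element is the fibrewise linear function of `η` evaluated
    -- along a local frame section of `E`. That section is smooth because the inverse trivialization
    -- is.
    let σ : V → Tot m E := fun x => c.triv.toOpenPartialHomeomorph.symm ((x : M), c.basis α)
    have hσ : ∀ x : V, σ x = ⟨x, c.dualFrame α ⟨x, hV x.2⟩⟩ := fun x => by
      have h1 := c.triv.mk_symm (c.U_le_triv (hV x.2)) (c.basis α)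
      exact h1.symm.trans (congrArg (TotalSpace.mk' (EuclideanSpace ℝ (Fin m)) (x : M))
        (congrFun (c.triv.coe_symmₗ (R := ℝ) (c.U_le_triv (hV x.2))) (c.basis α)).symm)
    have hs : ContMDiffAt (𝓡 n) (totModel n m) ∞ σ x := by
      have h1 : (x.1, c.basis α) ∈ c.triv.target :=
        c.triv.mem_target.2 (c.U_le_triv (hV x.2))
      exact ContMDiffAt.comp x (c.triv_symm_smooth.contMDiffAt (c.triv.open_target.mem_nhds h1))
        ((contMDiff_subtype_val.prodMk contMDiff_const) x)
    have h2 : (fun x : V => η x (c.dualFrame α ⟨x, hV x.2⟩)) = F ∘ σ := by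
      ext x
      rw [Function.comp_apply, hσ]
      exact ((dualFun η hη).extend_of_mem (y := ⟨x, c.dualFrame α ⟨x, hV x.2⟩⟩) x.2).symm
    rw [h2]
    refine ContMDiffAt.comp x ((dualFun η hη).contMDiffAt_extend ?_) hs
    rw [hσ]
    exact x.2⟩

end BundleCoords

end BundleCoordinates

/-! ### Superderivations are determined by their values on coordinates. -/

section SuperDerivationUniqueness

variable {n m : ℕ} {M : Type*} [TopologicalSpace M] [ChartedSpace (EuclideanSpace ℝ (Fin n)) M]
  [IsManifold (𝓡 n) ∞ M]
  {E : M → Type*} [∀ x, AddCommGroup (E x)] [∀ x, Module ℝ (E x)] [∀ x, TopologicalSpace (E x)]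
  [TopologicalSpace (TotalSpace (EuclideanSpace ℝ (Fin m)) E)]
  [FiberBundle (EuclideanSpace ℝ (Fin m)) E] [VectorBundle ℝ (EuclideanSpace ℝ (Fin m)) E]
  [ContMDiffVectorBundle ∞ (EuclideanSpace ℝ (Fin m)) E (𝓡 n)]

variable {U V W : Opens M}

namespace SuperFun

/-- Smooth functions as superfunctions, as an algebra homomorphism. -/
def ofSmoothHom : Smooth (𝓡 n) U →ₐ[ℝ] SuperFun n m E U where
  toFun := ofSmooth
  map_one' := SuperFun.ext fun x => map_one (algebraMap ℝ (Lam E x))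
  map_mul' f g := SuperFun.ext fun x => map_mul (algebraMap ℝ (Lam E x)) (f x) (g x)
  map_zero' := SuperFun.ext fun x => map_zero (algebraMap ℝ (Lam E x))
  map_add' f g := SuperFun.ext fun x => map_add (algebraMap ℝ (Lam E x)) (f x) (g x)
  commutes' _ := rfl

theorem ofSmooth_mul (f g : Smooth (𝓡 n) U) :
    (ofSmooth (f * g) : SuperFun n m E U) = ofSmooth f * ofSmooth g := map_mul ofSmoothHom f g

/-- The value of a superfunction at a point. -/
def evalHom (x : U) : SuperFun n m E U →ₐ[ℝ] Lam E x where
  toFun f := f.1 x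
  map_one' := rfl
  map_mul' _ _ := rfl
  map_zero' := rfl
  map_add' _ _ := rfl
  commutes' _ := rfl

theorem sum_apply {κ : Type*} (s : Finset κ) (f : κ → SuperFun n m E U) (x : U) :
    (∑ i ∈ s, f i).1 x = ∑ i ∈ s, (f i).1 x := map_sum (evalHom x) f s

/-- Restriction of superfunctions, as an algebra homomorphism. -/
def resHom (h : V ≤ U) : SuperFun n m E U →ₐ[ℝ] SuperFun n m E V where
  toFun f := f.res h
  map_one' := rfl
  map_mul' _ _ := rfl
  map_zero' := rfl
  map_add' _ _ := rfl
  commutes' _ := rfl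

theorem hasParity_one : (1 : SuperFun n m E U).HasParity 0 := fun _ => by
  change (1 : Lam E _) ∈ _
  rw [mem_evenOdd_iff, map_one, sgn_zero, one_smul]

end SuperFun

open SuperFun

namespace BundleCoords

variable (c : BundleCoords n m E)

theorem ofDual_eq_sum (hV : V ≤ c.U) {η : ∀ x : V, Module.Dual ℝ (E x)}
    (hη : IsSmoothDual n m V η) :
    ofDual η hη = ∑ α, ofSmooth (c.dualCoeff hV η hη α) * (c.superCoord (.inr α)).res hV := by
  refine SuperFun.ext fun x => ?_
  rw [SuperFun.sum_apply]
  change ExteriorAlgebra.ι ℝ (η x) = ∑ α, algebraMap ℝ (Lam E x) (η x (c.dualFrame α ⟨x, hV x.2⟩)) *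
    ExteriorAlgebra.ι ℝ (c.coframe α ⟨x, hV x.2⟩)
  conv_lhs => rw [c.dual_eq_sum ⟨x, hV x.2⟩ (η x), map_sum]
  refine Finset.sum_congr rfl fun α _ => ?_
  rw [map_smul, Algebra.smul_def]

end BundleCoords

namespace SuperDer

variable {a : ZMod 2} {X Y : SuperFam n m E U}

theorem map_res (hX : X ∈ SuperDer n m E a U) (hV : V ≤ U) (h : W ≤ V) (f : SuperFun n m E V) :
    (X ⟨V, hV⟩ f).res h = X ⟨W, h.trans hV⟩ (f.res h) := hX.1 V W hV h f

theorem map_even_mul (hX : X ∈ SuperDer n m E a U) (hV : V ≤ U) {f : SuperFun n m E V}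
    (hf : f.HasParity 0) (g : SuperFun n m E V) :
    X ⟨V, hV⟩ (f * g) = X ⟨V, hV⟩ f * g + f * X ⟨V, hV⟩ g := by
  rw [hX.2.2 V hV 0 f g hf, mul_zero, sgn_zero, one_smul]

theorem map_one (hX : X ∈ SuperDer n m E a U) (hV : V ≤ U) : X ⟨V, hV⟩ 1 = 0 := by
  have h := map_even_mul hX hV (hasParity_one (n := n) (m := m)) 1
  rw [mul_one, mul_one, one_mul] at h
  exact left_eq_add.1 h

/-- On functions, which are even, the graded Leibniz rule carries no sign; evaluated at `p`, a
superderivation of either parity is therefore an ordinary derivation at `p` with values in the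
exterior algebra of the dual fibre. Hadamard's lemma applies to it. -/
theorem map_ofSmooth (c : BundleCoords n m E) (hX : X ∈ SuperDer n m E a U) (hU : U ≤ c.U)
    (hV : V ≤ U) (f : Smooth (𝓡 n) V) :
    X ⟨V, hV⟩ (ofSmooth f) = ∑ i, ofSmooth (c.baseCoords.pd (hV.trans hU) i f) *
      X ⟨V, hV⟩ ((c.superCoord (.inl i)).res (hV.trans hU)) := by
  refine SuperFun.ext fun p => ?_
  let D : ∀ W : Opens M, W ≤ V → p.1 ∈ W → (Smooth (𝓡 n) W →ₗ[ℝ] Lam E p) := fun W hW hp =>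
    (evalHom (E := E) (n := n) (m := m) (⟨p, hp⟩ : W)).toLinearMap ∘ₗ X ⟨W, hW.trans hV⟩ ∘ₗ
      ofSmoothHom.toLinearMap
  have h := c.baseCoords.pointDerivation_eq (hV.trans hU) p.2 D
    (fun W hW hp f => congrArg (fun k : SuperFun n m E W => k.1 ⟨p, hp⟩)
      (map_res hX hV hW (ofSmooth f)).symm)
    (fun W hW hp f g => by
      change (X ⟨W, hW.trans hV⟩ (ofSmooth (f * g))).1 ⟨p, hp⟩ = _
      rw [ofSmooth_mul, map_even_mul hX _ (hasParity_ofSmooth f), add_comm]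
      change algebraMap ℝ (Lam E p) (f ⟨p, hp⟩) * (X ⟨W, hW.trans hV⟩ (ofSmooth g)).1 ⟨p, hp⟩ +
        (X ⟨W, hW.trans hV⟩ (ofSmooth f)).1 ⟨p, hp⟩ * algebraMap ℝ (Lam E p) (g ⟨p, hp⟩) = _
      rw [← Algebra.smul_def, ← Algebra.commutes, ← Algebra.smul_def]
      rfl) f
  rw [SuperFun.sum_apply]
  refine h.trans (Finset.sum_congr rfl fun i _ => ?_)
  exact Algebra.smul_def _ _

/-- `X` kills functions by the coordinate formula, hence sections of E^*, which are combinations of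
the coframe with functions as coefficients, hence by the Leibniz rule all products of these. Every
superfunction is locally a combination of such products, and `X` commutes with restrictions. -/
theorem eq_zero_of_superCoord (c : BundleCoords n m E) (hX : X ∈ SuperDer n m E a U) (hU : U ≤ c.U)
    (h0 : ∀ s, X ⟨U, le_rfl⟩ ((c.superCoord s).res hU) = 0) : X = 0 := by
  have hc : ∀ (V : Opens M) (hV : V ≤ U) s, X ⟨V, hV⟩ ((c.superCoord s).res (hV.trans hU)) = 0 := by
    intro V hV s
    have h1 := map_res hX le_rfl hV ((c.superCoord s).res hU)
    rw [h0] at h1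
    exact h1.symm
  have hs : ∀ (V : Opens M) (hV : V ≤ U) (f : Smooth (𝓡 n) V), X ⟨V, hV⟩ (ofSmooth f) = 0 := by
    intro V hV f
    rw [map_ofSmooth c hX hU hV f]
    simp only [hc, mul_zero, Finset.sum_const_zero]
  have hd : ∀ (V : Opens M) (hV : V ≤ U) (η : ∀ x : V, Module.Dual ℝ (E x))
      (hη : IsSmoothDual n m V η), X ⟨V, hV⟩ (ofDual η hη) = 0 := by
    intro V hV η hη
    rw [c.ofDual_eq_sum (hV.trans hU), map_sum]
    refine Finset.sum_eq_zero fun α _ => ?_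
    rw [map_even_mul hX hV (hasParity_ofSmooth _), hs, hc, zero_mul, mul_zero, add_zero]
  have ha : ∀ (V : Opens M) (hV : V ≤ U) (s : SuperFun n m E V),
      s.1 ∈ Algebra.adjoin ℝ (superGens n m V) → X ⟨V, hV⟩ s = 0 := by
    intro V hV s hs'
    -- The graded Leibniz rule is available only when the left factor is homogeneous. Monomials are
    -- therefore built by multiplying with one generator at a time on the left, since generators are
    -- homogeneous while general elements of the algebra are not.
    have hm : ∀ t ∈ Submonoid.closure (superGens (E := E) n m V),
        ∃ t' : SuperFun n m E V, t'.1 = t ∧ X ⟨V, hV⟩ t' = 0 := by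
      intro t ht
      induction ht using Submonoid.closure_induction_left with
      | one => exact ⟨1, rfl, map_one hX hV⟩
      | mul_left x hx y hy ih =>
        obtain ⟨y', rfl, hy'⟩ := ih
        rcases hx with ⟨f, rfl⟩ | ⟨η, hη, rfl⟩
        · refine ⟨ofSmooth f * y', rfl, ?_⟩
          rw [map_even_mul hX hV (hasParity_ofSmooth _), hs, hy', zero_mul, mul_zero, add_zero]
        · refine ⟨ofDual η hη * y', rfl, ?_⟩
          rw [hX.2.2 V hV 1 _ _ (hasParity_ofDual hη), hd, hy', zero_mul, mul_zero, smul_zero,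
            add_zero]
    have hsp : s.1 ∈ Submodule.span ℝ (Submonoid.closure (superGens (E := E) n m V) : Set _) := by
      rw [← Algebra.adjoin_eq_span]
      exact hs'
    have : ∀ t ∈ Submodule.span ℝ (Submonoid.closure (superGens (E := E) n m V) : Set _),
        ∃ t' : SuperFun n m E V, t'.1 = t ∧ X ⟨V, hV⟩ t' = 0 := by
      intro t ht
      induction ht using Submodule.span_induction with
      | mem t ht => exact hm t ht
      | zero => exact ⟨0, rfl, map_zero _⟩
      | add x y _ _ hx hy =>
        obtain ⟨x', rfl, hx'⟩ := hx
        obtain ⟨y', rfl, hy'⟩ := hy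
        exact ⟨x' + y', rfl, by rw [map_add, hx', hy', add_zero]⟩
      | smul r x _ hx =>
        obtain ⟨x', rfl, hx'⟩ := hx
        exact ⟨r • x', rfl, by rw [map_smul, hx', smul_zero]⟩
    obtain ⟨t', ht', h⟩ := this s.1 hsp
    rwa [Subtype.ext ht'] at h
  refine funext fun V => LinearMap.ext fun s => SuperFun.ext fun x => ?_
  obtain ⟨W, hW, hx, hs'⟩ := s.2 x
  have h1 := map_res hX V.2 hW s
  rw [ha W (hW.trans V.2) (s.res hW) hs'] at h1
  exact congrArg (fun k : SuperFun n m E W => k.1 ⟨x, hx⟩) h1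

theorem ext_of_superCoord (c : BundleCoords n m E) (hX : X ∈ SuperDer n m E a U)
    (hY : Y ∈ SuperDer n m E a U) (hU : U ≤ c.U)
    (h : ∀ s, X ⟨U, le_rfl⟩ ((c.superCoord s).res hU) = Y ⟨U, le_rfl⟩ ((c.superCoord s).res hU)) :
    X = Y := by
  have h0 := eq_zero_of_superCoord c (add_mem hX (Submodule.smul_mem _ (-1 : ℝ) hY)) hU fun s => by
    change X ⟨U, le_rfl⟩ _ + (-1 : ℝ) • Y ⟨U, le_rfl⟩ _ = 0
    rw [h s, neg_one_smul, add_neg_cancel]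
  refine funext fun V => LinearMap.ext fun f => ?_
  have h1 : X V f + (-1 : ℝ) • Y V f = 0 := congrArg (fun Z : SuperFam n m E U => Z V f) h0
  rwa [neg_one_smul, ← sub_eq_add_neg, sub_eq_zero] at h1

/-- The product of a homogeneous superfunction and a superderivation. -/
theorem mul_mem {b : ZMod 2} (hX : X ∈ SuperDer n m E a U) {f : SuperFun n m E U}
    (hf : f.HasParity b) :
    (fun V => LinearMap.mulLeft ℝ (f.res V.2) ∘ₗ X V : SuperFam n m E U) ∈
      SuperDer n m E (b + a) U := by
  refine ⟨fun V V' hV h k => ?_, fun V hV d k hk => ?_, fun V hV d k l hk => ?_⟩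
  · change f.res (h.trans hV) * (X ⟨V, hV⟩ k).res h = _
    rw [map_res hX hV h k]
    rfl
  · rw [add_assoc]
    exact (hf.res hV).mul (hX.2.1 V hV d k hk)
  · change f.res hV * X ⟨V, hV⟩ (k * l) = f.res hV * X ⟨V, hV⟩ k * l +
      sgn ((b + a) * d) • (k * (f.res hV * X ⟨V, hV⟩ l))
    rw [hX.2.2 V hV d k l hk, mul_add, ← mul_assoc, mul_smul_comm, add_mul, sgn_add, mul_smul]
    congr 1
    -- Moving `f` past `k` costs `sgn (b * d)`, the additional sign required for the parity `b + a`.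
    rw [← mul_assoc, ← mul_assoc, (hf.res hV).mul_comm hk, smul_mul_assoc,
      smul_comm (sgn (a * d)), smul_smul, mul_comm (sgn _)]

end SuperDer

end SuperDerivationUniqueness

/-! ### Maps with smooth components into a finite-dimensional space, and their partial derivatives.
-/

section VectorValued

variable {B H N : Type*} [NormedAddCommGroup B] [NormedSpace ℝ B] [TopologicalSpace H]
    [TopologicalSpace N] [ChartedSpace H N] {I : ModelWithCorners ℝ B H} {V W : Opens N}
    {A : Type*} [AddCommGroup A] [Module ℝ A]

variable (I V A) in
/-- Maps with values in a vector space all of whose components are smooth. -/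
def SmoothMaps : Submodule ℝ (V → A) where
  carrier := {t | ∀ ℓ : Module.Dual ℝ A, ContMDiff I 𝓘(ℝ, ℝ) ∞ fun x => ℓ (t x)}
  add_mem' {t u} ht hu ℓ := by
    simp only [Pi.add_apply, map_add]
    exact (ht ℓ).add (hu ℓ)
  zero_mem' ℓ := by
    simp only [Pi.zero_apply, map_zero]
    exact contMDiff_const
  smul_mem' r t ht ℓ := by
    simp only [Pi.smul_apply, map_smul]
    exact (contMDiff_const (c := r)).mul (ht ℓ)

namespace SmoothMaps

/-- The components of a map with smooth components. -/
def comp (ℓ : Module.Dual ℝ A) : SmoothMaps I V A →ₗ[ℝ] Smooth I V where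
  toFun t := ⟨fun x => ℓ (t.1 x), t.2 ℓ⟩
  map_add' t u := ContMDiffMap.ext fun x => map_add ℓ (t.1 x) (u.1 x)
  map_smul' r t := ContMDiffMap.ext fun x => map_smul ℓ r (t.1 x)

theorem comp_apply (ℓ : Module.Dual ℝ A) (t : SmoothMaps I V A) (x : V) :
    comp ℓ t x = ℓ (t.1 x) := rfl

variable [FiniteDimensional ℝ A]

theorem comp_eq_sum (ℓ : Module.Dual ℝ A) (t : SmoothMaps I V A) :
    comp ℓ t = ∑ k, ℓ (Module.finBasis ℝ A k) • comp ((Module.finBasis ℝ A).coord k) t := by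
  ext x
  rw [Smooth.sum_apply, comp_apply]
  conv_lhs => rw [← (Module.finBasis ℝ A).sum_repr (t.1 x), map_sum]
  refine Finset.sum_congr rfl fun k _ => ?_
  rw [map_smul, smul_eq_mul, mul_comm]
  rfl

theorem eq_of_comp {a b : A} (h : ∀ ℓ : Module.Dual ℝ A, ℓ a = ℓ b) : a = b :=
  (Module.finBasis ℝ A).ext_elem fun k => h ((Module.finBasis ℝ A).coord k)

variable {κ : Type*} [Fintype κ] [DecidableEq κ] (c : LocalCoords N I κ)

/-- Linear functionals commute with differentiation, so the componentwise derivative does not depend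
on the basis. Identities between derivatives of vector-valued maps are reduced to real functions by
testing against functionals. -/
theorem dual_sum_pd (hV : V ≤ c.U) (i : κ) (ℓ : Module.Dual ℝ A) (t : SmoothMaps I V A) (x : V) :
    ℓ (∑ k, c.pd hV i (comp ((Module.finBasis ℝ A).coord k) t) x • Module.finBasis ℝ A k) =
      c.pd hV i (comp ℓ t) x := by
  rw [comp_eq_sum ℓ t, map_sum, map_sum, Smooth.sum_apply]
  refine Finset.sum_congr rfl fun k _ => ?_
  rw [map_smul, Derivation.map_smul, smul_eq_mul, mul_comm]
  rfl

/-- Componentwise partial derivatives. -/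
def pd (hV : V ≤ c.U) (i : κ) : SmoothMaps I V A →ₗ[ℝ] SmoothMaps I V A where
  toFun t := ⟨fun x => ∑ k, c.pd hV i (comp ((Module.finBasis ℝ A).coord k) t) x •
    Module.finBasis ℝ A k, fun ℓ => by
      simp only [dual_sum_pd]
      exact (c.pd hV i (comp ℓ t)).contMDiff⟩
  map_add' t u := Subtype.ext <| funext fun x => eq_of_comp fun ℓ => by
    refine (dual_sum_pd c hV i ℓ _ x).trans ?_
    rw [map_add, map_add]
    refine Eq.trans ?_ (map_add ℓ _ _).symm
    exact congrArg₂ (· + ·) (dual_sum_pd c hV i ℓ t x).symm (dual_sum_pd c hV i ℓ u x).symm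
  map_smul' r t := Subtype.ext <| funext fun x => eq_of_comp fun ℓ => by
    refine (dual_sum_pd c hV i ℓ _ x).trans ?_
    rw [map_smul, Derivation.map_smul]
    refine Eq.trans ?_ (map_smul ℓ r _).symm
    exact congrArg (r * ·) (dual_sum_pd c hV i ℓ t x).symm

theorem dual_pd (hV : V ≤ c.U) (i : κ) (ℓ : Module.Dual ℝ A) (t : SmoothMaps I V A) (x : V) :
    ℓ ((pd c hV i t).1 x) = c.pd hV i (comp ℓ t) x := dual_sum_pd c hV i ℓ t x

/-- A constant linear map commutes with differentiation. Taking the grade involution for `L` shows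
that differentiation preserves parity. -/
theorem pd_eq_of_comp (hV : V ≤ c.U) (i : κ) {A' : Type*} [AddCommGroup A'] [Module ℝ A']
    [FiniteDimensional ℝ A'] (L : A →ₗ[ℝ] A') (t : SmoothMaps I V A) (u : SmoothMaps I V A')
    (h : ∀ x, L (t.1 x) = u.1 x) (x : V) : L ((pd c hV i t).1 x) = (pd c hV i u).1 x := by
  refine eq_of_comp fun ℓ => ?_
  rw [dual_pd]
  have h1 : comp ℓ u = comp (ℓ ∘ₗ L) t := by
    ext y
    exact congrArg ℓ (h y).symm
  rw [h1, ← dual_pd]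
  rfl

theorem pd_res (hV : V ≤ c.U) (hW : W ≤ V) (i : κ) (t : SmoothMaps I V A) (u : SmoothMaps I W A)
    (h : ∀ x : W, u.1 x = t.1 ⟨x, hW x.2⟩) (x : W) :
    (pd c (hW.trans hV) i u).1 x = (pd c hV i t).1 ⟨x, hW x.2⟩ := by
  refine eq_of_comp fun ℓ => ?_
  rw [dual_pd, dual_pd]
  have h1 : comp ℓ u = (comp ℓ t).res hW := by
    ext y
    exact congrArg ℓ (h y)
  rw [h1, ← c.pd_res hV]
  rfl

/-- Expanding the first factor in a basis turns a functional of the product into a finite sum of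
products of real smooth functions. The same expansion reduces the product rule `pd_mul` to the
scalar one. -/
theorem mul_mem {A : Type*} [Ring A] [Algebra ℝ A] [FiniteDimensional ℝ A]
    (t u : SmoothMaps I V A) : t.1 * u.1 ∈ SmoothMaps I V A := by
  intro ℓ
  have h : (fun x => ℓ ((t.1 * u.1) x)) =
      ⇑(∑ k, comp ((Module.finBasis ℝ A).coord k) t *
        comp (ℓ ∘ₗ LinearMap.mulLeft ℝ (Module.finBasis ℝ A k)) u) := by
    ext x
    rw [Smooth.sum_apply, Pi.mul_apply]
    conv_lhs => rw [← (Module.finBasis ℝ A).sum_repr (t.1 x), Finset.sum_mul, map_sum]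
    refine Finset.sum_congr rfl fun k _ => ?_
    rw [smul_mul_assoc, map_smul]
    rfl
  rw [h]
  exact ContMDiffMap.contMDiff _

theorem pd_mul {A : Type*} [Ring A] [Algebra ℝ A] [FiniteDimensional ℝ A] (hV : V ≤ c.U) (i : κ)
    (t u : SmoothMaps I V A) (x : V) : (pd c hV i ⟨_, mul_mem t u⟩).1 x =
      (pd c hV i t).1 x * u.1 x + t.1 x * (pd c hV i u).1 x := by
  refine eq_of_comp fun ℓ => ?_
  rw [dual_pd]
  have h1 : comp ℓ ⟨_, mul_mem t u⟩ = ∑ k, comp ((Module.finBasis ℝ A).coord k) t *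
      comp (ℓ ∘ₗ LinearMap.mulLeft ℝ (Module.finBasis ℝ A k)) u := by
    ext x
    rw [Smooth.sum_apply, comp_apply]
    change ℓ (t.1 x * u.1 x) = _
    conv_lhs => rw [← (Module.finBasis ℝ A).sum_repr (t.1 x), Finset.sum_mul, map_sum]
    refine Finset.sum_congr rfl fun k _ => ?_
    rw [smul_mul_assoc, map_smul]
    rfl
  rw [h1, map_sum, Smooth.sum_apply, map_add]
  conv_rhs => rw [← (Module.finBasis ℝ A).sum_repr (t.1 x),
    ← (Module.finBasis ℝ A).sum_repr ((pd c hV i t).1 x), Finset.sum_mul, Finset.sum_mul, map_sum,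
    map_sum, ← Finset.sum_add_distrib]
  refine Finset.sum_congr rfl fun k _ => ?_
  rw [Derivation.leibniz, smul_mul_assoc, smul_mul_assoc, map_smul, map_smul]
  have h2 := dual_pd c hV i ((Module.finBasis ℝ A).coord k) t x
  have h3 := dual_pd c hV i (ℓ ∘ₗ LinearMap.mulLeft ℝ (Module.finBasis ℝ A k)) u x
  rw [Module.Basis.coord_apply] at h2
  rw [h2, smul_eq_mul, smul_eq_mul]
  change comp ((Module.finBasis ℝ A).coord k) t x * c.pd hV i _ x +
    comp (ℓ ∘ₗ LinearMap.mulLeft ℝ (Module.finBasis ℝ A k)) u x * c.pd hV i _ x = _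
  rw [← h3, add_comm, mul_comm]
  rfl

end SmoothMaps

end VectorValued

/-! ### Construction of the coordinate superderivations and derivations. -/

section SuperDerivationExistence

variable {n m : ℕ} {M : Type*} [TopologicalSpace M] [ChartedSpace (EuclideanSpace ℝ (Fin n)) M]
  [IsManifold (𝓡 n) ∞ M]
  {E : M → Type*} [∀ x, AddCommGroup (E x)] [∀ x, Module ℝ (E x)] [∀ x, TopologicalSpace (E x)]
  [TopologicalSpace (TotalSpace (EuclideanSpace ℝ (Fin m)) E)]
  [FiberBundle (EuclideanSpace ℝ (Fin m)) E] [VectorBundle ℝ (EuclideanSpace ℝ (Fin m)) E]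
  [ContMDiffVectorBundle ∞ (EuclideanSpace ℝ (Fin m)) E (𝓡 n)]

open CliffordAlgebra (involute contractLeft)
open SuperFun

/-- The Leibniz rule of contraction involves the grade involution, so this closure property is
needed for contraction to preserve the algebra generated by functions and sections of E^*. -/
theorem involute_mem_adjoin {V : Opens M} {s : ∀ x : V, Lam E x}
    (hs : s ∈ Algebra.adjoin ℝ (superGens n m V)) :
    (fun x => involute (s x) : ∀ x : V, Lam E x) ∈ Algebra.adjoin ℝ (superGens n m V) := by
  induction hs using Algebra.adjoin_induction with
  | mem s hs =>
    rcases hs with ⟨f, rfl⟩ | ⟨η, hη, rfl⟩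
    · simp only [AlgHom.commutes]
      exact Algebra.subset_adjoin (Or.inl ⟨f, rfl⟩)
    · simp only [CliffordAlgebra.involute_ι]
      have h : (fun x : V => ExteriorAlgebra.ι ℝ (η x)) ∈
          Algebra.adjoin ℝ (superGens (E := E) n m V) :=
        Algebra.subset_adjoin (Or.inr ⟨η, hη, rfl⟩)
      exact Subalgebra.neg_mem _ h
  | algebraMap r =>
    simp only [Pi.algebraMap_apply, AlgHom.commutes]
    exact Subalgebra.algebraMap_mem _ r
  | add s t _ _ hs ht =>
    simp only [Pi.add_apply, map_add]
    exact add_mem hs ht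
  | mul s t _ _ hs ht =>
    simp only [Pi.mul_apply, map_mul]
    exact mul_mem hs ht

namespace BundleCoords

variable (c : BundleCoords n m E) {U V W : Opens M}

/-- Fibrewise contraction with a vector of the local frame of `E`. -/
def contract (α : Fin m) (x : c.U) : Lam E x →ₗ[ℝ] Lam E x :=
  contractLeft (Module.Dual.eval ℝ (E x) (c.dualFrame α x))

/-- Contraction kills functions and sends a section of E^* to its smooth coefficient in the coframe;
products follow from the graded Leibniz rule. -/
theorem contract_mem_adjoin (hV : V ≤ c.U) (α : Fin m) {s : ∀ x : V, Lam E x}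
    (hs : s ∈ Algebra.adjoin ℝ (superGens n m V)) :
    (fun x => c.contract α ⟨x, hV x.2⟩ (s x) : ∀ x : V, Lam E x) ∈
      Algebra.adjoin ℝ (superGens n m V) := by
  induction hs using Algebra.adjoin_induction with
  | mem s hs =>
    rcases hs with ⟨f, rfl⟩ | ⟨η, hη, rfl⟩
    · simp only [contract, CliffordAlgebra.contractLeft_algebraMap]
      exact zero_mem _
    · simp only [contract, CliffordAlgebra.contractLeft_ι]
      exact Algebra.subset_adjoin (Or.inl ⟨c.dualCoeff hV η hη α, rfl⟩)
  | algebraMap r =>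
    simp only [contract, Pi.algebraMap_apply, CliffordAlgebra.contractLeft_algebraMap]
    exact zero_mem _
  | add s t _ _ hs ht =>
    simp only [Pi.add_apply, map_add]
    exact add_mem hs ht
  | mul s t hs' _ hs ht =>
    simp only [contract, Pi.mul_apply, contractLeft_mul]
    exact add_mem (mul_mem hs ‹_›) (mul_mem (involute_mem_adjoin hs') ht)

/-- The odd coordinate superderivations, as families of linear maps. -/
def oddFam (α : Fin m) : SuperFam n m E c.U := fun V =>
  { toFun s := ⟨fun x => c.contract α ⟨x, V.2 x.2⟩ (s.1 x), fun x => by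
      obtain ⟨W, hW, hx, hs⟩ := s.2 x
      exact ⟨W, hW, hx, c.contract_mem_adjoin (hW.trans V.2) α hs⟩⟩
    map_add' s t := SuperFun.ext fun x => map_add (c.contract α ⟨x, V.2 x.2⟩) (s.1 x) (t.1 x)
    map_smul' r s := SuperFun.ext fun x => map_smul (c.contract α ⟨x, V.2 x.2⟩) r (s.1 x) }

theorem oddFam_mem (α : Fin m) : c.oddFam α ∈ SuperDer n m E 1 c.U := by
  refine ⟨fun V V' hV h s => rfl, fun V hV b s hs x => contractLeft_mem_evenOdd _ (hs x),
    fun V hV b s t hs => SuperFun.ext fun x => ?_⟩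
  refine (contractLeft_mul _ (s.1 x) (t.1 x)).trans ?_
  rw [mem_evenOdd_iff.1 (hs x), one_mul, smul_mul_assoc]
  rfl

theorem oddFam_superCoord (α : Fin m) (s : Fin n ⊕ Fin m) :
    c.oddFam α ⟨c.U, le_rfl⟩ (c.superCoord s) = if Sum.inr α = s then 1 else 0 := by
  refine SuperFun.ext fun x => ?_
  rcases s with i | β
  · refine (CliffordAlgebra.contractLeft_algebraMap _ _ _).trans ?_
    rfl
  · refine (CliffordAlgebra.contractLeft_ι _ _ _).trans ?_
    rw [Module.Dual.eval_apply, c.coframe_dualFrame]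
    by_cases h : α = β
    · subst h
      simp
    · simp [h, Ne.symm h]

/-- The identification of the fibres of the dual bundle given by the local frame. -/
def coeffMap (x : c.U) : Module.Dual ℝ (E x) →ₗ[ℝ] (Fin m → ℝ) :=
  LinearMap.pi fun α => Module.Dual.eval ℝ (E x) (c.dualFrame α x)

/-- The inverse of `coeffMap`. -/
def coeffInv (x : c.U) : (Fin m → ℝ) →ₗ[ℝ] Module.Dual ℝ (E x) :=
  ∑ α, (LinearMap.proj α : (Fin m → ℝ) →ₗ[ℝ] ℝ).smulRight (c.coframe α x)

theorem coeffInv_comp_coeffMap (x : c.U) : c.coeffInv x ∘ₗ c.coeffMap x = LinearMap.id := by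
  refine LinearMap.ext fun η => ?_
  refine Eq.trans ?_ (c.dual_eq_sum x η).symm
  rw [LinearMap.comp_apply, coeffInv, LinearMap.sum_apply]
  rfl

variable (m) in
/-- The typical fibre of the bundle of exterior algebras. -/
abbrev Fib : Type := ExteriorAlgebra ℝ (Fin m → ℝ)

/-- The trivialization of the bundle of exterior algebras. -/
def toFib (x : c.U) : Lam E x →ₐ[ℝ] Fib m := ExteriorAlgebra.map (c.coeffMap x)

/-- The inverse of `toFib`. -/
def ofFib (x : c.U) : Fib m →ₐ[ℝ] Lam E x := ExteriorAlgebra.map (c.coeffInv x)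

theorem ofFib_toFib (x : c.U) (s : Lam E x) : c.ofFib x (c.toFib x s) = s := by
  have h : (c.ofFib x).comp (c.toFib x) = AlgHom.id ℝ _ := by
    rw [ofFib, toFib, ExteriorAlgebra.map_comp_map, coeffInv_comp_coeffMap, ExteriorAlgebra.map_id]
  exact DFunLike.congr_fun h s

theorem involute_map {V V' : Type*} [AddCommGroup V] [Module ℝ V] [AddCommGroup V'] [Module ℝ V']
    (f : V →ₗ[ℝ] V') (x : ExteriorAlgebra ℝ V) :
    involute (ExteriorAlgebra.map f x) = ExteriorAlgebra.map f (involute x) := by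
  have h : involute.comp (ExteriorAlgebra.map f) = (ExteriorAlgebra.map f).comp involute := by
    ext v
    simp
  exact DFunLike.congr_fun h x

/-- The trivialization is an algebra homomorphism on each fibre, so only generators matter. A
section of E^* becomes a combination of fixed vectors with its smooth coframe coefficients. -/
theorem toFib_adjoin_mem (hV : V ≤ c.U) {s : ∀ x : V, Lam E x}
    (hs : s ∈ Algebra.adjoin ℝ (superGens n m V)) :
    (fun x : V => c.toFib ⟨x, hV x.2⟩ (s x)) ∈ SmoothMaps (𝓡 n) V (Fib m) := by
  have hmap : ∀ f : Smooth (𝓡 n) V, (fun x : V => algebraMap ℝ (Fib m) (f x)) ∈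
      SmoothMaps (𝓡 n) V (Fib m) := fun f ℓ => by
    simp only [Algebra.algebraMap_eq_smul_one, map_smul, smul_eq_mul]
    exact f.contMDiff.mul contMDiff_const
  induction hs using Algebra.adjoin_induction with
  | mem s hs =>
    rcases hs with ⟨f, rfl⟩ | ⟨η, hη, rfl⟩
    · simp only [AlgHom.commutes]
      exact hmap f
    · have h : ∀ x : V, c.toFib ⟨x, hV x.2⟩ (ExteriorAlgebra.ι ℝ (η x)) =
          ∑ α, c.dualCoeff hV η hη α x • ExteriorAlgebra.ι ℝ (Pi.single α 1) := fun x => by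
        rw [toFib, ExteriorAlgebra.map_apply_ι]
        have h2 : c.coeffMap ⟨x, hV x.2⟩ (η x) =
            ∑ α, c.dualCoeff hV η hη α x • (Pi.single α 1 : Fin m → ℝ) := by
          ext β
          simp only [Finset.sum_apply, Pi.smul_apply, Pi.single_apply, smul_eq_mul, mul_ite,
            mul_one, mul_zero, Finset.sum_ite_eq, Finset.mem_univ, if_true]
          rfl
        rw [h2, map_sum]
        simp only [map_smul]
      simp only [h]
      intro ℓ
      simp only [map_sum, map_smul, smul_eq_mul]
      refine contMDiff_finsetSum fun α _ => ?_
      exact (c.dualCoeff hV η hη α).contMDiff.mul contMDiff_const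
  | algebraMap r =>
    simp only [Pi.algebraMap_apply, AlgHom.commutes]
    exact hmap (algebraMap ℝ _ r)
  | add s t _ _ hs ht =>
    simp only [Pi.add_apply, map_add]
    exact add_mem hs ht
  | mul s t _ _ hs ht =>
    simp only [Pi.mul_apply, map_mul]
    exact SmoothMaps.mul_mem ⟨_, hs⟩ ⟨_, ht⟩

/-- Superfunctions as functions with values in a fixed exterior algebra. -/
def toMaps (hV : V ≤ c.U) : SuperFun n m E V →ₗ[ℝ] SmoothMaps (𝓡 n) V (Fib m) where
  toFun s := ⟨fun x => c.toFib ⟨x, hV x.2⟩ (s.1 x), fun ℓ x => by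
    obtain ⟨W, hW, hx, hs⟩ := s.2 x
    exact contMDiffAt_of_restrict hW hx (c.toFib_adjoin_mem (hW.trans hV) hs ℓ _)⟩
  map_add' s t := Subtype.ext <| funext fun x => map_add (c.toFib ⟨x, hV x.2⟩) (s.1 x) (t.1 x)
  map_smul' r s := Subtype.ext <| funext fun x => map_smul (c.toFib ⟨x, hV x.2⟩) r (s.1 x)

theorem ofFib_const_mem (hV : V ≤ c.U) (w : Fib m) :
    (fun x => c.ofFib ⟨x, hV x.2⟩ w : ∀ x : V, Lam E x) ∈ superFunSubalgebra n m E V := by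
  induction w using ExteriorAlgebra.induction with
  | algebraMap r =>
    simp only [AlgHom.commutes]
    exact Subalgebra.algebraMap_mem _ r
  | ι v =>
    have h : ∀ x : V, c.ofFib ⟨x, hV x.2⟩ (ExteriorAlgebra.ι ℝ v) =
        ∑ α, v α • ExteriorAlgebra.ι ℝ (c.coframe α ⟨x, hV x.2⟩) := fun x => by
      rw [ofFib, ExteriorAlgebra.map_apply_ι, coeffInv, LinearMap.sum_apply, map_sum]
      exact Finset.sum_congr rfl fun α _ => map_smul (ExteriorAlgebra.ι ℝ) (v α) _
    have h2 : (fun x => c.ofFib ⟨x, hV x.2⟩ (ExteriorAlgebra.ι ℝ v) : ∀ x : V, Lam E x) =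
        ∑ α, v α • ((c.superCoord (.inr α)).res hV).1 := by
      ext x
      rw [h, Finset.sum_apply]
      rfl
    rw [h2]
    exact sum_mem fun α _ => Subalgebra.smul_mem _ (Subtype.property _) _
  | mul a b ha hb =>
    simp only [map_mul]
    exact mul_mem ha hb
  | add a b ha hb =>
    simp only [map_add]
    exact add_mem ha hb

/-- In a basis of the typical fibre, `t` has smooth coefficients, and each constant basis element
corresponds to a superfunction that is a polynomial in the coframe. -/
theorem ofFib_mem (hV : V ≤ c.U) (t : SmoothMaps (𝓡 n) V (Fib m)) :
    (fun x => c.ofFib ⟨x, hV x.2⟩ (t.1 x) : ∀ x : V, Lam E x) ∈ superFunSubalgebra n m E V := by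
  let b := Module.finBasis ℝ (Fib m)
  have h : (fun x => c.ofFib ⟨x, hV x.2⟩ (t.1 x) : ∀ x : V, Lam E x) =
      ∑ k, (ofSmooth (E := E) (m := m) (SmoothMaps.comp (b.coord k) t)).1 *
        fun x : V => c.ofFib ⟨x, hV x.2⟩ (b k) := by
    ext x
    conv_lhs => rw [← b.sum_repr (t.1 x), map_sum]
    rw [Finset.sum_apply]
    refine Finset.sum_congr rfl fun k _ => ?_
    rw [map_smul, Algebra.smul_def]
    rfl
  rw [h]
  exact sum_mem fun k _ => mul_mem (Subtype.property _) (c.ofFib_const_mem hV _)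

/-- The inverse of `toMaps`. -/
def ofMaps (hV : V ≤ c.U) : SmoothMaps (𝓡 n) V (Fib m) →ₗ[ℝ] SuperFun n m E V where
  toFun t := ⟨fun x => c.ofFib ⟨x, hV x.2⟩ (t.1 x), c.ofFib_mem hV t⟩
  map_add' s t := SuperFun.ext fun x => map_add (c.ofFib ⟨x, hV x.2⟩) (s.1 x) (t.1 x)
  map_smul' r s := SuperFun.ext fun x => map_smul (c.ofFib ⟨x, hV x.2⟩) r (s.1 x)

/-- The even coordinate superderivations, as families of linear maps. -/
def evenFam (i : Fin n) : SuperFam n m E c.U := fun V =>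
  c.ofMaps V.2 ∘ₗ SmoothMaps.pd c.baseCoords V.2 i ∘ₗ c.toMaps V.2

theorem evenFam_apply (i : Fin n) (hV : V ≤ c.U) (s : SuperFun n m E V) (x : V) :
    (c.evenFam i ⟨V, hV⟩ s).1 x =
      c.ofFib ⟨x, hV x.2⟩ ((SmoothMaps.pd c.baseCoords hV i (c.toMaps hV s)).1 x) := rfl

/-- Differentiation in a fixed algebra is local, commutes with the constant grade involution and
satisfies the product rule. The fibrewise algebra homomorphisms commute with the involution and
transfer these three facts to superfunctions; for the product rule only `ofFib_toFib` is needed to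
recover the undifferentiated factors. -/
theorem evenFam_mem (i : Fin n) : c.evenFam i ∈ SuperDer n m E 0 c.U := by
  refine ⟨fun V V' hV h s => SuperFun.ext fun x => ?_, fun V hV b s hs x => ?_,
    fun V hV b s t hs => SuperFun.ext fun x => ?_⟩
  · refine congrArg (c.ofFib ⟨x, hV (h x.2)⟩) ?_
    exact (SmoothMaps.pd_res c.baseCoords hV h i (c.toMaps hV s) (c.toMaps (h.trans hV) (s.res h))
      (fun _ => rfl) x).symm
  · rw [zero_add, mem_evenOdd_iff, evenFam_apply, ofFib, involute_map, ← map_smul]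
    congr 1
    have h1 := SmoothMaps.pd_eq_of_comp c.baseCoords hV i involute.toLinearMap (c.toMaps hV s)
      (sgn b • c.toMaps hV s) (fun y => by
        change involute (c.toFib ⟨y, hV y.2⟩ (s.1 y)) = sgn b • c.toFib ⟨y, hV y.2⟩ (s.1 y)
        rw [toFib, involute_map, mem_evenOdd_iff.1 (hs y), map_smul]) x
    rw [map_smul] at h1
    exact h1
  · rw [zero_mul, sgn_zero, one_smul]
    change c.ofFib ⟨x, hV x.2⟩ _ = c.ofFib ⟨x, hV x.2⟩ _ * t.1 x + s.1 x * c.ofFib ⟨x, hV x.2⟩ _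
    have h1 : c.toMaps hV (s * t) = ⟨_, SmoothMaps.mul_mem (c.toMaps hV s) (c.toMaps hV t)⟩ :=
      Subtype.ext <| funext fun y => map_mul (c.toFib ⟨y, hV y.2⟩) (s.1 y) (t.1 y)
    have h2 := SmoothMaps.pd_mul c.baseCoords hV i (c.toMaps hV s) (c.toMaps hV t) x
    rw [← h1] at h2
    have hs : c.ofFib ⟨x, hV x.2⟩ ((c.toMaps hV s).1 x) = s.1 x := c.ofFib_toFib _ _
    have ht : c.ofFib ⟨x, hV x.2⟩ ((c.toMaps hV t).1 x) = t.1 x := c.ofFib_toFib _ _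
    refine (congrArg (c.ofFib ⟨x, hV x.2⟩) h2).trans ?_
    rw [map_add, map_mul, map_mul, hs, ht]
    rfl

theorem evenFam_superCoord (i : Fin n) (s : Fin n ⊕ Fin m) :
    c.evenFam i ⟨c.U, le_rfl⟩ (c.superCoord s) = if Sum.inl i = s then 1 else 0 := by
  refine SuperFun.ext fun x => ?_
  rw [evenFam_apply]
  -- In the trivialization the base coordinates become scalar multiples of 1 and the coframe
  -- elements become constants, whose derivatives vanish.
  have hpd : (SmoothMaps.pd c.baseCoords (le_refl c.U) i (c.toMaps le_rfl (c.superCoord s))).1 x =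
      if Sum.inl i = s then 1 else 0 := by
    refine SmoothMaps.eq_of_comp fun ℓ => ?_
    refine (SmoothMaps.dual_pd c.baseCoords (le_refl c.U) i ℓ _ x).trans ?_
    rcases s with j | β
    · have h1 : SmoothMaps.comp ℓ (c.toMaps le_rfl (c.superCoord (.inl j))) =
          ℓ 1 • c.x j := by
        ext y
        change ℓ (c.toFib y (algebraMap ℝ _ (c.x j y))) = ℓ 1 * c.x j y
        rw [AlgHom.commutes, Algebra.algebraMap_eq_smul_one, map_smul, smul_eq_mul, mul_comm]
      have h2 : c.baseCoords.pd (le_refl c.U) i (c.x j) = if i = j then 1 else 0 :=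
        c.baseCoords.pd_x (le_refl c.U) i j
      rw [h1, Derivation.map_smul, h2]
      by_cases h : i = j
      · subst h
        simp
      · simp [h]
    · have h1 : SmoothMaps.comp ℓ (c.toMaps le_rfl (c.superCoord (.inr β))) =
          algebraMap ℝ _ (ℓ (ExteriorAlgebra.ι ℝ (Pi.single β 1))) := by
        ext y
        change ℓ (c.toFib y (ExteriorAlgebra.ι ℝ (c.coframe β y))) = _
        rw [toFib, ExteriorAlgebra.map_apply_ι]
        have h2 : c.coeffMap y (c.coframe β y) = Pi.single β 1 := by
          ext α
          change c.coframe β y (c.dualFrame α y) = _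
          rw [c.coframe_dualFrame, Pi.single_apply]
          simp only [eq_comm]
        rw [h2]
        rfl
      rw [h1, Derivation.map_algebraMap]
      simp
  rw [hpd]
  by_cases h : Sum.inl i = s
  · rw [if_pos h, if_pos h, map_one]; rfl
  · rw [if_neg h, if_neg h, map_zero]; rfl

/-- The coordinate superderivations. -/
def superFrame : Fin n ⊕ Fin m → SuperVect n m E c.U
  | .inl i => ⟨c.evenFam i, Submodule.mem_sup_left (c.evenFam_mem i)⟩
  | .inr α => ⟨c.oddFam α, Submodule.mem_sup_right (c.oddFam_mem α)⟩

theorem isSuperFrame_superFrame : c.IsSuperFrame c.superFrame := by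
  refine ⟨c.evenFam_mem, c.oddFam_mem, fun r s => ?_⟩
  rcases r with i | α
  · exact c.evenFam_superCoord i s
  · exact c.oddFam_superCoord α s

theorem IsSuperFrame.eq {c : BundleCoords n m E} {D : Fin n ⊕ Fin m → SuperVect n m E c.U}
    (hD : c.IsSuperFrame D) : D = c.superFrame := by
  have h := c.isSuperFrame_superFrame
  funext r
  refine Subtype.ext ?_
  rcases r with i | α
  · exact SuperDer.ext_of_superCoord c (hD.1 i) (h.1 i) le_rfl fun s =>
      (hD.2.2 _ s).trans (h.2.2 _ s).symm
  · exact SuperDer.ext_of_superCoord c (hD.2.1 α) (h.2.1 α) le_rfl fun s =>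
      (hD.2.2 _ s).trans (h.2.2 _ s).symm

/-- The coordinate vector fields on the total space. -/
theorem isFrame_frame : c.IsFrame c.totCoords.frame := by
  intro r s
  rw [← totCoords_x]
  exact c.totCoords.pd_x (le_refl _) r s

theorem IsFrame.eq {c : BundleCoords n m E}
    {d : Fin n ⊕ Fin m → Vect (totModel n m) (preim m E c.U)} (hd : c.IsFrame d) :
    d = c.totCoords.frame := by
  funext r
  refine c.totCoords.vect_ext le_rfl fun s => ?_
  rw [totCoords_x]
  exact (hd r s).trans (c.isFrame_frame r s).symm

end BundleCoords

end SuperDerivationExistence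

/-! ### Sections of ℒ₀ in coordinates and the relation Ψ. -/

section LinearVectorFields

variable {n m : ℕ} {M : Type*} [TopologicalSpace M] [ChartedSpace (EuclideanSpace ℝ (Fin n)) M]
  [IsManifold (𝓡 n) ∞ M]
  {E : M → Type*} [∀ x, AddCommGroup (E x)] [∀ x, Module ℝ (E x)] [∀ x, TopologicalSpace (E x)]
  [TopologicalSpace (TotalSpace (EuclideanSpace ℝ (Fin m)) E)]
  [FiberBundle (EuclideanSpace ℝ (Fin m)) E] [VectorBundle ℝ (EuclideanSpace ℝ (Fin m)) E]
  [ContMDiffVectorBundle ∞ (EuclideanSpace ℝ (Fin m)) E (𝓡 n)]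

variable {U V W : Opens M}

open SuperFun

namespace SuperFun

theorem IsAffine.add {f g : SuperFun n m E U} (hf : f.IsAffine) (hg : g.IsAffine) :
    (f + g).IsAffine := fun x => by
  obtain ⟨r, η, h⟩ := hf x
  obtain ⟨r', η', h'⟩ := hg x
  refine ⟨r + r', η + η', ?_⟩
  change f.1 x + g.1 x = _
  rw [h, h', map_add, map_add, add_add_add_comm]

theorem isAffine_sum {κ : Type*} (s : Finset κ) {f : κ → SuperFun n m E U}
    (hf : ∀ i, (f i).IsAffine) : (∑ i ∈ s, f i).IsAffine := by
  induction s using Finset.cons_induction with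
  | empty => exact fun x => ⟨0, 0, by rw [map_zero, map_zero, add_zero]; rfl⟩
  | cons a s ha ih =>
    rw [Finset.sum_cons]
    exact (hf a).add ih

theorem IsAffine.ofSmooth_mul {f : SuperFun n m E U} (hf : f.IsAffine) (k : Smooth (𝓡 n) U) :
    (ofSmooth k * f).IsAffine := fun x => by
  obtain ⟨r, η, h⟩ := hf x
  refine ⟨k x * r, k x • η, ?_⟩
  change algebraMap ℝ (Lam E x) (k x) * f.1 x = _
  rw [h, mul_add, map_mul, map_smul, Algebra.smul_def]

theorem IsAffine.res {f : SuperFun n m E U} (hf : f.IsAffine) (h : V ≤ U) : (f.res h).IsAffine :=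
  fun x => hf ⟨x, h x.2⟩

theorem psi_of_even {f : SuperFun n m E U} (hf : f.HasParity 0) (e : preim m E U) :
    f.psi e = f.red (proj e) := by
  rw [psi_eq, show f.lin = fun _ => 0 from funext (lin_of_even hf), evalDual_zero, add_zero]

theorem psi_of_odd {f : SuperFun n m E U} (hf : f.HasParity 1) (e : preim m E U) :
    f.psi e = evalDual f.lin e := by
  rw [psi_eq, red_of_odd hf, zero_add]

end SuperFun

namespace SuperVect

/-- A homogeneous superderivation as a vector field. -/
def ofDer {a : ZMod 2} {X : SuperFam n m E U} (hX : X ∈ SuperDer n m E a U) : SuperVect n m E U :=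
  ⟨X, by
    rcases zmod_two_cases a with rfl | rfl
    · exact Submodule.mem_sup_left hX
    · exact Submodule.mem_sup_right hX⟩

/-- The product of a homogeneous superfunction and a homogeneous vector field. -/
def mulOf {a b : ZMod 2} {f : SuperFun n m E U} (hf : f.HasParity b) {X : SuperVect n m E U}
    (hX : X.HasParity a) : SuperVect n m E U := ofDer (SuperDer.mul_mem hX hf)

theorem isMul_mulOf {a b : ZMod 2} {f : SuperFun n m E U} (hf : f.HasParity b)
    {X : SuperVect n m E U} (hX : X.HasParity a) : IsMul f X (mulOf hf hX) := fun _ _ _ => rfl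

theorem hasParity_mulOf {a b : ZMod 2} {f : SuperFun n m E U} (hf : f.HasParity b)
    {X : SuperVect n m E U} (hX : X.HasParity a) : (mulOf hf hX).HasParity (b + a) :=
  SuperDer.mul_mem hX hf

theorem sum_val_apply {κ : Type*} (s : Finset κ) (X : κ → SuperVect n m E U)
    (V : {V : Opens M // V ≤ U}) (f : SuperFun n m E V.1) :
    (∑ i ∈ s, X i).1 V f = ∑ i ∈ s, (X i).1 V f := by
  induction s using Finset.cons_induction with
  | empty => rfl
  | cons a s ha ih =>
    rw [Finset.sum_cons, Finset.sum_cons, ← ih]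
    rfl

theorem hasParity_sum {κ : Type*} (s : Finset κ) {X : κ → SuperVect n m E U} {a : ZMod 2}
    (hX : ∀ i, (X i).HasParity a) : (∑ i ∈ s, X i).HasParity a := by
  induction s using Finset.cons_induction with
  | empty => exact zero_mem _
  | cons i s hi ih =>
    rw [Finset.sum_cons]
    exact add_mem (hX i) ih

/-- The action of a vector field on the superfunctions on its domain. -/
def app (X : SuperVect n m E U) : SuperFun n m E U →ₗ[ℝ] SuperFun n m E U := X.1 ⟨U, le_rfl⟩

theorem app_add (X Y : SuperVect n m E U) (f : SuperFun n m E U) :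
    (X + Y).app f = X.app f + Y.app f := rfl

theorem app_sum {κ : Type*} (s : Finset κ) (X : κ → SuperVect n m E U) (f : SuperFun n m E U) :
    (∑ i ∈ s, X i).app f = ∑ i ∈ s, (X i).app f := sum_val_apply s X ⟨U, le_rfl⟩ f

theorem app_mulOf {a b : ZMod 2} {f : SuperFun n m E U} (hf : f.HasParity b)
    {X : SuperVect n m E U} (hX : X.HasParity a) (k : SuperFun n m E U) :
    (mulOf hf hX).app k = f * X.app k := rfl

theorem HasParity.res {X : SuperVect n m E U} {a : ZMod 2} (hX : X.HasParity a) (h : V ≤ U) :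
    (X.res h).HasParity a := SuperDer.res_mem h hX

theorem IsL0.res {X : SuperVect n m E U} (hX : X.IsL0) (h : V ≤ U) : (X.res h).IsL0 :=
  ⟨hX.1.res h, fun W hW => hX.2 W (hW.trans h)⟩

theorem app_res {a : ZMod 2} {X : SuperVect n m E U} (hX : X.HasParity a) (h : V ≤ U)
    (f : SuperFun n m E U) : (X.res h).app (f.res h) = (X.app f).res h :=
  (SuperDer.map_res hX le_rfl h f).symm

theorem ext_of_superCoord (c : BundleCoords n m E) {X Y : SuperVect n m E U} {a : ZMod 2}
    (hX : X.HasParity a) (hY : Y.HasParity a) (hU : U ≤ c.U)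
    (h : ∀ s, X.app ((c.superCoord s).res hU) = Y.app ((c.superCoord s).res hU)) : X = Y :=
  Subtype.ext (SuperDer.ext_of_superCoord c hX hY hU h)

end SuperVect

theorem IsPsi.res {X : SuperVect n m E U} {X' : Vect (totModel n m) (preim m E U)}
    (hX : IsPsi X X') (h : V ≤ U) : IsPsi (X.res h) (X'.res (preim_mono h)) :=
  fun W hW h' f k hf hk e => hX W (hW.trans h) (h'.trans (preim_mono h)) f k hf hk e

namespace BundleCoords

variable (c : BundleCoords n m E)

theorem isAffine_superCoord (s : Fin n ⊕ Fin m) : (c.superCoord s).IsAffine := by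
  rcases s with i | α
  · exact isAffine_ofSmooth _
  · exact isAffine_ofDual (c.coframe_smooth α)

theorem psi_superCoord (s : Fin n ⊕ Fin m) (e : preim m E c.U) :
    (c.superCoord s).psi e = c.coord s e := by
  rcases s with i | α
  · exact psi_ofSmooth _ e
  · exact psi_ofDual (c.coframe_smooth α) e

theorem superFrame_app (hV : V ≤ c.U) (r s : Fin n ⊕ Fin m) :
    ((c.superFrame r).res hV).app ((c.superCoord s).res hV) = if r = s then 1 else 0 := by
  have h : ∃ a, (c.superFrame r).HasParity a := by
    rcases r with i | α
    · exact ⟨0, c.evenFam_mem i⟩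
    · exact ⟨1, c.oddFam_mem α⟩
  obtain ⟨a, ha⟩ := h
  rw [SuperVect.app_res ha hV]
  have h2 : (c.superFrame r).app (c.superCoord s) = if r = s then 1 else 0 :=
    c.isSuperFrame_superFrame.2.2 r s
  rw [h2]
  by_cases hrs : r = s
  · rw [if_pos hrs, if_pos hrs]; rfl
  · rw [if_neg hrs, if_neg hrs]; rfl

theorem superFrame_inl_parity (i : Fin n) : (c.superFrame (.inl i)).HasParity 0 := c.evenFam_mem i

theorem superFrame_inr_parity (α : Fin m) : (c.superFrame (.inr α)).HasParity 1 := c.oddFam_mem α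

/-- An affine superfunction of even parity has no degree-one part, hence is a function. For the odd
coordinates the same argument leaves only a section of E^*, so the two kinds of coefficients of `X`
never mix. -/
theorem L0_app_inl (hV : V ≤ c.U) {X : SuperVect n m E V} (hX : X.IsL0) (i : Fin n) :
    X.app ((c.superCoord (.inl i)).res hV) =
      ofSmooth (X.app ((c.superCoord (.inl i)).res hV)).redS :=
  (hX.2 V le_rfl _ ((c.isAffine_superCoord _).res hV)).eq_of_even
    (hX.1.2.1 V le_rfl 0 _ ((hasParity_ofSmooth _).res hV))

theorem L0_app_inr (hV : V ≤ c.U) {X : SuperVect n m E V} (hX : X.IsL0) (α : Fin m) :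
    X.app ((c.superCoord (.inr α)).res hV) =
      ofDual _ (X.app ((c.superCoord (.inr α)).res hV)).lin_smooth :=
  (hX.2 V le_rfl _ ((c.isAffine_superCoord _).res hV)).eq_of_odd
    (hX.1.2.1 V le_rfl 1 _ ((hasParity_ofDual (c.coframe_smooth α)).res hV))

theorem sum_mul_ite_inl {R κ κ' : Type*} [NonAssocSemiring R] [Fintype κ] [Fintype κ']
    [DecidableEq κ] [DecidableEq κ'] (a : κ → R) (b : κ' → R) (i : κ) :
    ∑ j, a j * (if (Sum.inl j : κ ⊕ κ') = .inl i then 1 else 0) +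
      ∑ k, b k * (if (Sum.inr k : κ ⊕ κ') = .inl i then 1 else 0) = a i := by
  simp

theorem sum_mul_ite_inr {R κ κ' : Type*} [NonAssocSemiring R] [Fintype κ] [Fintype κ']
    [DecidableEq κ] [DecidableEq κ'] (a : κ → R) (b : κ' → R) (k : κ') :
    ∑ j, a j * (if (Sum.inl j : κ ⊕ κ') = .inr k then 1 else 0) +
      ∑ l, b l * (if (Sum.inr l : κ ⊕ κ') = .inr k then 1 else 0) = b k := by
  simp

/-- A linear vector field in coordinates. -/
theorem L0_eq_sum (hV : V ≤ c.U) {X : SuperVect n m E V} (hX : X.IsL0) :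
    X = ∑ i, SuperVect.mulOf (hasParity_ofSmooth (X.app ((c.superCoord (.inl i)).res hV)).redS)
        ((c.superFrame_inl_parity i).res hV) +
      ∑ α, SuperVect.mulOf
        (hasParity_ofDual (X.app ((c.superCoord (.inr α)).res hV)).lin_smooth)
        ((c.superFrame_inr_parity α).res hV) := by
  -- Both sides are even superderivations, so they need only be compared on coordinates, where the
  -- frame is dual to the coordinates and each sum leaves a single coefficient.
  refine SuperVect.ext_of_superCoord c (a := 0) hX.1 ?_ hV fun s => ?_
  · exact add_mem (SuperVect.hasParity_sum _ fun i => SuperVect.hasParity_mulOf _ _)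
      (SuperVect.hasParity_sum _ fun α => SuperVect.hasParity_mulOf _ _)
  · refine Eq.trans ?_ ((SuperVect.app_add _ _ _).trans (congrArg₂ (· + ·)
      ((SuperVect.app_sum _ _ _).trans (Finset.sum_congr rfl fun i _ =>
        (SuperVect.app_mulOf _ _ _).trans (congrArg (_ * ·) (c.superFrame_app hV (.inl i) s))))
      ((SuperVect.app_sum _ _ _).trans (Finset.sum_congr rfl fun α _ =>
        (SuperVect.app_mulOf _ _ _).trans
          (congrArg (_ * ·) (c.superFrame_app hV (.inr α) s)))))).symm
    have h1 := sum_mul_ite_inl (R := SuperFun n m E V)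
      (fun i : Fin n => ofSmooth (X.app ((c.superCoord (.inl i)).res hV)).redS)
      (fun α : Fin m => ofDual _ (X.app ((c.superCoord (.inr α)).res hV)).lin_smooth)
    have h2 := sum_mul_ite_inr (R := SuperFun n m E V)
      (fun i : Fin n => ofSmooth (X.app ((c.superCoord (.inl i)).res hV)).redS)
      (fun α : Fin m => ofDual _ (X.app ((c.superCoord (.inr α)).res hV)).lin_smooth)
    rcases s with i | α
    · exact (c.L0_app_inl hV hX i).trans (h1 i).symm
    · exact (c.L0_app_inr hV hX α).trans (h2 α).symm

/-- An affine superfunction in coordinates. -/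
theorem isAffine_eq_sum (hV : V ≤ c.U) {f : SuperFun n m E V} (hf : f.IsAffine) :
    f = ofSmooth f.redS + ∑ α, ofSmooth (c.dualCoeff hV f.lin f.lin_smooth α) *
      (c.superCoord (.inr α)).res hV := by
  conv_lhs => rw [hf.eq]
  rw [c.ofDual_eq_sum hV]

theorem app_ofSmooth (hV : V ≤ c.U) {X : SuperVect n m E V} {a : ZMod 2} (hX : X.HasParity a)
    (f : Smooth (𝓡 n) V) : X.app (ofSmooth f) = ∑ i, ofSmooth (c.baseCoords.pd hV i f) *
      X.app ((c.superCoord (.inl i)).res hV) :=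
  SuperDer.map_ofSmooth c hX hV le_rfl f

theorem app_affine (hV : V ≤ c.U) {X : SuperVect n m E V} (hX : X.HasParity 0)
    {f : SuperFun n m E V} (hf : f.IsAffine) :
    X.app f = X.app (ofSmooth f.redS) + ∑ α,
      (X.app (ofSmooth (c.dualCoeff hV f.lin f.lin_smooth α)) * (c.superCoord (.inr α)).res hV +
        ofSmooth (c.dualCoeff hV f.lin f.lin_smooth α) *
          X.app ((c.superCoord (.inr α)).res hV)) := by
  conv_lhs => rw [c.isAffine_eq_sum hV hf, map_add, map_sum]
  congr 1
  refine Finset.sum_congr rfl fun α _ => ?_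
  exact SuperDer.map_even_mul hX le_rfl (hasParity_ofSmooth _) _

/-- An even vector field that maps the coordinates to affine superfunctions preserves affine
superfunctions. -/
theorem isL0_of_superCoord (hV : V ≤ c.U) {X : SuperVect n m E V} (hX : X.HasParity 0)
    (h : ∀ s, (X.app ((c.superCoord s).res hV)).IsAffine) : X.IsL0 := by
  refine ⟨hX, fun W hW f hf => ?_⟩
  have hs : ∀ s, ((X.res hW).app ((c.superCoord s).res (hW.trans hV))).IsAffine := fun s => by
    have h1 := SuperVect.app_res hX hW ((c.superCoord s).res hV)
    have h2 := (h s).res hW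
    rw [← h1] at h2
    exact h2
  have hsm : ∀ k : Smooth (𝓡 n) W, ((X.res hW).app (ofSmooth k)).IsAffine := fun k => by
    rw [c.app_ofSmooth (hW.trans hV) (hX.res hW)]
    exact isAffine_sum _ fun i => (hs _).ofSmooth_mul _
  -- By parity `X` sends functions to functions, not merely to affine superfunctions. Without this,
  -- the term in which `X` differentiates a coefficient of e_α^* could acquire degree two.
  have hev : ∀ k : Smooth (𝓡 n) W, ∃ k', (X.res hW).app (ofSmooth k) = ofSmooth k' := fun k =>
    ⟨_, (hsm k).eq_of_even ((hX.res hW).2.1 W le_rfl 0 _ (hasParity_ofSmooth _))⟩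
  change ((X.res hW).app f).IsAffine
  rw [c.app_affine (hW.trans hV) (hX.res hW) hf]
  refine (hsm _).add (isAffine_sum _ fun α => IsAffine.add ?_ ((hs _).ofSmooth_mul _))
  obtain ⟨k', hk'⟩ := hev (c.dualCoeff (hW.trans hV) f.lin f.lin_smooth α)
  rw [hk']
  exact ((c.isAffine_superCoord _).res _).ofSmooth_mul _

/-- The action of a vector field on the total space on functions on the base. -/
theorem app_pull (hV : V ≤ c.U) (X' : Vect (totModel n m) (preim m E V)) (f : Smooth (𝓡 n) V)
    (e : preim m E V) : X'.app f.pull e = ∑ i, c.baseCoords.pd hV i f (proj e) *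
      X'.app ((c.coord (.inl i)).res (preim_mono hV)) e := by
  -- Pulling back, applying the vector field and evaluating at `e` is a derivation at the base point
  -- of `e` on functions of `M`, so Hadamard's lemma is used on the base.
  let D : ∀ W : Opens M, W ≤ V → e.1.proj ∈ W → (Smooth (𝓡 n) W →ₗ[ℝ] ℝ) := fun W hW hp =>
    { toFun k := (X'.res (preim_mono hW)).app k.pull ⟨e, hp⟩
      map_add' k l := congrArg (fun q : Smooth (totModel n m) (preim m E W) => q ⟨e, hp⟩)
        (map_add (X'.res (preim_mono hW)).app k.pull l.pull)
      map_smul' r k := congrArg (fun q : Smooth (totModel n m) (preim m E W) => q ⟨e, hp⟩)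
        ((X'.res (preim_mono hW)).app.map_smul r k.pull) }
  exact c.baseCoords.pointDerivation_eq hV (p := e.1.proj) e.2 D
    (fun W hW hp f => congrArg (fun q : Smooth (totModel n m) (preim m E W) => q ⟨e, hp⟩)
      (X'.app_res (preim_mono hW) f.pull))
    (fun W hW hp f g => congrArg (fun q : Smooth (totModel n m) (preim m E W) => q ⟨e, hp⟩)
      ((X'.res (preim_mono hW)).app.leibniz f.pull g.pull)) f

/-- The relation `X' = Ψ(X)` can be checked on coordinates. -/
theorem isPsi_of_coord (hV : V ≤ c.U) {X : SuperVect n m E V} (hX : X.HasParity 0)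
    {X' : Vect (totModel n m) (preim m E V)}
    (h : ∀ s e, X'.app ((c.coord s).res (preim_mono hV)) e =
      (X.app ((c.superCoord s).res hV)).psi e) : IsPsi X X' := by
  intro W hW h' f k hf hk e
  have hWU := hW.trans hV
  have hX'' := hX.res hW
  let X'' := X'.res (preim_mono (m := m) (E := E) hW)
  have hs : ∀ s, X''.app ((c.coord s).res (preim_mono hWU)) e =
      ((X.res hW).app ((c.superCoord s).res hWU)).psi e := fun s => by
    have h1 := X'.app_res (preim_mono hW) ((c.coord s).res (preim_mono hV))
    have h2 := SuperVect.app_res hX hW ((c.superCoord s).res hV)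
    exact (congrArg (fun q : Smooth (totModel n m) (preim m E W) => q e) h1).trans
      ((h s ⟨e, preim_mono hW e.2⟩).trans (congrArg (fun q => q.psi e) h2.symm))
  have hp : ∀ l : Smooth (𝓡 n) W, X''.app l.pull e = ((X.res hW).app (ofSmooth l)).psi e :=
    fun l => by
      rw [c.app_pull hWU, c.app_ofSmooth hWU hX'', psi_sum]
      refine Finset.sum_congr rfl fun i _ => ?_
      rw [psi_ofSmooth_mul, hs]
  -- A function ψ(f) is affine along the fibres: a pulled-back function plus a combination of the
  -- fibre coordinates with pulled-back coefficients. It remains to compare the two Leibniz rules on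
  -- such expressions.
  have hk' : k = f.redS.pull + ∑ α, (c.dualCoeff hWU f.lin f.lin_smooth α).pull *
      (c.coord (.inr α)).res (preim_mono hWU) := by
    ext e'
    refine (hk e').trans ((congrArg (fun q : SuperFun n m E W => q.psi e')
      (c.isAffine_eq_sum hWU hf)).trans ?_)
    rw [psi_add, psi_ofSmooth, psi_sum]
    refine Eq.trans ?_ (congrArg (f.redS (proj e') + ·) (Smooth.sum_apply _ _ _)).symm
    congr 1
    refine Finset.sum_congr rfl fun α _ => ?_
    rw [psi_ofSmooth_mul]
    exact congrArg (_ * ·) (c.psi_superCoord (.inr α) ⟨e', preim_mono hWU e'.2⟩)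
  change X''.app k e = ((X.res hW).app f).psi e
  rw [c.app_affine hWU hX'' hf, psi_add, psi_sum, hk', map_add, map_sum]
  refine Eq.trans (congrArg (X''.app f.redS.pull e + ·) (Smooth.sum_apply _ _ _)) ?_
  rw [hp]
  congr 1
  refine Finset.sum_congr rfl fun α _ => ?_
  rw [Derivation.leibniz, psi_add, psi_ofSmooth_mul, psi_mul, ← hs]
  -- The fibre coordinate has zero reduction, and the derivative of a coefficient is even and so
  -- equals its reduction under ψ. Therefore ψ is multiplicative on the product of the two.
  have h1 : ((c.superCoord (.inr α)).res hWU : SuperFun n m E W).red (proj e) = 0 :=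
    algebraMapInv_ι _
  have h2 := psi_of_even (hX''.2.1 W le_rfl 0 _
    (hasParity_ofSmooth (c.dualCoeff hWU f.lin f.lin_smooth α))) e
  rw [h1, zero_mul, add_zero]
  refine (add_comm _ _).trans (congrArg₂ (· + ·) ?_ rfl)
  refine (mul_comm _ _).trans (congrArg₂ (· * ·) ((hp _).trans h2) ?_)
  exact (c.psi_superCoord (.inr α) ⟨e, preim_mono hWU e.2⟩).symm

end BundleCoords

end LinearVectorFields

/-! ### The coordinate form satisfying the defining identity, and why that identity determines it.
-/

section InducedCoefficients

variable {n m : ℕ} {M : Type*} [TopologicalSpace M] [ChartedSpace (EuclideanSpace ℝ (Fin n)) M]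
  [IsManifold (𝓡 n) ∞ M]
  {E : M → Type*} [∀ x, AddCommGroup (E x)] [∀ x, Module ℝ (E x)] [∀ x, TopologicalSpace (E x)]
  [TopologicalSpace (TotalSpace (EuclideanSpace ℝ (Fin m)) E)]
  [FiberBundle (EuclideanSpace ℝ (Fin m)) E] [VectorBundle ℝ (EuclideanSpace ℝ (Fin m)) E]
  [ContMDiffVectorBundle ∞ (EuclideanSpace ℝ (Fin m)) E (𝓡 n)]

variable {U V W : Opens M} {p : ZMod 2}

open SuperFun

theorem bilin_sum_add_sum {A B C κ κ' : Type*} [AddCommMonoid A] [Module ℝ A] [AddCommMonoid B]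
    [Module ℝ B] [AddCommMonoid C] [Module ℝ C] [Fintype κ] [Fintype κ'] (b : A →ₗ[ℝ] B →ₗ[ℝ] C)
    (f : κ → A) (f' : κ' → A) (y : B) :
    b (∑ i, f i + ∑ j, f' j) y = ∑ i, b (f i) y + ∑ j, b (f' j) y := by
  simp only [map_add, map_sum, LinearMap.add_apply, LinearMap.sum_apply]

theorem SuperFun.red_sum {κ : Type*} (s : Finset κ) (f : κ → SuperFun n m E U) (x : U) :
    (∑ i ∈ s, f i).red x = ∑ i ∈ s, (f i).red x :=
  map_sum ((ExteriorAlgebra.algebraMapInv (R := ℝ)).comp (evalHom x)) f s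

namespace BundleCoords

variable (c : BundleCoords n m E)

theorem preim_le_totCoords (hV : V ≤ c.U) : preim m E V ≤ c.totCoords.U := preim_mono hV

theorem totCoords_x_res (hV : V ≤ c.U) (s : Fin n ⊕ Fin m) :
    (c.totCoords.x s).res (c.preim_le_totCoords hV) = (c.coord s).res (preim_mono hV) :=
  congrArg (Smooth.res (preim_mono hV)) (c.totCoords_x s)

end BundleCoords

namespace SuperMetric

variable (g : SuperMetric n m E p) (c : BundleCoords n m E)

theorem form_mulOf {a b : ZMod 2} {f : SuperFun n m E V} (hf : f.HasParity b)
    {X : SuperVect n m E V} (hX : X.HasParity a) (Z : SuperVect n m E V) :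
    g.form V (SuperVect.mulOf hf hX) Z = sgn (p * b) • (f * g.form V X Z) :=
  g.form_mul V b f X _ Z hf (SuperVect.isMul_mulOf hf hX)

theorem form_comm_of_even {a : ZMod 2} {X Y : SuperVect n m E V} (hX : X.HasParity 0)
    (hY : Y.HasParity a) : g.form V X Y = g.form V Y X := by
  rw [g.form_symm V 0 a X Y hX hY, zero_mul, sgn_zero, one_smul]

/-- The sign comes from pulling an odd coefficient out of a metric of parity `p`; even coefficients
come out without one. -/
theorem form_eq_sum (hV : V ≤ c.U) {X : SuperVect n m E V} (hX : X.IsL0) (Z : SuperVect n m E V) :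
    g.form V X Z = ∑ i, ofSmooth (X.app ((c.superCoord (.inl i)).res hV)).redS *
        g.form V ((c.superFrame (.inl i)).res hV) Z +
      ∑ α, sgn p • (ofDual _ (X.app ((c.superCoord (.inr α)).res hV)).lin_smooth *
        g.form V ((c.superFrame (.inr α)).res hV) Z) := by
  refine (congrArg (fun Q => g.form V Q Z) (c.L0_eq_sum hV hX)).trans ?_
  refine (bilin_sum_add_sum (g.form V) _ _ Z).trans (congrArg₂ (· + ·) ?_ ?_)
  · refine Finset.sum_congr rfl fun i _ => (g.form_mulOf _ _ Z).trans ?_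
    rw [mul_zero, sgn_zero, one_smul]
  · refine Finset.sum_congr rfl fun α _ => (g.form_mulOf _ _ Z).trans ?_
    rw [mul_one]

/-- Under ψ ∘ pr an odd coefficient absorbs all permitted degree, so the metric value it multiplies
enters only through its reduction. In `red_form`, where degree one is dropped too, the odd terms
vanish altogether. -/
theorem psi_form (hV : V ≤ c.U) {X : SuperVect n m E V} (hX : X.IsL0) (Z : SuperVect n m E V)
    (e : preim m E V) :
    (g.form V X Z).psi e = ∑ i, (X.app ((c.superCoord (.inl i)).res hV)).psi e *
        (g.form V ((c.superFrame (.inl i)).res hV) Z).psi e +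
      ∑ α, (X.app ((c.superCoord (.inr α)).res hV)).psi e *
        (sgn p * (g.form V ((c.superFrame (.inr α)).res hV) Z).red (proj e)) := by
  refine (congrArg (fun q : SuperFun n m E V => q.psi e) (g.form_eq_sum c hV hX Z)).trans ?_
  refine (psi_add _ _ e).trans (congrArg₂ (· + ·) ((psi_sum _ _ e).trans ?_)
    ((psi_sum _ _ e).trans ?_))
  · exact Finset.sum_congr rfl fun i _ => (psi_ofSmooth_mul _ _ e).trans
      (congrArg (· * _) ((psi_of_even (hX.1.2.1 V le_rfl 0 _ ((hasParity_ofSmooth (c.x i)).res hV)) e).symm))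
  · refine Finset.sum_congr rfl fun α _ => (psi_smul _ _ e).trans
      ((congrArg (sgn p * ·) (psi_ofDual_mul _ _ e)).trans ((mul_left_comm _ _ _).trans
        (congrArg (· * _) ?_)))
    exact (psi_of_odd (hX.1.2.1 V le_rfl 1 _
      ((hasParity_ofDual (c.coframe_smooth α)).res hV)) e).symm

theorem red_form (hV : V ≤ c.U) {X : SuperVect n m E V} (hX : X.IsL0) (Z : SuperVect n m E V)
    (e : preim m E V) :
    (g.form V X Z).red (proj e) = ∑ i, (X.app ((c.superCoord (.inl i)).res hV)).psi e *
        (g.form V ((c.superFrame (.inl i)).res hV) Z).red (proj e) := by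
  refine (congrArg (fun q : SuperFun n m E V => q.red (proj e)) (g.form_eq_sum c hV hX Z)).trans ?_
  refine (red_add _ _ _).trans ((congrArg₂ (· + ·) ((red_sum _ _ _).trans ?_)
    ((red_sum _ _ _).trans (Finset.sum_eq_zero fun α _ => ?_))).trans (add_zero _))
  · exact Finset.sum_congr rfl fun i _ => (red_mul _ _ _).trans (congrArg (· * _)
      ((red_ofSmooth _ _).trans
        (psi_of_even (hX.1.2.1 V le_rfl 0 _ ((hasParity_ofSmooth (c.x i)).res hV)) e).symm))
  · refine (red_smul _ _ _).trans (mul_eq_zero_of_right _ ((red_mul _ _ _).trans ?_))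
    exact mul_eq_zero_of_left (red_ofDual _ _) _

/-- The coefficients of the induced form in coordinates. -/
def inducedCoeff : Fin n ⊕ Fin m → Fin n ⊕ Fin m → Smooth (totModel n m) c.totCoords.U
  | .inl i, .inl j => (g.form c.U (c.superFrame (.inl i)) (c.superFrame (.inl j))).psiS
  | .inl i, .inr α =>
    sgn p • (g.form c.U (c.superFrame (.inl i)) (c.superFrame (.inr α))).redS.pull
  | .inr α, .inl i =>
    sgn p • (g.form c.U (c.superFrame (.inl i)) (c.superFrame (.inr α))).redS.pull
  | .inr _, .inr _ => 0

/-- The mixed coefficients are symmetric by definition; for two even directions this is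
supersymmetry of `g`, which carries no sign there. -/
theorem inducedCoeff_symm (r s : Fin n ⊕ Fin m) : g.inducedCoeff c r s = g.inducedCoeff c s r := by
  rcases r with i | α <;> rcases s with j | β
  · refine congrArg SuperFun.psiS (g.form_comm_of_even (c.superFrame_inl_parity i)
      (c.superFrame_inl_parity j))
  all_goals rfl

/-- Expand `g` in `X`, exchange the arguments using that sections of ℒ₀ and the ∂̂ᵢ are even, and
expand in `Y`. Next to an odd coefficient of `X` only the reduction is left, which contains no odd
coefficients of `Y`: this accounts for the zero odd-odd block. The right-hand side makes no
reference to coordinates, so any two coordinate systems give the same values on Ψ-images. -/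
theorem coordForm_inducedCoeff (hV : V ≤ c.U) {X Y : SuperVect n m E V}
    {X' Y' : Vect (totModel n m) (preim m E V)} (hX : X.IsL0) (hY : Y.IsL0) (hXX' : IsPsi X X')
    (hYY' : IsPsi Y Y') (e : preim m E V) :
    c.totCoords.coordForm (c.preim_le_totCoords hV) (g.inducedCoeff c) X' Y' e = (g.form V X Y).psi e := by
  -- Coordinates are affine, so Ψ can be evaluated on them: the coefficients of `Z'` are the images
  -- under ψ of those of `Z`.
  have hcoord : ∀ {Z : SuperVect n m E V} {Z' : Vect (totModel n m) (preim m E V)}, IsPsi Z Z' →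
      ∀ s, Z'.app ((c.totCoords.x s).res (c.preim_le_totCoords hV)) e =
        (Z.app ((c.superCoord s).res hV)).psi e := fun h s =>
    h V le_rfl le_rfl _ _ ((c.isAffine_superCoord s).res hV) (fun e' => by
      rw [c.totCoords_x_res hV]; exact (c.psi_superCoord s ⟨e', preim_mono hV e'.2⟩).symm) e
  rw [LocalCoords.coordForm_apply]
  have hsum : (∑ r, ∑ s, X'.app ((c.totCoords.x r).res (c.preim_le_totCoords hV)) *
      Y'.app ((c.totCoords.x s).res (c.preim_le_totCoords hV)) *
        (g.inducedCoeff c r s).res (c.preim_le_totCoords hV) : Smooth (totModel n m) (preim m E V)) e =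
      ∑ r, ∑ s, (X.app ((c.superCoord r).res hV)).psi e *
        (Y.app ((c.superCoord s).res hV)).psi e *
          g.inducedCoeff c r s ⟨e, c.preim_le_totCoords hV e.2⟩ := by
    rw [Smooth.sum_apply]
    refine Finset.sum_congr rfl fun r _ => ?_
    rw [Smooth.sum_apply]
    refine Finset.sum_congr rfl fun s _ => ?_
    rw [← hcoord hXX', ← hcoord hYY']
    rfl
  rw [hsum]
  -- The order of the two even indices is reversed, because `psi_form` expands first arguments and
  -- `Y` has been moved there by symmetry.
  have hll : ∀ i j, g.inducedCoeff c (.inl i) (.inl j) ⟨e, c.preim_le_totCoords hV e.2⟩ =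
      (g.form V ((c.superFrame (.inl j)).res hV) ((c.superFrame (.inl i)).res hV)).psi e :=
    fun i j => by
      rw [inducedCoeff_symm, ← g.form_res hV]
      rfl
  have hlr : ∀ i α, g.inducedCoeff c (.inl i) (.inr α) ⟨e, c.preim_le_totCoords hV e.2⟩ = sgn p *
      (g.form V ((c.superFrame (.inl i)).res hV) ((c.superFrame (.inr α)).res hV)).red (proj e) :=
    fun i α => by
      rw [← g.form_res hV]
      rfl
  have hrl : ∀ i α, g.inducedCoeff c (.inr α) (.inl i) ⟨e, c.preim_le_totCoords hV e.2⟩ = sgn p *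
      (g.form V ((c.superFrame (.inl i)).res hV) ((c.superFrame (.inr α)).res hV)).red (proj e) :=
    fun i α => by
      rw [← g.form_res hV]
      rfl
  have hrr : ∀ α β, g.inducedCoeff c (.inr α) (.inr β) ⟨e, c.preim_le_totCoords hV e.2⟩ = 0 :=
    fun _ _ => rfl
  refine Eq.trans ?_ (g.psi_form c hV hX Y e).symm
  simp only [Fintype.sum_sum_type, hll, hlr, hrl, hrr, mul_zero, Finset.sum_const_zero, add_zero]
  refine congrArg₂ (· + ·) (Finset.sum_congr rfl fun i _ => ?_) (Finset.sum_congr rfl fun α _ => ?_)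
  · have h := (congrArg (fun q : SuperFun n m E V => q.psi e)
      (g.form_comm_of_even ((c.superFrame_inl_parity i).res hV) hY.1)).trans
        (g.psi_form c hV hY _ e)
    refine Eq.trans ?_ (congrArg (_ * ·) h).symm
    refine Eq.trans ?_ (mul_add _ _ _).symm
    refine congrArg₂ (· + ·) ?_ ?_
    · refine Eq.trans ?_ (Finset.mul_sum _ _ _).symm
      exact Finset.sum_congr rfl fun j _ => mul_assoc _ _ _
    · refine Eq.trans ?_ (Finset.mul_sum _ _ _).symm
      refine Finset.sum_congr rfl fun α _ => (mul_assoc _ _ _).trans ?_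
      exact congrArg (fun q : SuperFun n m E V => _ * (_ * (_ * q.red (proj e))))
        (g.form_comm_of_even ((c.superFrame_inl_parity i).res hV)
          ((c.superFrame_inr_parity α).res hV))
  -- For an odd coefficient of `X`, only a reduction has to be expanded in `Y`, so `red_form`
  -- replaces `psi_form` and only even directions of `Y` remain.
  · have h := (congrArg (fun q : SuperFun n m E V => q.red (proj e))
      (g.form_comm_of_even hY.1 ((c.superFrame_inr_parity α).res hV))).symm.trans
        (g.red_form c hV hY _ e)
    refine Eq.trans ?_ (congrArg (fun q => _ * (_ * q)) h).symm
    rw [Finset.mul_sum, Finset.mul_sum]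
    exact Finset.sum_congr rfl fun j _ => (mul_assoc _ _ _).trans
      (congrArg (_ * ·) (mul_left_comm _ _ _))

end SuperMetric

namespace BundleCoords

variable (c : BundleCoords n m E)

/-- Away from the zeros of the coordinate one divides. At a zero, differentiating the relation along
that same coordinate leaves `d` alone, so it vanishes there as well. -/
theorem eq_zero_of_coord_mul (hV : V ≤ c.U) (s : Fin n ⊕ Fin m)
    {d : Smooth (totModel n m) (preim m E V)}
    (h : (c.coord s).res (preim_mono hV) * d = 0) : d = 0 := by
  rw [← c.totCoords_x_res hV] at h
  have hV' := c.preim_le_totCoords hV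
  have h1 := congrArg (c.totCoords.pd hV' s) h
  rw [Derivation.leibniz, map_zero, c.totCoords.pd_x hV', if_pos rfl] at h1
  ext e
  have h2 : c.totCoords.x s ⟨e, hV' e.2⟩ * d e = 0 :=
    congrArg (fun q : Smooth (totModel n m) (preim m E V) => q e) h
  have h3 : c.totCoords.x s ⟨e, hV' e.2⟩ * c.totCoords.pd hV' s d e + d e * 1 = 0 :=
    congrArg (fun q : Smooth (totModel n m) (preim m E V) => q e) h1
  change d e = 0
  rcases mul_eq_zero.1 h2 with h0 | h0
  · rwa [h0, zero_mul, zero_add, mul_one] at h3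
  · exact h0

/-- Up to a factor that is not a zero divisor, the coordinate vector fields on the total space come
from linear vector fields. -/
theorem exists_isPsi_frame (hV : V ≤ c.U) (r : Fin n ⊕ Fin m) :
    ∃ (w : Smooth (totModel n m) (preim m E V)) (X : SuperVect n m E V),
      (∀ d, w * d = 0 → d = 0) ∧ X.IsL0 ∧
        IsPsi X (((c.totCoords.frame r).res (c.preim_le_totCoords hV)).mul w) := by
  have hframe : ∀ s (e : preim m E V),
      ((c.totCoords.frame r).res (c.preim_le_totCoords hV)).app ((c.coord s).res (preim_mono hV)) e =
        if r = s then 1 else 0 := fun s e => by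
    have h := c.totCoords.pd_x (c.preim_le_totCoords hV) r s
    rw [c.totCoords_x_res hV] at h
    refine (congrArg (fun q : Smooth (totModel n m) (preim m E V) => q e) h).trans ?_
    by_cases hrs : r = s
    · rw [if_pos hrs, if_pos hrs]; rfl
    · rw [if_neg hrs, if_neg hrs]; rfl
  have hpsi1 : ∀ e : preim m E V, (1 : SuperFun n m E V).psi e = 1 := fun e => by
    have h := psi_ofSmooth (m := m) (E := E) (1 : Smooth (𝓡 n) V) e
    rw [show (ofSmooth 1 : SuperFun n m E V) = 1 from map_one ofSmoothHom] at h
    exact h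
  have hpsi0 : ∀ e : preim m E V, (0 : SuperFun n m E V).psi e = 0 := fun e => map_zero (psiHom e)
  rcases r with i | α
  · have hX := (c.superFrame_inl_parity i).res hV
    refine ⟨1, (c.superFrame (.inl i)).res hV, fun d hd => by rwa [one_mul] at hd,
      c.isL0_of_superCoord hV hX fun s => ?_, c.isPsi_of_coord hV hX fun s e => ?_⟩
    · rw [superFrame_app]
      split_ifs
      · exact fun x => ⟨1, 0, by rw [map_one, map_zero, add_zero]; rfl⟩
      · exact fun x => ⟨0, 0, by rw [map_zero, map_zero, add_zero]; rfl⟩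
    · rw [superFrame_app, Vect.app_mul, one_mul, hframe]
      split_ifs
      · exact (hpsi1 e).symm
      · exact (hpsi0 e).symm
  -- The odd ∂̂_α is not in ℒ₀; multiplied by its own coordinate it becomes even and maps
  -- coordinates to affine superfunctions. The price is the factor `w`, the corresponding fibre
  -- coordinate.
  · have hf : ((c.superCoord (.inr α)).res hV).HasParity 1 :=
      (hasParity_ofDual (c.coframe_smooth α)).res hV
    let X := SuperVect.mulOf hf ((c.superFrame_inr_parity α).res hV)
    have hX : X.HasParity 0 := SuperVect.hasParity_mulOf hf _
    have happ : ∀ s, X.app ((c.superCoord s).res hV) =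
        if Sum.inr α = s then (c.superCoord (.inr α)).res hV else 0 := fun s => by
      change (c.superCoord (.inr α)).res hV * ((c.superFrame (.inr α)).res hV).app _ = _
      rw [superFrame_app, mul_ite, mul_one, mul_zero]
    refine ⟨(c.coord (.inr α)).res (preim_mono hV), X, fun d => c.eq_zero_of_coord_mul hV _,
      c.isL0_of_superCoord hV hX fun s => ?_, c.isPsi_of_coord hV hX fun s e => ?_⟩
    · rw [happ]
      split_ifs
      · exact (c.isAffine_superCoord _).res hV
      · exact fun x => ⟨0, 0, by rw [map_zero, map_zero, add_zero]; rfl⟩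
    · rw [happ, Vect.app_mul]
      refine (congrArg (_ * ·) (hframe s e)).trans ?_
      split_ifs
      · rw [mul_one]
        exact (c.psi_superCoord (.inr α) ⟨e, preim_mono hV e.2⟩).symm
      · rw [mul_zero]
        exact (hpsi0 e).symm

/-- A bilinear form on vector fields is determined by its values on vector fields that come from
linear vector fields. -/
theorem bilin_ext_of_isPsi (hV : V ≤ c.U)
    {b b' : Vect (totModel n m) (preim m E V) →ₗ[ℝ] Vect (totModel n m) (preim m E V) →ₗ[ℝ]
      Smooth (totModel n m) (preim m E V)}
    (hl : ∀ f X Y, b (X.mul f) Y = f * b X Y) (hs : ∀ X Y, b X Y = b Y X)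
    (hl' : ∀ f X Y, b' (X.mul f) Y = f * b' X Y) (hs' : ∀ X Y, b' X Y = b' Y X)
    (h : ∀ (X Y : SuperVect n m E V) (X' Y' : Vect (totModel n m) (preim m E V)), X.IsL0 →
      Y.IsL0 → IsPsi X X' → IsPsi Y Y' → b X' Y' = b' X' Y') : b = b' := by
  have hr : ∀ f X Y, b X (Y.mul f) = f * b X Y := fun f X Y => by rw [hs, hl, hs]
  have hr' : ∀ f X Y, b' X (Y.mul f) = f * b' X Y := fun f X Y => by rw [hs', hl', hs']
  have hV' :  preim m E V ≤ c.totCoords.U := c.preim_le_totCoords hV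
  have key : ∀ r s, b ((c.totCoords.frame r).res hV') ((c.totCoords.frame s).res hV') =
      b' ((c.totCoords.frame r).res hV') ((c.totCoords.frame s).res hV') := fun r s => by
    obtain ⟨w, X, hw, hX, hXX'⟩ := c.exists_isPsi_frame hV r
    obtain ⟨v, Y, hv, hY, hYY'⟩ := c.exists_isPsi_frame hV s
    have h1 := h X Y _ _ hX hY hXX' hYY'
    rw [hl, hr, hl', hr'] at h1
    -- The forms agree after multiplication by `w` and `v`; neither annihilates a nonzero function,
    -- so both factors cancel.
    refine sub_eq_zero.1 (hv _ (hw _ ?_))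
    rw [mul_sub, mul_sub, h1, sub_self]
  refine LinearMap.ext fun X => LinearMap.ext fun Y => ?_
  rw [c.totCoords.vect_eq_sum hV' X, c.totCoords.vect_eq_sum hV' Y]
  simp only [map_sum, LinearMap.sum_apply, hl, hr, hl', hr', key]

end BundleCoords

end InducedCoefficients

/-! ### Existence and uniqueness of the induced form; degree-one parts as derivatives. -/

section InducedForm

variable {n m : ℕ} {M : Type*} [TopologicalSpace M] [ChartedSpace (EuclideanSpace ℝ (Fin n)) M]
  [IsManifold (𝓡 n) ∞ M]
  {E : M → Type*} [∀ x, AddCommGroup (E x)] [∀ x, Module ℝ (E x)] [∀ x, TopologicalSpace (E x)]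
  [TopologicalSpace (TotalSpace (EuclideanSpace ℝ (Fin m)) E)]
  [FiberBundle (EuclideanSpace ℝ (Fin m)) E] [VectorBundle ℝ (EuclideanSpace ℝ (Fin m)) E]
  [ContMDiffVectorBundle ∞ (EuclideanSpace ℝ (Fin m)) E (𝓡 n)]

open SuperFun

namespace LocalCoords

variable {B H N κ : Type*} [NormedAddCommGroup B] [NormedSpace ℝ B] [TopologicalSpace H]
  [TopologicalSpace N] [ChartedSpace H N] {I : ModelWithCorners ℝ B H} [Fintype κ] [DecidableEq κ]

theorem coordForm_frame [IsManifold I ∞ N] (c : LocalCoords N I κ) {V : Opens N} (hV : V ≤ c.U)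
    (G : κ → κ → Smooth I c.U) (r s : κ) :
    c.coordForm hV G ((c.frame r).res hV) ((c.frame s).res hV) = (G r s).res hV := by
  simp only [coordForm_apply, frame_app, pd_x]
  rw [Finset.sum_eq_single r (fun i _ hi => by simp [Ne.symm hi]) (by simp),
    Finset.sum_eq_single s (fun j _ hj => by simp [Ne.symm hj]) (by simp), if_pos rfl, if_pos rfl,
    one_mul, one_mul]

/-- The defining identity compares coordinate forms only over preimages of open sets of the base,
whereas gluing on the total space needs arbitrary open subsets. Agreement descends because a form is
determined by its values on the frame, which restricts. -/
theorem coordForm_eq_of_le [IsManifold I ∞ N] {c c' : LocalCoords N I κ} {V W : Opens N}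
    (hV : V ≤ c.U) (hV' : V ≤ c'.U) (h : W ≤ V) {G : κ → κ → Smooth I c.U}
    {G' : κ → κ → Smooth I c'.U} (hG : ∀ i j, G' i j = G' j i)
    (heq : c'.coordForm hV' G' = c.coordForm hV G) :
    c'.coordForm (h.trans hV') G' = c.coordForm (h.trans hV) G := by
  refine c.bilin_eq_coordForm _ _ (fun f X Y => c'.coordForm_mul _ G' f X Y) (fun f X Y => ?_)
    fun i j => ?_
  · rw [c'.coordForm_symm _ hG, c'.coordForm_mul, c'.coordForm_symm _ hG]
  · have h1 := c'.coordForm_res hV' h G' ((c.frame i).res hV) ((c.frame j).res hV)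
    rw [heq, c.coordForm_frame] at h1
    exact h1.symm

end LocalCoords

namespace BundleCoords

/-- Coordinates around a point. -/
def around (x : M) : BundleCoords n m E where
  U := ⟨(chartAt (EuclideanSpace ℝ (Fin n)) x).source ∩
    (trivializationAt (EuclideanSpace ℝ (Fin m)) E x).baseSet,
    (chartAt _ x).open_source.inter (trivializationAt _ E x).open_baseSet⟩
  chart := chartAt _ x
  chart_mem := IsManifold.chart_mem_maximalAtlas x
  U_le_chart := Set.inter_subset_left
  triv := trivializationAt _ E x
  triv_linear := inferInstance
  triv_smooth := Trivialization.contMDiffOn _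
  triv_symm_smooth := Trivialization.contMDiffOn_symm _
  U_le_triv := Set.inter_subset_right
  basis := (EuclideanSpace.basisFun (Fin m) ℝ).toBasis

theorem mem_around (x : M) : x ∈ (BundleCoords.around x : BundleCoords n m E).U :=
  ⟨mem_chart_source _ x, FiberBundle.mem_baseSet_trivializationAt' x⟩

end BundleCoords

variable {p : ZMod 2}

/-- Both forms take the prescribed values on Ψ-images, and these determine a symmetric
function-bilinear form over a coordinate domain. -/
theorem IsInduced.form_eq {g : SuperMetric n m E p} {G : SymmForm (Tot m E) (totModel n m)}
    (hG : IsInduced g G) (c : BundleCoords n m E) :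
    G.form (preim m E c.U) = c.totCoords.coordForm (c.preim_le_totCoords le_rfl)
      (g.inducedCoeff c) := by
  refine c.bilin_ext_of_isPsi le_rfl (G.form_mul _) (G.form_symm _)
    (c.totCoords.coordForm_mul _ _)
    (c.totCoords.coordForm_symm _ (g.inducedCoeff_symm c)) fun X Y X' Y' hX hY hXX' hYY' => ?_
  ext e
  exact (hG c.U X Y X' Y' hX hY hXX' hYY' e).trans
    (g.coordForm_inducedCoeff c le_rfl hX hY hXX' hYY' e).symm

theorem IsInduced.form_frame {g : SuperMetric n m E p} {G : SymmForm (Tot m E) (totModel n m)}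
    (hG : IsInduced g G) (c : BundleCoords n m E) (r s : Fin n ⊕ Fin m) :
    G.form (preim m E c.U) (c.totCoords.frame r) (c.totCoords.frame s) = g.inducedCoeff c r s := by
  rw [hG.form_eq c]
  exact c.totCoords.coordForm_frame (c.preim_le_totCoords le_rfl) (g.inducedCoeff c) r s

theorem IsInduced.unique {g : SuperMetric n m E p} {G G' : SymmForm (Tot m E) (totModel n m)}
    (hG : IsInduced g G) (hG' : IsInduced g G') : G = G' := by
  refine SymmForm.ext_of_local fun y => ?_
  let c : BundleCoords n m E := BundleCoords.around y.proj
  have key : ∀ {F : SymmForm (Tot m E) (totModel n m)}, IsInduced g F →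
      ∀ V (hV : V ≤ preim m E c.U),
        F.form V = c.totCoords.coordForm (V := V) hV (g.inducedCoeff c) := by
    intro F hF V hV
    refine c.totCoords.bilin_eq_coordForm _ _ (F.form_mul V) (fun f X Y => ?_) fun r s => ?_
    · rw [F.form_symm, F.form_mul, F.form_symm]
    · exact (F.form_res hV _ _).symm.trans (congrArg (Smooth.res hV) (hF.form_frame c r s))
  exact ⟨preim m E c.U, BundleCoords.mem_around y.proj, fun V hV => (key hG V hV).trans
    (key hG' V hV).symm⟩

theorem exists_isInduced (g : SuperMetric n m E p) :
    ∃ G : SymmForm (Tot m E) (totModel n m), IsInduced g G := by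
  let c : M → BundleCoords n m E := BundleCoords.around
  obtain ⟨F, hF⟩ := LocalCoords.exists_symmForm (fun y : Tot m E => (c y.proj).totCoords)
    (fun y => BundleCoords.mem_around y.proj) (fun y => g.inducedCoeff (c y.proj))
    (fun y => g.inducedCoeff_symm (c y.proj)) fun y z V hy hz => by
      have hU : preim m E ((c y.proj).U ⊓ (c z.proj).U) ≤ (c y.proj).totCoords.U :=
        (c y.proj).preim_le_totCoords inf_le_left
      have hU' : preim m E ((c y.proj).U ⊓ (c z.proj).U) ≤ (c z.proj).totCoords.U :=
        (c z.proj).preim_le_totCoords inf_le_right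
      refine LocalCoords.coordForm_eq_of_le (V := preim m E ((c y.proj).U ⊓ (c z.proj).U)) hU' hU
        (fun e he => ⟨hy he, hz he⟩) (g.inducedCoeff_symm (c y.proj)) ?_
      -- On the overlap both coordinate forms have the value ψ(pr(g(X, Y))) on Ψ-images, and this
      -- replaces the computation of a transformation law.
      refine (c y.proj).bilin_ext_of_isPsi inf_le_left
        ((c y.proj).totCoords.coordForm_mul _ _)
        ((c y.proj).totCoords.coordForm_symm _ (g.inducedCoeff_symm (c y.proj)))
        ((c z.proj).totCoords.coordForm_mul _ _)
        ((c z.proj).totCoords.coordForm_symm _ (g.inducedCoeff_symm (c z.proj)))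
        fun X Y X' Y' hX hY hXX' hYY' => ?_
      ext e
      exact (g.coordForm_inducedCoeff (c y.proj) inf_le_left hX hY hXX' hYY' e).trans
        (g.coordForm_inducedCoeff (c z.proj) inf_le_right hX hY hXX' hYY' e).symm
  refine ⟨F, fun U X Y X' Y' hX hY hXX' hYY' e => ?_⟩
  -- `U` need not lie in a coordinate domain. The identity is checked pointwise after restriction to
  -- the part of `U` inside coordinates around the base point of `e`.
  have hV : U ⊓ (c e.1.proj).U ≤ U := inf_le_left
  have he : e.1 ∈ preim m E (U ⊓ (c e.1.proj).U) := ⟨e.2, BundleCoords.mem_around e.1.proj⟩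
  have h1 := F.form_res (preim_mono hV) X' Y'
  rw [hF e.1 _ ((c e.1.proj).preim_le_totCoords inf_le_right)] at h1
  have h2 := g.coordForm_inducedCoeff (c e.1.proj) inf_le_right (hX.res hV) (hY.res hV)
    (hXX'.res hV) (hYY'.res hV) ⟨e, he⟩
  rw [← h1, ← g.form_res hV] at h2
  exact h2

/-- As functions of `x`, both sides vanish on scalars, equal `d` on vectors and obey the same
product rule. Hence the reduction of ∂̂_β f is the coefficient of e_β^* in the degree-one part of
`f`. -/
theorem algebraMapInv_contractLeft {W : Type*} [AddCommGroup W] [Module ℝ W]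
    (d : Module.Dual ℝ W) (x : ExteriorAlgebra ℝ W) :
    (ExteriorAlgebra.algebraMapInv (CliffordAlgebra.contractLeft d x) : ℝ) =
      d (ExteriorAlgebra.ιInv x) := by
  induction x using ExteriorAlgebra.induction with
  | algebraMap r =>
    rw [CliffordAlgebra.contractLeft_algebraMap, ιInv_algebraMap, map_zero, map_zero]
  | ι v => rw [CliffordAlgebra.contractLeft_ι, ιInv_ι, algebraMapInv_algebraMap]
  | mul a b ha hb =>
    rw [contractLeft_mul, map_add, map_mul, map_mul, ha, hb, ιInv_mul, map_add, map_smul, map_smul,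
      algebraMapInv_involute, smul_eq_mul, smul_eq_mul]
    ring
  | add a b ha hb => rw [map_add, map_add, map_add, map_add, ha, hb]

theorem BundleCoords.psi_of_odd_eq_sum (c : BundleCoords n m E) {f : SuperFun n m E c.U}
    (hf : f.HasParity 1) (e : preim m E c.U) :
    f.psi e = ∑ β, c.coord (.inr β) e * ((c.superFrame (.inr β)).app f).red (proj e) := by
  rw [SuperFun.psi_of_odd hf]
  refine (congrArg (fun q : Module.Dual ℝ (E (proj e : c.U)) => q e.1.snd)
    (c.dual_eq_sum (proj e) (f.lin (proj e)))).trans ?_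
  refine (LinearMap.sum_apply _ _ _).trans (Finset.sum_congr rfl fun β _ => ?_)
  refine (mul_comm _ _).trans (congrArg (_ * ·) ?_)
  exact (algebraMapInv_contractLeft
    (Module.Dual.eval ℝ (E (proj e : c.U)) (c.dualFrame β (proj e))) (f.1 (proj e))).symm

end InducedForm

end SplitSuper

end

/-! ### The metric coefficients for the two parities. -/

theorem lemma3p6 (n m : ℕ) {M : Type*} [TopologicalSpace M] [T2Space M]
    [SecondCountableTopology M] [ChartedSpace (EuclideanSpace ℝ (Fin n)) M]
    [IsManifold (𝓡 n) ∞ M]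
    (E : M → Type*) [∀ x, AddCommGroup (E x)] [∀ x, Module ℝ (E x)]
    [∀ x, TopologicalSpace (E x)]
    [TopologicalSpace (TotalSpace (EuclideanSpace ℝ (Fin m)) E)]
    [FiberBundle (EuclideanSpace ℝ (Fin m)) E] [VectorBundle ℝ (EuclideanSpace ℝ (Fin m)) E]
    [ContMDiffVectorBundle ∞ (EuclideanSpace ℝ (Fin m)) E (𝓡 n)]
    (p : ZMod 2) (g : SplitSuper.SuperMetric n m E p) :
    -- the induced form exists and is unique
    (∃! G : SplitSuper.SymmForm (SplitSuper.Tot m E) (SplitSuper.totModel n m),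
      SplitSuper.IsInduced g G) ∧
    ∀ c : SplitSuper.BundleCoords n m E,
      -- the coordinate (super-)derivations exist and are unique
      (∃! D : Fin n ⊕ Fin m → SplitSuper.SuperVect n m E c.U, c.IsSuperFrame D) ∧
      (∃! d : Fin n ⊕ Fin m →
        SplitSuper.Vect (SplitSuper.totModel n m) (SplitSuper.preim m E c.U), c.IsFrame d) ∧
      -- the metric coefficients of the induced form
      ∀ (G : SplitSuper.SymmForm (SplitSuper.Tot m E) (SplitSuper.totModel n m))
        (D : Fin n ⊕ Fin m → SplitSuper.SuperVect n m E c.U)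
        (d : Fin n ⊕ Fin m →
          SplitSuper.Vect (SplitSuper.totModel n m) (SplitSuper.preim m E c.U)),
        SplitSuper.IsInduced g G → c.IsSuperFrame D → c.IsFrame d →
        ∀ e : SplitSuper.preim m E c.U,
          (p = 0 →
            (∀ i j, G.form _ (d (.inl i)) (d (.inl j)) e =
              (g.form c.U (D (.inl i)) (D (.inl j))).red (SplitSuper.proj e)) ∧
            (∀ i α, G.form _ (d (.inl i)) (d (.inr α)) e = 0) ∧
            (∀ α i, G.form _ (d (.inr α)) (d (.inl i)) e = 0) ∧
            (∀ α β, G.form _ (d (.inr α)) (d (.inr β)) e = 0)) ∧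
          (p = 1 →
            (∀ i j, G.form _ (d (.inl i)) (d (.inl j)) e =
              ∑ β, c.coord (.inr β) e *
                ((D (.inr β)).1 ⟨c.U, le_rfl⟩
                  (g.form c.U (D (.inl i)) (D (.inl j)))).red (SplitSuper.proj e)) ∧
            (∀ i α, G.form _ (d (.inl i)) (d (.inr α)) e =
              -(g.form c.U (D (.inl i)) (D (.inr α))).red (SplitSuper.proj e)) ∧
            (∀ α i, G.form _ (d (.inr α)) (d (.inl i)) e =
              -(g.form c.U (D (.inr α)) (D (.inl i))).red (SplitSuper.proj e)) ∧
            (∀ α β, G.form _ (d (.inr α)) (d (.inr β)) e = 0)) := by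
  refine ⟨?_, fun c => ⟨?_, ?_, ?_⟩⟩
  · obtain ⟨G, hG⟩ := SplitSuper.exists_isInduced g
    exact ⟨G, hG, fun G' hG' => hG'.unique hG⟩
  · exact ⟨_, c.isSuperFrame_superFrame, fun D hD => hD.eq⟩
  · exact ⟨_, c.isFrame_frame, fun d hd => hd.eq⟩
  · intro G D d hG hD hd e
    have hD' := hD.eq
    have hd' := hd.eq
    -- By uniqueness the given frames are the constructed ones, for which the coefficients of the
    -- induced form are already known.
    subst hD' hd'
    have hc : ∀ r s, G.form _ (c.totCoords.frame r) (c.totCoords.frame s) e =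
        g.inducedCoeff c r s e := fun r s => congrArg
      (fun q : SplitSuper.Smooth (SplitSuper.totModel n m) (SplitSuper.preim m E c.U) => q e)
      (hG.form_frame c r s)
    -- No sign appears because ∂̂ᵢ is even. Hence the formula for g_αi is that for g_iα.
    have hcomm : ∀ i α, g.form c.U (c.superFrame (.inr α)) (c.superFrame (.inl i)) =
        g.form c.U (c.superFrame (.inl i)) (c.superFrame (.inr α)) := fun i α =>
      (g.form_comm_of_even (c.superFrame_inl_parity i) (c.superFrame_inr_parity α)).symm
    refine ⟨?_, ?_⟩
    · rintro rfl
      -- For an even metric g_iα is odd, so its reduction vanishes.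
      have h0 : ∀ i α, (SplitSuper.sgn 0 • (g.form c.U (c.superFrame (.inl i))
          (c.superFrame (.inr α))).redS.pull : SplitSuper.Smooth (SplitSuper.totModel n m)
            (SplitSuper.preim m E c.U)) e = 0 := fun i α =>
        mul_eq_zero_of_right _ (SplitSuper.SuperFun.red_of_odd
          (g.form_parity c.U 0 1 _ _ (c.superFrame_inl_parity i) (c.superFrame_inr_parity α)) _)
      refine ⟨fun i j => (hc _ _).trans ?_, fun i α => (hc _ _).trans (h0 i α),
        fun α i => (hc _ _).trans (h0 i α), fun α β => hc _ _⟩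
      exact SplitSuper.SuperFun.psi_of_even
        (g.form_parity c.U 0 0 _ _ (c.superFrame_inl_parity i) (c.superFrame_inl_parity j)) e
    · rintro rfl
      have h1 : ∀ i α, (SplitSuper.sgn 1 • (g.form c.U (c.superFrame (.inl i))
          (c.superFrame (.inr α))).redS.pull : SplitSuper.Smooth (SplitSuper.totModel n m)
            (SplitSuper.preim m E c.U)) e = -(g.form c.U (c.superFrame (.inl i))
          (c.superFrame (.inr α))).red (SplitSuper.proj e) := fun i α => by
        rw [SplitSuper.sgn_one, neg_one_smul]
        rfl
      refine ⟨fun i j => (hc _ _).trans ?_, fun i α => (hc _ _).trans (h1 i α),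
        fun α i => (hc _ _).trans ((h1 i α).trans (by rw [hcomm])), fun α β => hc _ _⟩
      -- For an odd metric g_ij is odd, so ψ ∘ pr retains only its degree-one part, written in the
      -- coframe.
      exact c.psi_of_odd_eq_sum
        (g.form_parity c.U 0 0 _ _ (c.superFrame_inl_parity i) (c.superFrame_inl_parity j)) e
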